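/- **Setting.** A contextuality game $G$ consists of a finite set $Q$ of questions, a finite non-empty set $A\subset\mathbb R$ of answers, a collection $C^{all}$ of non-empty contexts $C\subseteq Q$, a distribution $\mathcal D$ on $C^{all}$ (write $\Pr(C)$ for its weights) and a predicate $\mathrm{pred}(\mathbf a,C)\in\{0,1\}$ for $C\in C^{all}$, $\mathbf a\in A^C$. A strategy $P(\mathbf a\mid C)$ has the value $\sum_{C}\Pr(C)\sum_{\mathbf a}P(\mathbf a\mid C)\,\mathrm{pred}(\mathbf a,C)$. $\mathrm{valNC}$ is the supremum of the values over convex combinations of truth tables $\tau:Q\to A$ (answering $\tau|_C$ in context $C$). A quantum strategy $(\psi,\mathbf O)$ is a unit vector $\psi$ of a Hilbert space with self-adjoint operators $O_q$, $q\in Q$, whose spectra lie in $A$ and which commute within every context; its $P(\cdot\mid C)$ is the joint measurement distribution of $\{O_q\}_{q\in C}$ on $\psi$. $\mathrm{valQu}$ is the supremum of their values. **Primitives.** Let $\mathsf{QFHE}$ be a quantum homomorphic encryption scheme, for all quantum circuits of size independent of the security parameter $\lambda$, in which the ciphertext of an $n$-qubit state $\phi$ has the form $(U_k\phi,\hat k)$,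 where $\{U_k\}_{k\in K(n)}$ is, up to global phases, a finite group indexed by a group $K(n)$, its elements map basis states to basis states up to phase (so that ciphertexts of classical strings are classical), and $\hat k$ is a classical ciphertext from which the secret key recovers $k$ by a PPT algorithm. It is assumed that (i) for every circuit $C$, decrypting a homomorphic evaluation of $C$ gives the output of $C$ up to a negligible trace distance (*correctness*); (ii) no PPT algorithm distinguishes encryptions of two strings of equal polynomial length with non-negligible advantage (*security*); (iii) classical circuits can be evaluated on classical ciphertexts by a PPT algorithm $\mathsf{cEval}$ with the same output distribution as $\mathsf{Eval}$ (*classical evaluation*). Let $\mathsf{OPad}$ be an oblivious pad for the same unitaries $\{U_k\}_{k\in K(n)}$: $\mathsf{Gen}(1^\lambda)$ is PPT and returns $(pk,sk)$; $\mathsf{Enc}(pk,\phi)$ is QPT and returns an $n$-qubit state and a string $s$; $\mathsf{Dec}(sk,s)\in K(n)$ is deterministic and polynomial time. It is assumed that, up to a negligible trace distance, the state returned is $U_k\phi$ with $k=\mathsf{Dec}(sk,s)$ (*correctness*); that no PPT adversary which is given $pk$, outputs a string $s$, and then receives either $\mathsf{Dec}(sk,s)$ or a uniformly random element of $K(n)$,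 each with probability $\tfrac12$, guesses which one it received with probability more than $\tfrac12+\mathrm{negl}(\lambda)$ (*soundness*); and that a PPT algorithm $\mathsf{Samp}(pk)$ returns strings whose distribution, jointly with $pk$, is statistically negligibly close to that of the string returned by $\mathsf{Enc}(pk,\phi)$, for every $\phi$ (*classical range sampling*). **The compiled game $G'_\lambda$ ($(|C|,1)$ compiler).** (1) The verifier samples $sk\leftarrow\mathsf{QFHE.Gen}(1^\lambda)$, $C\leftarrow\mathcal D$, $c\leftarrow\mathsf{QFHE.Enc}_{sk}(C)$, $(pk',sk')\leftarrow\mathsf{OPad.Gen}(1^\lambda)$ and sends $(c,pk')$. (2) The prover replies with $(c_{\mathbf a},\hat k'',s')$. (3) The verifier decrypts $k''$ from $\hat k''$, puts $k'=\mathsf{OPad.Dec}(sk',s')$ and $k=k'k''$, so that $U_k=U_{k'}U_{k''}$ up to phase, samples $q\in C$ uniformly and sends $(q,k)$ in the clear. (4) The prover replies with an answer $a$. The verifier accepts iff $c_{\mathbf a}$ decrypts to some $\mathbf a\in A^C$ with $\mathrm{pred}(\mathbf a,C)=1$ and $\mathbf a[q]=a$. The honest prover with a strategy $S=(\psi,\mathbf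 O)$ on $n$ qubits homomorphically measures $\{O_q\}_{q\in C}$ on $\psi$, which gives $c_{\mathbf a}$ and $(U_{k''}\psi_{\mathbf aC},\hat k'')$, where $\psi_{\mathbf aC}$ is the post-measurement state, applies the oblivious pad to $U_{k''}\psi_{\mathbf aC}$, which gives $(U_{k'}U_{k''}\psi_{\mathbf aC},s')$, and finally measures $U_kO_qU_k^\dagger$ to obtain $a$. **Faithfulness.** The protocol $G'$ is called faithful to $G$ with parameters $s,c$, with respect to the procedure that maps a quantum strategy $S$ on $n$ qubits to the honest prover with $S$ and to the maps which, using the verifier's secrets, read the encrypted message $c$ as the context $C$, the message $q$ as a question, and encode answers as encryptions $c_{\mathbf a}$ resp. as clear answers $a$ (all other messages being auxiliary), if the following hold, all up to negligible additive errors: * *Well-formedness.* Whatever the prover does, the questions asked in an execution lie in one common context. The honest prover with $S$ is QPT for every $S$. If $S$ and $S'$ have the same state and the same observables for $q\in C$, then for executions in which only questions from $C$ are asked, the transcripts (including the verdict) with the respective honest provers have the same distribution. * *Soundness with respect to simulators.* A classical simulator answers all questions from a truth table $\tau$ and produces the auxiliary messages by an arbitrary randomised strategy that sees only the messages. Every such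 simulator wins with probability at most $s$. * *Decision faithfulness.* Against a classical simulator with truth table $\tau$, if the set of the questions asked is a context $C$, then the verdict is $\mathrm{pred}(\tau|_C,C)$; if it is not a context, the verifier accepts. * *Quantum completeness.* Some honest prover wins with probability $c$ (with error at most negligible). For every $S$ there is a strategy for the auxiliary messages such that the quantum simulator, which answers the questions by measuring the observables of $S$, first on $\psi$ and then on the post-measurement state, has the same transcript distribution as the honest prover with $S$. * *Classical completeness.* If all observables of $S$ commute, some PPT prover has the same transcript distribution as the honest prover with $S$. **Theorem.** Let $G$ be a contextuality game with $\mathrm{valNC}<1$, let $\mathsf{QFHE}$ and $\mathsf{OPad}$ be as above, and let $S$ be a quantum strategy on $n$ qubits with value $\mathrm{valQu}$. Let $\mathrm{const}_1=\min_{C\in C^{all}}\Pr(C)/|C|$. Then: 1. (Completeness) The honest prover with $S$ is QPT, and there is a negligible function $\mathrm{negl}$ such that for all $\lambda$ it wins $G'_\lambda$ with probability at least $\mathrm{valQu}-\mathrm{negl}(\lambda)$. 2. (Soundness) For every PPT prover (which may also use one sample from a fixed finite distribution) there is a negligible function $\mathrm{negl}'$ such that for all $\lambda$ it wins $G'_\lambda$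 with probability at most $1-\mathrm{const}_1+\mathrm{negl}'(\lambda)$. 3. (Faithfulness) If moreover the form of encryption of $\mathsf{QFHE}$ persists under evaluation, that is, if for every circuit $C$ the homomorphic evaluation of $C$ on any ciphertext is distributed, up to a negligible trace distance, as a fresh encryption of the output of $C$, then the compiled game is faithful to $G$ with parameters $1-\mathrm{const}_1$ and $\mathrm{valQu}$. -/

import Mathlib

open scoped ENNReal ComplexOrder

noncomputable section

namespace Contextuality

/-! ### Discrete probability -/

/-- The probability distribution proportional to the weights `f`
(a fixed point mass when `f` has total weight `0` or `∞`). -/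
def sampleBy {ι : Type*} [Nonempty ι] (f : ι → ℝ≥0∞) : PMF ι :=
  open scoped Classical in
  if h : (∑' i, f i) ≠ 0 ∧ (∑' i, f i) ≠ ∞ then PMF.normalize f h.1 h.2
  else PMF.pure (Classical.arbitrary ι)

/-- Expected value of a bounded function. -/
def expect {α : Type*} (p : PMF α) (f : α → ℝ) : ℝ := ∑' a, (p a).toReal * f a

/-- Probability of an event. -/
def Pr {α : Type*} (p : PMF α) (E : α → Prop) : ℝ := (p.toOuterMeasure {a | E a}).toReal

/-- Total variation (statistical) distance. -/
def tv {α : Type*} (p q : PMF α) : ℝ := (1 / 2) * ∑' a, |(p a).toReal - (q a).toReal|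

/-- A negligible function: it decays faster than every inverse polynomial. -/
def Negligible (ε : ℕ → ℝ) : Prop :=
  Asymptotics.SuperpolynomialDecay Filter.atTop (fun l : ℕ => (l : ℝ)) ε

/-! ### Data and qubits -/

/-- The data on which algorithms operate: finite binary trees.  Bit strings, numbers and pairs
are particular trees. -/
inductive Data : Type
  | nil : Data
  | node : Data → Data → Data

namespace Data

/-- Number of vertices of the tree. -/
def size : Data → ℕ
  | nil => 1
  | node a b => 1 + a.size + b.size

def fst : Data → Data
  | nil => nil
  | node a _ => a

def snd : Data → Data
  | nil => nil
  | node _ b => b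

def toList : Data → List Data
  | nil => []
  | node a b => a :: b.toList

def ofList : List Data → Data
  | [] => nil
  | a :: l => node a (ofList l)

/-- A bit as a tree. -/
def bit (b : Bool) : Data := if b then node nil nil else nil

/-- The unary number `1 ^ n`. -/
def unary (n : ℕ) : Data := ofList (List.replicate n nil)

/-- The number of entries of a list, i.e. the value of a unary number. -/
def toNat (x : Data) : ℕ := x.toList.length

end Data

/-- Bit strings of length `n`. -/
abbrev Bits (n : ℕ) : Type := Fin n → Bool

/-- A bit string as a tree. -/
def ofBits {n : ℕ} (x : Bits n) : Data := Data.ofList (List.ofFn fun i => Data.bit (x i))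

/-- Reading `n` bits (missing bits are read as `0`). -/
def toBits (n : ℕ) (d : Data) : Bits n :=
  open scoped Classical in fun i => decide (d.toList.getD i Data.nil ≠ Data.nil)

/-- Vectors of `n` qubits; they need not be normalised, a nonzero vector stands for its ray. -/
abbrev Ket (n : ℕ) : Type := Bits n → ℂ

/-- The computational basis state. -/
def basisKet {n : ℕ} (x : Bits n) : Ket n := Pi.single x 1

abbrev Unitary (n : ℕ) : Type := Matrix.unitaryGroup (Bits n) ℂ

/-- Action of a matrix on a vector of qubits. -/
def act {n : ℕ} (U : Matrix (Bits n) (Bits n) ℂ) (φ : Ket n) : Ket n := U.mulVec φ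

/-- A quantum memory with infinitely many qubits.  The basis state `S` has the qubits in the
finite set `S` equal to `1` and the other ones equal to `0`. -/
abbrev QMem : Type := Finset ℕ → ℂ

namespace QMem

/-- All qubits are `0`. -/
def vac : QMem := Pi.single ∅ 1

/-- Genuine states: nonzero finite superpositions of basis states. -/
def Valid (v : QMem) : Prop := (Function.support v).Finite ∧ v ≠ 0

/-- A measurement of all qubits in the computational basis. -/
def born (v : QMem) : PMF (Finset ℕ) := sampleBy fun S => ENNReal.ofReal (‖v S‖ ^ 2)

/-- The values of the qubits `w 0, …, w (k - 1)` in the basis state `S`. -/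
def read {k : ℕ} (w : Fin k → ℕ) (S : Finset ℕ) : Bits k := fun i => decide (w i ∈ S)

/-- The basis state `S` with the qubits `w 0, …, w (k - 1)` replaced by `y`. -/
def write {k : ℕ} (w : Fin k → ℕ) (y : Bits k) (S : Finset ℕ) : Finset ℕ :=
  (S \ Finset.univ.image w) ∪ (Finset.univ.filter fun i => y i = true).image w

/-- Apply the matrix `U` to the qubits `w 0, …, w (k - 1)`
(nothing happens if these are not distinct). -/
def gate {k : ℕ} (U : Matrix (Bits k) (Bits k) ℂ) (w : Fin k → ℕ) (v : QMem) : QMem :=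
  open scoped Classical in
  if Function.Injective w then fun S => ∑ y : Bits k, U (read w S) y * v (write w y S) else v

/-- Measure qubit `i`: the outcome and the post-measurement state. -/
def measure (i : ℕ) (v : QMem) : PMF (Bool × QMem) :=
  (born v).map fun S =>
    (decide (i ∈ S), fun S' => if (i ∈ S' ↔ i ∈ S) then v S' else 0)

/-- Discard the qubits `m, m + 1, …`: they are measured, the outcomes are forgotten and the
qubits are reset to `0`. -/
def clear (m : ℕ) (v : QMem) : PMF QMem :=
  (born v).map fun S S' =>
    if S' ⊆ Finset.range m then v (S' ∪ S.filter fun i => m ≤ i) else 0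

/-- The state `ξ ⊗ φ` on the first `a + n` qubits. -/
def load₂ {a n : ℕ} (ξ : Ket a) (φ : Ket n) : QMem := fun S =>
  if S ⊆ Finset.range (a + n) then
    ξ (read (fun i : Fin a => (i : ℕ)) S) * φ (read (fun i : Fin n => a + (i : ℕ)) S)
  else 0

/-- The state `φ` on the first `n` qubits. -/
def load {n : ℕ} (φ : Ket n) : QMem := fun S =>
  if S ⊆ Finset.range n then φ (read (fun i : Fin n => (i : ℕ)) S) else 0

/-- The state of the first `m` qubits when all other qubits are `0`. -/
def ket (m : ℕ) (v : QMem) : Ket m := fun x => v (write (fun i : Fin m => (i : ℕ)) x ∅)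

end QMem

/-! ### Algorithms

A while-language on trees with coin tosses, whose programs may also act on a quantum memory.
Every executed instruction is charged `1` plus the size of the data it works on. -/

inductive Prog : Type
  | id : Prog
  | nil : Prog
  | fst : Prog
  | snd : Prog
  /-- first `f`, then `g`, on the same input; returns the pair of the results -/
  | pair (f g : Prog) : Prog
  /-- first `f`, then `g` on its result -/
  | seq (f g : Prog) : Prog
  /-- run `c`; on the original input run `f` if the result is not `nil`, and `g` otherwise -/
  | ite (c f g : Prog) : Prog
  /-- while the first component of the data is not `nil`, run `f` -/
  | loop (f : Prog) : Prog
  /-- a fair random bit -/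
  | coin : Prog
  /-- apply a fixed unitary to the qubits whose addresses are listed (in unary) in the input -/
  | gate (k : ℕ) (U : Unitary k) : Prog
  /-- measure the qubit whose address is given in unary -/
  | meas : Prog
  /-- discard all qubits from the given (unary) address on -/
  | clear : Prog

namespace Prog

/-- `none` if the run was cut off; otherwise the result, the quantum memory and the cost. -/
abbrev Res : Type := Option ((Data × QMem) × ℕ)

def done (c : ℕ) (x : Data) (v : QMem) : PMF Res := PMF.pure (some ((x, v), c))

/-- Continue a run, adding up the costs. -/
def andThen (p : PMF Res) (f : Data → QMem → PMF Res) : PMF Res :=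
  p.bind fun r => match r with
    | none => PMF.pure none
    | some ((x, v), c) => (f x v).map (Option.map fun s => (s.1, c + s.2))

/-- At most `n - 1` iterations of `body`. -/
def iter (body : Data → QMem → PMF Res) : ℕ → Data → QMem → PMF Res
  | 0, _, _ => PMF.pure none
  | n + 1, x, v =>
    match x.fst with
    | Data.nil => done (1 + x.size) x v
    | Data.node _ _ =>
      andThen (done (1 + x.size) x v) fun x v => andThen (body x v) (iter body n)

/-- Execution on data `x` and memory `v`; runs in which some loop does not stop before its
`n`-th test of the loop condition are cut off. -/
def exec : Prog → ℕ → Data → QMem → PMF Res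
  | id, _, x, v => done (1 + x.size) x v
  | nil, _, x, v => done (1 + x.size) Data.nil v
  | fst, _, x, v => done (1 + x.size) x.fst v
  | snd, _, x, v => done (1 + x.size) x.snd v
  | pair f g, n, x, v =>
    andThen (exec f n x v) fun y v => andThen (exec g n x v) fun z v =>
      done (1 + x.size) (Data.node y z) v
  | seq f g, n, x, v =>
    andThen (done (1 + x.size) x v) fun x v => andThen (exec f n x v) fun y v => exec g n y v
  | ite c f g, n, x, v =>
    andThen (done (1 + x.size) x v) fun x v => andThen (exec c n x v) fun y v =>
      match y with
      | Data.nil => exec g n x v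
      | Data.node _ _ => exec f n x v
  | loop f, n, x, v => iter (fun y w => exec f n y w) n x v
  | coin, _, x, v =>
    (PMF.uniformOfFintype Bool).bind fun b => done (1 + x.size) (Data.bit b) v
  | gate k U, _, x, v =>
    done (1 + x.size) x
      (QMem.gate (U : Matrix (Bits k) (Bits k) ℂ)
        (fun i : Fin k => (x.toList.getD i Data.nil).toNat) v)
  | meas, _, x, v =>
    (QMem.measure x.toNat v).bind fun r => done (1 + x.size) (Data.bit r.1) r.2
  | clear, _, x, v => (QMem.clear x.toNat v).bind fun w => done (1 + x.size) x w

/-- The run with time bound `T`: `none` when the cost exceeds `T`. -/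
def within (p : Prog) (T : ℕ) (x : Data) (v : QMem) : PMF (Option (Data × QMem)) :=
  (exec p T x v).map fun r => r.bind fun s => if s.2 ≤ T then some s.1 else none

/-- Programs that do not touch the quantum memory. -/
def IsClassical : Prog → Prop
  | pair f g => IsClassical f ∧ IsClassical g
  | seq f g => IsClassical f ∧ IsClassical g
  | ite c f g => IsClassical c ∧ IsClassical f ∧ IsClassical g
  | loop f => IsClassical f
  | gate _ _ => False
  | meas => False
  | clear => False
  | _ => True

end Prog

/-- A quantum polynomial-time algorithm: a program which always stops within a number of steps
that is polynomial in the size of its classical input. -/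
structure QPT where
  prog : Prog
  time : Polynomial ℕ
  halts : ∀ x v, QMem.Valid v → none ∉ (prog.within (time.eval x.size) x v).support

namespace QPT

def run (A : QPT) (x : Data) (v : QMem) : PMF (Data × QMem) :=
  (A.prog.within (A.time.eval x.size) x v).map fun r => r.getD (Data.nil, v)

/-- The classical output together with the state of the first `m` qubits; all other qubits
are discarded. -/
def out (A : QPT) (m : ℕ) (x : Data) (v : QMem) : PMF (Data × Ket m) :=
  (A.run x v).bind fun r => (QMem.clear m r.2).map fun w => (r.1, QMem.ket m w)

end QPT

/-- A probabilistic polynomial-time algorithm. -/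
structure PPT extends QPT where
  classical : prog.IsClassical

def PPT.run (A : PPT) (x : Data) : PMF Data := (A.toQPT.run x QMem.vac).map Prod.fst

/-- `A` computes the function `f`. -/
def PPT.Computes (A : PPT) (f : Data → Data) : Prop := ∀ x, A.run x = PMF.pure (f x)

/-! ### Closeness of states

An ensemble `p : PMF (X × Ket n)` describes a classical value in `X` together with an `n`-qubit
(in general mixed) state. -/

/-- Measurement effects `0 ≤ E ≤ 1`. -/
def Effect {n : ℕ} (E : Matrix (Bits n) (Bits n) ℂ) : Prop :=
  E.PosSemidef ∧ (1 - E).PosSemidef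

/-- The probability `⟨φ|E|φ⟩ / ⟨φ|φ⟩`. -/
def effectProb {n : ℕ} (E : Matrix (Bits n) (Bits n) ℂ) (φ : Ket n) : ℝ :=
  (dotProduct (star φ) (E.mulVec φ)).re / ∑ x, ‖φ x‖ ^ 2

/-- The trace distance of the two classical-quantum states is at most `ε`.  (The trace distance
`½ tr |ρ - σ|` is the maximum of `|tr E (ρ - σ)|` over all effects `E`; on classical-quantum
states an effect is a family of effects indexed by the classical value.) -/
def TraceClose {X : Type} {n : ℕ} (ε : ℝ) (p q : PMF (X × Ket n)) : Prop :=
  ∀ E : X → Matrix (Bits n) (Bits n) ℂ, (∀ x, Effect (E x)) →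
    |expect p (fun r => effectProb (E r.1) r.2) - expect q (fun r => effectProb (E r.1) r.2)| ≤ ε

/-! ### Quantum circuits -/

/-- A quantum circuit on `a + n` input qubits with `cbits` classical (measured) output bits,
`qbits` output qubits and `rest` discarded qubits.  With the ancillas absorbed, a circuit over
arbitrary gates is an isometry, see `Circuit.IsCircuit`. -/
structure Circuit (a n : ℕ) where
  cbits : ℕ
  qbits : ℕ
  rest : ℕ
  V : Matrix (Bits cbits × Bits qbits × Bits rest) (Bits a × Bits n) ℂ

namespace Circuit

variable {a n : ℕ}

def IsCircuit (C : Circuit a n) : Prop := C.V.conjTranspose * C.V = 1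

/-- The output on the input state `ξ ⊗ φ`. -/
def apply (C : Circuit a n) (ξ : Ket a) (φ : Ket n) : PMF (Bits C.cbits × Ket C.qbits) :=
  let χ := C.V.mulVec fun i => ξ i.1 * φ i.2
  (sampleBy fun o => ENNReal.ofReal (‖χ o‖ ^ 2)).map fun o =>
    (o.1, fun y => χ (o.1, y, o.2.2))

/-- The classical circuit `|x⟩ ↦ |f x⟩ |x⟩`, with output `f x`. -/
def ofFun {n l : ℕ} (f : Bits n → Bits l) : Circuit 0 n where
  cbits := l
  qbits := 0
  rest := n
  V := fun o i => if o.1 = f i.2 ∧ o.2.2 = i.2 then 1 else 0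

end Circuit

/-! ### Quantum homomorphic encryption -/

/-- The syntax of a quantum fully homomorphic encryption scheme in which an `n`-qubit state `φ`
is encrypted as `(U k φ, k̂)`, where `k̂` is a classical encryption of `k`. -/
structure QFHE where
  /-- the pads of `n`-qubit states form a finite group, up to global phases -/
  K : ℕ → Type
  [group : ∀ n, Group (K n)]
  [fintype : ∀ n, Fintype (K n)]
  keyCode : ∀ n, K n → Data
  keyCode_inj : ∀ n, Function.Injective (keyCode n)
  U : ∀ n, K n → Unitary n
  U_mul : ∀ n (k l : K n), ∃ z : ℂ,
    (U n (k * l) : Matrix (Bits n) (Bits n) ℂ) = z • ((U n k * U n l : Unitary n) : Matrix _ _ ℂ)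
  /-- pads map classical states to classical states -/
  perm : ∀ n, K n → Bits n → Bits n
  U_basis : ∀ n (k : K n) (x : Bits n), ∃ z : ℂ,
    act (U n k : Matrix (Bits n) (Bits n) ℂ) (basisKet x) = z • basisKet (perm n k x)
  /-- key generation, on input `1 ^ λ` -/
  gen : PPT
  /-- the distribution of `(k, k̂)` in the encryption of an `n`-qubit state under a secret key -/
  pad : Data → ∀ n, PMF (K n × Data)
  /-- encryption of classical strings, on input `(sk, x)` -/
  enc : PPT
  /-- encryption of `n`-qubit states, on input `(sk, 1 ^ n)` -/
  encQ : QPT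
  /-- decryption of classical ciphertexts, on input `(sk, c)` -/
  dec : PPT
  decFun : Data → Data → Data
  /-- decryption of `k̂`, on input `(sk, (1 ^ n, k̂))` -/
  decKey : PPT
  decKeyFun : Data → ∀ n, Data → K n
  /-- homomorphic evaluation of a circuit, on classical input `(1 ^ λ, k̂)` and on the quantum
  input consisting of `a` plain qubits and of the `n` qubits of the ciphertext -/
  eval : ∀ {a n : ℕ}, Circuit a n → QPT
  /-- classical evaluation of classical circuits, on input `(1 ^ λ, c)` -/
  cEval : ∀ {n l : ℕ}, (Bits n → Bits l) → PPT

attribute [instance] QFHE.group QFHE.fintype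

namespace QFHE

variable (E : QFHE)

/-- The matrix of the pad `k`. -/
def padMatrix (n : ℕ) (k : E.K n) : Matrix (Bits n) (Bits n) ℂ := (E.U n k : Matrix _ _ ℂ)

/-- The possible secret keys for the security parameter `l`. -/
def IsKey (l : ℕ) (sk : Data) : Prop := sk ∈ (E.gen.run (Data.unary l)).support

/-- Encryption of quantum states: the classical part `k̂` and the padded state `U k φ`. -/
def encState {n : ℕ} (sk : Data) (φ : Ket n) : PMF (Data × Ket n) :=
  (E.pad sk n).map fun r => (r.2, act (E.padMatrix n r.1) φ)

/-- The classical encryption of the string `x`. -/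
def encBits {n : ℕ} (sk : Data) (x : Bits n) : PMF Data := E.enc.run (Data.node sk (ofBits x))

/-- All algorithms compute what they should, and ciphertexts have the form `(U k φ, k̂)`.
On a classical state `|x⟩` this is the classical string `(perm k x, k̂)`. -/
structure WellFormed : Prop where
  encState_eq : ∀ l sk, E.IsKey l sk → ∀ n (φ : Ket n), φ ≠ 0 →
    TraceClose 0 (E.encQ.out n (Data.node sk (Data.unary n)) (QMem.load φ)) (E.encState sk φ)
  encBits_eq : ∀ l sk, E.IsKey l sk → ∀ n (x : Bits n),
    E.encBits sk x = (E.pad sk n).map fun r => Data.node (ofBits (E.perm n r.1 x)) r.2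
  dec_eq : E.dec.Computes fun d => E.decFun d.fst d.snd
  decKey_eq : ∀ sk n kh, E.decKey.run (Data.node sk (Data.node (Data.unary n) kh)) =
    PMF.pure (E.keyCode n (E.decKeyFun sk n kh))

/-- Homomorphic evaluation of `C` with plain input `ξ` on the ciphertext `(U k φ, k̂)`.  The
output is a ciphertext: `c` encrypts the classical output bits, and `k̂'` and the output qubits
form the ciphertext of the quantum output. -/
def evalState {a n : ℕ} (C : Circuit a n) (l : ℕ) (k : E.K n) (kh : Data) (ξ : Ket a)
    (φ : Ket n) : PMF ((Data × Data) × Ket C.qbits) :=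
  ((E.eval C).out C.qbits (Data.node (Data.unary l) kh)
    (QMem.load₂ ξ (act (E.padMatrix n k) φ))).map fun r => ((r.1.fst, r.1.snd), r.2)

/-- Decryption of both parts of a ciphertext. -/
def decState {m : ℕ} (sk : Data) (r : (Data × Data) × Ket m) : Data × Ket m :=
  (E.decFun sk r.1.1,
    act (E.padMatrix m (E.decKeyFun sk m r.1.2)).conjTranspose r.2)

/-- Encryption of a classical string together with a quantum state. -/
def encBoth {c m : ℕ} (sk : Data) (r : Bits c × Ket m) : PMF ((Data × Data) × Ket m) :=
  (E.encBits sk r.1).bind fun cx => (E.encState sk r.2).map fun s => ((cx, s.1), s.2)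

/-- Correctness: decrypting the homomorphic evaluation of `C` gives the output of `C`. -/
def Correct : Prop :=
  ∀ {a n : ℕ} (C : Circuit a n), C.IsCircuit → ∃ ε, Negligible ε ∧
    ∀ l sk, E.IsKey l sk → ∀ r ∈ (E.pad sk n).support, ∀ (ξ : Ket a) (φ : Ket n),
      ξ ≠ 0 → φ ≠ 0 →
      TraceClose (ε l) ((E.evalState C l r.1 r.2 ξ φ).map (E.decState sk))
        ((C.apply ξ φ).map fun s => (ofBits s.1, s.2))

/-- Security: no probabilistic polynomial-time algorithm distinguishes encryptions of two
strings of the same polynomial length. -/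
def Secure : Prop :=
  ∀ (D : PPT) (len : Polynomial ℕ), ∃ ε, Negligible ε ∧
    ∀ (l : ℕ) (x₀ x₁ : Bits (len.eval l)),
      let game (x : Bits (len.eval l)) : PMF Data :=
        (E.gen.run (Data.unary l)).bind fun sk =>
          (E.encBits sk x).bind fun c => D.run (Data.node (Data.unary l) c)
      |Pr (game x₀) (· = Data.bit true) - Pr (game x₁) (· = Data.bit true)| ≤ ε l

/-- The form of encryption persists under evaluation: evaluating `C` on a ciphertext yields a
ciphertext of the output of `C`, i.e. (up to a negligible error) the result is distributed as an
encryption of that output. -/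
def EvalForm : Prop :=
  ∀ {a n : ℕ} (C : Circuit a n), C.IsCircuit → ∃ ε, Negligible ε ∧
    ∀ l sk, E.IsKey l sk → ∀ r ∈ (E.pad sk n).support, ∀ (ξ : Ket a) (φ : Ket n),
      ξ ≠ 0 → φ ≠ 0 →
      TraceClose (ε l) (E.evalState C l r.1 r.2 ξ φ) ((C.apply ξ φ).bind (E.encBoth sk))

/-- Classical evaluation of classical circuits: on classical ciphertexts, `cEval` and `eval`
have identical output distributions. -/
def ClassicalEval : Prop :=
  ∀ {n m : ℕ} (f : Bits n → Bits m) (l : ℕ) (sk : Data), E.IsKey l sk →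
    ∀ r ∈ (E.pad sk n).support, ∀ y : Bits n,
      (E.cEval f).run (Data.node (Data.unary l) (Data.node (ofBits y) r.2)) =
        ((E.eval (Circuit.ofFun f)).out 0 (Data.node (Data.unary l) r.2)
          (QMem.load₂ (basisKet Fin.elim0) (basisKet y))).map fun s => s.1.fst

end QFHE

/-! ### The oblivious pad -/

/-- The syntax of an oblivious pad for the unitaries `U k`, `k ∈ K`, on `n` qubits, where the
elements of `K` are written as data by `code`. -/
structure OPad (n : ℕ) (K : Type) (code : K → Data) where
  /-- key generation, on input `1 ^ λ`; returns `(pk, sk)` -/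
  gen : PPT
  /-- on input `pk` and an `n`-qubit state; returns a string and an `n`-qubit state -/
  enc : QPT
  /-- deterministic decoding, on input `(sk, s)` -/
  dec : PPT
  decFun : Data → Data → K
  dec_eq : ∀ sk s, dec.run (Data.node sk s) = PMF.pure (code (decFun sk s))
  /-- on input `pk`; returns a string -/
  samp : PPT

namespace OPad

variable {n : ℕ} {K : Type} {code : K → Data} (P : OPad n K code)

/-- Correctness: for the encryption `(σ, s)` of `φ`, the state `σ` is `U k φ`, where
`k = dec (sk, s)`. -/
def Correct (U : K → Unitary n) : Prop :=
  ∃ ε, Negligible ε ∧ ∀ (l : ℕ) (φ : Ket n), φ ≠ 0 →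
    let real : PMF ((Data × Data) × Ket n) :=
      (P.gen.run (Data.unary l)).bind fun keys =>
        (P.enc.out n keys.fst (QMem.load φ)).map fun r => ((keys, r.1), r.2)
    TraceClose (ε l) real
      (real.map fun r => (r.1, act (U (P.decFun r.1.1.snd r.1.2) : Matrix _ _ ℂ) φ))

/-- The soundness game.  The two stages `A₁`, `A₂` of the prover communicate through a state. -/
def game [Fintype K] [Nonempty K] (A₁ A₂ : PPT) (l : ℕ) : PMF Bool :=
  (P.gen.run (Data.unary l)).bind fun keys =>
    (A₁.run (Data.node (Data.unary l) keys.fst)).bind fun m =>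
      (PMF.uniformOfFintype Bool).bind fun b =>
        (PMF.uniformOfFintype K).bind fun k₀ =>
          (A₂.run (Data.node m.snd
            (code (if b then P.decFun keys.snd m.fst else k₀)))).map fun b' =>
              open scoped Classical in decide (b' = Data.bit b)

def Sound [Fintype K] [Nonempty K] : Prop :=
  ∀ A₁ A₂ : PPT, ∃ ε, Negligible ε ∧ ∀ l, Pr (P.game A₁ A₂ l) (· = true) ≤ 1 / 2 + ε l

/-- Classical range sampling: given `pk`, the string produced by `samp` is statistically close to
the one produced by `enc`. -/
def RangeSampling : Prop :=
  ∃ ε, Negligible ε ∧ ∀ (l : ℕ) (φ : Ket n), φ ≠ 0 →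
    tv ((P.gen.run (Data.unary l)).bind fun keys =>
          (P.samp.run keys.fst).map fun s => (keys.fst, s))
       ((P.gen.run (Data.unary l)).bind fun keys =>
          (P.enc.out n keys.fst (QMem.load φ)).map fun r => (keys.fst, r.1)) ≤ ε l

end OPad

/-! ### Contextuality games -/

/-- A contextuality game with question set `Q`. -/
structure Game (Q : Type) [Fintype Q] [DecidableEq Q] where
  A : Finset ℝ
  A_nonempty : A.Nonempty
  contexts : Finset (Finset Q)
  context_nonempty : ∀ C ∈ contexts, C.Nonempty
  D : PMF contexts
  pred : (C : Finset Q) → (C → A) → Bool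

variable {Q : Type} [Fintype Q] [DecidableEq Q]

namespace Game

instance (G : Game Q) : Nonempty G.A := G.A_nonempty.to_subtype

variable (G : Game Q)

/-- Strategies: `P C 𝐚` is the probability of the answers `𝐚` in the context `C`. -/
abbrev Strat : Type := (C : Finset Q) → (C → G.A) → ℝ

/-- The restriction of a truth table to a set of questions. -/
def restrict (τ : Q → G.A) (R : Finset Q) : R → G.A := fun q => τ q

def val (P : G.Strat) : ℝ :=
  ∑ C : G.contexts, ∑ a : C.1 → G.A, (if G.pred C.1 a then P C.1 a else 0) * (G.D C).toReal

def IsNC (P : G.Strat) : Prop :=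
  ∃ μ : PMF (Q → G.A), ∀ C ∈ G.contexts, ∀ a, P C a = Pr μ fun τ => G.restrict τ C = a

/-- The non-contextual value. -/
def valNC : ℝ := sSup {v | ∃ P, G.IsNC P ∧ v = G.val P}

end Game

/-- Quantum strategies `(ψ, 𝐎)` on the Hilbert space `H`. -/
structure QStrat (G : Game Q) (H : Type) [NormedAddCommGroup H] [InnerProductSpace ℂ H]
    [CompleteSpace H] where
  ψ : H
  norm_ψ : ‖ψ‖ = 1
  O : Q → H →L[ℂ] H
  selfAdjoint : ∀ q, IsSelfAdjoint (O q)
  spectrum_subset : ∀ q, spectrum ℂ (O q) ⊆ (fun r : ℝ => (r : ℂ)) '' (G.A : Set ℝ)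
  commute : ∀ C ∈ G.contexts, ∀ q ∈ C, ∀ q' ∈ C, Commute (O q) (O q')

namespace QStrat

variable {G : Game Q} {H : Type} [NormedAddCommGroup H] [InnerProductSpace ℂ H]
  [CompleteSpace H] (S : QStrat G H)

/-- The joint eigenspace of the observables in `R` for the eigenvalues `a`. -/
def eigen (R : Finset Q) (a : R → G.A) : Submodule ℂ H :=
  (ContinuousLinearMap.pi fun q : R =>
    S.O q - (((a q : ℝ) : ℂ) • ContinuousLinearMap.id ℂ H)).ker

instance (R : Finset Q) (a : R → G.A) : CompleteSpace (S.eigen R a) :=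
  ContinuousLinearMap.completeSpace_ker _

/-- The orthogonal projection onto the joint eigenspace. -/
def proj (R : Finset Q) (a : R → G.A) : H →L[ℂ] H := (S.eigen R a).starProjection

/-- The outcome of the joint measurement of the observables in `R` on the state `u`; the
post-measurement state for the outcome `a` is `S.proj R a u`. -/
def outcome (u : H) (R : Finset Q) : PMF (R → G.A) :=
  sampleBy fun a => ENNReal.ofReal (‖S.proj R a u‖ ^ 2)

/-- The strategy in the game: measure the observables of the context on `ψ`. -/
def strat : G.Strat := fun C a => ‖S.proj C a S.ψ‖ ^ 2

def val : ℝ := G.val S.strat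

end QStrat

namespace Game

variable (G : Game Q)

/-- The quantum value. -/
def valQu : ℝ :=
  sSup {v | ∃ (H : Type) (_ : NormedAddCommGroup H) (_ : InnerProductSpace ℂ H)
    (_ : CompleteSpace H) (S : QStrat G H), v = S.val}

/-- The constant `min_C Pr(C) / |C|`. -/
def const₁ : ℝ := ⨅ C : G.contexts, (G.D C).toReal / (C.1.card : ℝ)

end Game

/-! ### Four-message protocols

The messages are parsed as `(t₁, t₂)` from the verifier, `(t₃, t₄)` from the prover, `(t₅, t₆)`
from the verifier and `(t₇, t₈)` from the prover. -/

/-- The verifier of a protocol, for every value of the security parameter. -/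
structure Verifier where
  /-- private state after the first message -/
  State₁ : Type
  /-- further private state after the third message -/
  State₂ : Type
  init : ℕ → PMF (State₁ × Data × Data)
  next : State₁ → Data → Data → PMF (State₂ × Data × Data)
  verdict : State₁ → State₂ → Data → Data → Bool

/-- A party answering the messages; the type `I` is additional information that it gets. -/
structure Party (I : Type) where
  State : Type
  first : ℕ → I → Data → Data → PMF (Data × Data × State)
  second : State → I → Data → Data → PMF (Data × Data)

/-- Provers only see the messages. -/
abbrev Prover : Type 1 := Party Unit

def Prover.withInfo (P : Prover) (I : Type) : Party I where
  State := P.State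
  first l _ := P.first l ()
  second s _ := P.second s ()

/-- The eight messages and the verdict. -/
structure Transcript where
  t₁ : Data
  t₂ : Data
  t₃ : Data
  t₄ : Data
  t₅ : Data
  t₆ : Data
  t₇ : Data
  t₈ : Data
  accept : Bool

namespace Verifier

variable (V : Verifier)

/-- An execution: the private state of the verifier and the transcript. -/
def exec (P : Party V.State₁) (l : ℕ) : PMF (V.State₁ × Transcript) :=
  (V.init l).bind fun m₁ =>
    (P.first l m₁.1 m₁.2.1 m₁.2.2).bind fun m₂ =>
      (V.next m₁.1 m₂.1 m₂.2.1).bind fun m₃ =>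
        (P.second m₂.2.2 m₁.1 m₃.2.1 m₃.2.2).map fun m₄ =>
          (m₁.1, ⟨m₁.2.1, m₁.2.2, m₂.1, m₂.2.1, m₃.2.1, m₃.2.2, m₄.1, m₄.2,
            V.verdict m₁.1 m₃.1 m₄.1 m₄.2⟩)

def transcript (P : Party V.State₁) (l : ℕ) : PMF Transcript := (V.exec P l).map Prod.snd

/-- The probability that the verifier accepts. -/
def winProb (P : Party V.State₁) (l : ℕ) : ℝ := Pr (V.transcript P l) (·.accept = true)

end Verifier

/-- Probabilistic polynomial-time provers.  A prover may start from a sample of a fixed finite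
distribution (a constant sample is an ordinary prover), and its two stages communicate through a
state. -/
structure PPTProver where
  seed : PMF Data
  seed_finite : seed.support.Finite
  A₁ : PPT
  A₂ : PPT

def PPTProver.toProver (A : PPTProver) : Prover where
  State := Data
  first l _ t₁ t₂ :=
    A.seed.bind fun d =>
      (A.A₁.run (Data.node d (Data.node (Data.unary l) (Data.node t₁ t₂)))).map fun m =>
        (m.fst, m.snd.fst, m.snd.snd)
  second s _ t₅ t₆ :=
    (A.A₂.run (Data.node s (Data.node t₅ t₆))).map fun m => (m.fst, m.snd)

/-- The prover given by two quantum polynomial-time algorithms, which share classical data and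
the quantum memory. -/
def qptProver (A₁ A₂ : QPT) : Prover where
  State := Data × QMem
  first l _ t₁ t₂ :=
    (A₁.run (Data.node (Data.unary l) (Data.node t₁ t₂)) QMem.vac).map fun r =>
      (r.1.fst, r.1.snd.fst, (r.1.snd.snd, r.2))
  second s _ t₅ t₆ :=
    (A₂.run (Data.node s.1 (Data.node t₅ t₆)) s.2).map fun r => (r.1.fst, r.1.snd)

/-- The messages of a prover when it receives the given messages. -/
def Prover.behaviour (P : Prover) (l : ℕ) (t₁ t₂ t₅ t₆ : Data) : PMF ((Data × Data) × Data × Data) :=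
  (P.first l () t₁ t₂).bind fun m => (P.second m.2.2 () t₅ t₆).map fun r => ((m.1, m.2.1), r)

/-- The prover can be implemented in quantum polynomial time. -/
def Prover.IsQPT (P : Prover) : Prop :=
  ∃ A₁ A₂ : QPT, ∀ l t₁ t₂ t₅ t₆,
    P.behaviour l t₁ t₂ t₅ t₆ = (qptProver A₁ A₂).behaviour l t₁ t₂ t₅ t₆

/-! ### Faithfulness to a contextuality game -/

/-- The maps between messages and questions or answers of the game, in the presence of the
private state of the verifier: `t₁` and `t₅` encode (sets of) questions, `t₃` and `t₇` encode the
respective answers, and the other four messages are mapped to `⊥`. -/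
structure QAMaps (G : Game Q) (V : Verifier) where
  ask₁ : V.State₁ → Data → Finset Q
  ask₂ : V.State₁ → Data → Finset Q
  ans₁ : V.State₁ → (R : Finset Q) → (R → G.A) → PMF Data
  ans₂ : V.State₁ → (R : Finset Q) → (R → G.A) → PMF Data

/-- All questions asked in an execution. -/
def QAMaps.asked {G : Game Q} {V : Verifier} (M : QAMaps G V)
    (r : V.State₁ × Transcript) : Finset Q :=
  M.ask₁ r.1 r.2.t₁ ∪ M.ask₂ r.1 r.2.t₅

/-- The unrestricted part of a simulator: an arbitrary randomised strategy for `t₄` and `t₈`. -/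
structure Aux where
  State : Type
  first : (l : ℕ) → (t₁ t₂ t₃ : Data) → PMF (Data × State)
  second : State → (t₅ t₆ t₇ : Data) → PMF Data

/-- The classical simulator: questions are answered according to the truth table `τ`. -/
def ncSimulator {G : Game Q} {V : Verifier} (M : QAMaps G V) (τ : Q → G.A) (x : Aux) :
    Party V.State₁ where
  State := x.State
  first l s t₁ t₂ :=
    (M.ans₁ s (M.ask₁ s t₁) (G.restrict τ _)).bind fun t₃ =>
      (x.first l t₁ t₂ t₃).map fun r => (t₃, r.1, r.2)
  second u s t₅ t₆ :=
    (M.ans₂ s (M.ask₂ s t₅) (G.restrict τ _)).bind fun t₇ =>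
      (x.second u t₅ t₆ t₇).map fun t₈ => (t₇, t₈)

/-- The quantum simulator: questions are answered by measuring the observables of `S`, first on
the state of `S` and then on the post-measurement state. -/
def quSimulator {G : Game Q} {V : Verifier} {H : Type} [NormedAddCommGroup H]
    [InnerProductSpace ℂ H] [CompleteSpace H] (M : QAMaps G V) (S : QStrat G H) (x : Aux) :
    Party V.State₁ where
  State := x.State × H
  first l s t₁ t₂ :=
    (S.outcome S.ψ (M.ask₁ s t₁)).bind fun a =>
      (M.ans₁ s (M.ask₁ s t₁) a).bind fun t₃ =>
        (x.first l t₁ t₂ t₃).map fun r => (t₃, r.1, (r.2, S.proj _ a S.ψ))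
  second u s t₅ t₆ :=
    (S.outcome u.2 (M.ask₂ s t₅)).bind fun a =>
      (M.ans₂ s (M.ask₂ s t₅) a).bind fun t₇ =>
        (x.second u.1 t₅ t₆ t₇).map fun t₈ => (t₇, t₈)

/-- The protocol is faithful to `G` with parameters `s` and `c`, with respect to the maps `M` and
the procedure `qProver`; all requirements are up to negligible additive errors. -/
structure Faithful {H : Type} [NormedAddCommGroup H] [InnerProductSpace ℂ H] [CompleteSpace H]
    (G : Game Q) (V : Verifier) (M : QAMaps G V) (qProver : QStrat G H → Prover)
    (s c : ℝ) : Prop where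
  /-- well-formedness: in every execution the questions belong to one context -/
  wellFormed : ∃ ε, Negligible ε ∧ ∀ (P : Prover) (l : ℕ),
    Pr (V.exec (P.withInfo _) l) (fun r => ¬ ∃ C ∈ G.contexts, M.asked r ⊆ C) ≤ ε l
  /-- well-formedness: `qProver` produces quantum polynomial-time provers -/
  isQPT : ∀ S, (qProver S).IsQPT
  /-- the marginal requirement: when questions from `C` are asked, only the state and the
  observables in `C` matter -/
  marginal : ∀ S S' : QStrat G H, ∀ C ∈ G.contexts, S.ψ = S'.ψ → (∀ q ∈ C, S.O q = S'.O q) →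
    ∃ ε, Negligible ε ∧ ∀ (l : ℕ) (T : Set Transcript),
      |Pr (V.exec ((qProver S).withInfo _) l) (fun r => M.asked r ⊆ C ∧ r.2 ∈ T) -
        Pr (V.exec ((qProver S').withInfo _) l) (fun r => M.asked r ⊆ C ∧ r.2 ∈ T)| ≤ ε l
  /-- `G`-soundness -/
  soundness : ∃ ε, Negligible ε ∧ ∀ (τ : Q → G.A) (x : Aux) (l : ℕ),
    V.winProb (ncSimulator M τ x) l ≤ s + ε l
  /-- decision faithfulness: if the questions form a context then the verdict is given by the
  predicate, and otherwise the verifier accepts -/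
  decision : ∃ ε, Negligible ε ∧ ∀ (τ : Q → G.A) (x : Aux) (l : ℕ),
    Pr (V.exec (ncSimulator M τ x) l) (fun r => r.2.accept ≠
      if M.asked r ∈ G.contexts then G.pred (M.asked r) (G.restrict τ _) else true) ≤ ε l
  /-- quantum completeness: the value `c` is reached -/
  completeness : ∃ S, ∃ ε, Negligible ε ∧ ∀ l,
    |V.winProb ((qProver S).withInfo _) l - c| ≤ ε l
  /-- quantum completeness: the provers behave like quantum simulators -/
  simulation : ∀ S, ∃ x, ∃ ε, Negligible ε ∧ ∀ l,
    tv (V.transcript (quSimulator M S x) l) (V.transcript ((qProver S).withInfo _) l) ≤ ε l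
  /-- classical completeness: if all observables commute, a probabilistic polynomial-time prover
  produces the same transcript -/
  classicalCompleteness : ∀ S : QStrat G H, (∀ q q', Commute (S.O q) (S.O q')) →
    ∃ A : PPTProver, ∃ ε, Negligible ε ∧ ∀ l,
      tv (V.transcript (A.toProver.withInfo _) l)
        (V.transcript ((qProver S).withInfo _) l) ≤ ε l

/-! ### The `(|C|, 1)` compiler -/

/-- Encodings of contexts and answer vectors as bit strings of fixed lengths, and of questions
and answers as data. -/
structure Coding (G : Game Q) where
  ctxLen : ℕ
  ctx : Finset Q → Bits ctxLen
  ctx_inj : Set.InjOn ctx G.contexts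
  vecLen : ℕ
  vec : (C : Finset Q) → (C → G.A) → Bits vecLen
  vec_inj : ∀ C ∈ G.contexts, Function.Injective (vec C)
  que : Q → Data
  que_inj : Function.Injective que
  ans : G.A → Data
  ans_inj : Function.Injective ans

/-- The Hilbert space of `n` qubits. -/
abbrev QubitSpace (n : ℕ) : Type := EuclideanSpace ℂ (Bits n)

section Compiler

variable (G : Game Q) (E : QFHE) {n : ℕ} (P : OPad n (E.K n) (E.keyCode n)) (cd : Coding G)

/-- The private state of the verifier of the compiled game after the first message. -/
structure CompiledState where
  sk : Data
  padSk : Data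
  C : G.contexts

open scoped Classical in
/-- The verifier (challenger) of the compiled game. -/
def compiled : Verifier where
  State₁ := CompiledState G
  State₂ := Data × Q
  init l :=
    (E.gen.run (Data.unary l)).bind fun sk =>
      G.D.bind fun C =>
        (E.encBits sk (cd.ctx C.1)).bind fun c =>
          (P.gen.run (Data.unary l)).map fun keys => (⟨sk, keys.snd, C⟩, c, keys.fst)
  next s t₃ t₄ :=
    let k'' : E.K n := E.decKeyFun s.sk n t₄.fst
    let k' : E.K n := P.decFun s.padSk t₄.snd
    (PMF.uniformOfFinset s.C.1 (G.context_nonempty _ s.C.2)).map fun q =>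
      ((t₃, q), cd.que q, E.keyCode n (k' * k''))
  verdict s u t₇ _ :=
    decide (∃ a : s.C.1 → G.A, ofBits (cd.vec s.C.1 a) = E.decFun s.sk u.1 ∧
      G.pred s.C.1 a = true ∧ ∃ h : u.2 ∈ s.C.1, cd.ans (a ⟨u.2, h⟩) = t₇)

/-- The circuit that measures the observables of the context `C`, for the input `ξ ⊗ |C⟩`;
it returns the answers and the post-measurement state. -/
def measureCircuit {G : Game Q} (cd : Coding G) (S : QStrat G (QubitSpace n)) :
    Circuit n cd.ctxLen where
  cbits := cd.vecLen
  qbits := n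
  rest := cd.ctxLen
  V o i :=
    open scoped Classical in
    if o.2.2 ≠ i.2 then 0
    else if ∃ C ∈ G.contexts, cd.ctx C = i.2 then
      ∑ C ∈ G.contexts with cd.ctx C = i.2, ∑ a : C → G.A,
        if cd.vec C a = o.1 then (S.proj C a (EuclideanSpace.single i.1 1)) o.2.1 else 0
    else if o.1 = (fun _ => false) ∧ o.2.1 = i.1 then 1 else 0

/-- The honest prover with the quantum strategy `S`.  It measures the observables of the
encrypted context homomorphically, applies the oblivious pad to the encrypted post-measurement
state, and then measures `U k * O q * (U k)†`. -/
def honest (S : QStrat G (QubitSpace n)) : Prover where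
  State := Ket n
  first l _ t₁ t₂ :=
    ((E.eval (measureCircuit cd S)).out n (Data.node (Data.unary l) t₁.snd)
      (QMem.load₂ (S.ψ : QubitSpace n).ofLp (basisKet (toBits cd.ctxLen t₁.fst)))).bind fun r =>
        (P.enc.out n t₂ (QMem.load r.2)).map fun s =>
          (r.1.fst, Data.node r.1.snd s.1, s.2)
  second w _ t₅ t₆ :=
    let k : E.K n := (Function.partialInv (E.keyCode n) t₆).getD 1
    match Function.partialInv cd.que t₅ with
    | none => PMF.pure (Data.nil, Data.nil)
    | some q =>
      (S.outcome (WithLp.toLp 2 (act (E.padMatrix n k).conjTranspose w)) {q}).map fun a =>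
        (cd.ans (a ⟨q, Finset.mem_singleton_self q⟩), Data.nil)

open scoped Classical in
/-- The maps of the compiled game: `t₁` is an encrypted context, `t₃` are encrypted answers, `t₅`
is a question and `t₇` is an answer. -/
def compiledMaps : QAMaps G (compiled G E P cd) where
  ask₁ s t₁ := (G.contexts.filter fun C => ofBits (cd.ctx C) = E.decFun s.sk t₁).sup id
  ask₂ _ t₅ := Finset.univ.filter fun q => cd.que q = t₅
  ans₁ s R a := E.encBits s.sk (cd.vec R a)
  ans₂ _ R a := if h : ∃ q, q ∈ R then PMF.pure (cd.ans (a ⟨h.choose, h.choose_spec⟩))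
    else PMF.pure Data.nil

end Compiler

end Contextuality

end

open Contextuality

noncomputable section

namespace Contextuality

/-! ### Expected values -/

/-! Soundness is proved by rewinding the prover; completeness and faithfulness compare the execution
with idealised executions through a chain of hybrids.

Soundness. The second stage of a classical prover can be run on every question from one and the same
state, which yields a truth table (`extract`). As `valNC < 1`, every truth table violates the
predicate in some context, so the violation probabilities of the contexts sum to at least 1
(`one_le_sum_violation`). If the table violates the predicate in `C` while the encrypted answers
decrypt to a satisfying vector, the two differ at some question of `C`; hence the acceptance
probabilities over the questions of `C` sum to at most `|C|` minus the violation probability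
(`sum_Pr_accepts_le`). Two cryptographic steps make this usable. The key `k'k''` depends on secrets,
but by soundness of the oblivious pad `k'` may be replaced by a uniform element, and then `k'k''` is
uniform because `K n` is a group (`answerProb_real_le`). For a fixed key, the extraction is a PPT
experiment on the encrypted context, so by security its table hardly depends on which context was
encrypted (`violation_close`). Therefore the violations in the context that is really encrypted also
sum to at least 1 up to a negligible error, and the weights `Pr(C)/|C| ≥ const₁` turn this into the
bound (`seedValue_le`).

Honest prover. `measureCircuit` is an isometry that performs the joint measurement, so the decrypted
evaluation is close to the answers together with the post-measurement state. Correctness of the pad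
means that `U k'` was applied, the key `k'k''` undoes it, and range sampling makes `s'` independent
of the state (`hybrid`, `exec_honest_close`). The post-measurement state is a joint eigenvector, so
measuring `q` again repeats the answer, and the winning probability is close to the value of the
strategy. The prover is QPT because `n`, the questions and the pads are fixed finite data: case
distinctions are finite tables and all unitaries are hard-wired.

Faithfulness. If evaluated ciphertexts look fresh, the execution is close to `idealExec`, where the
observables are measured in the clear and the answers are then encrypted. Fresh ciphertexts decrypt
correctly because they resemble evaluated ones, which do (`QFHE.EvalForm.decBits`,
`QFHE.EvalForm.decKey`); so the questions read off an execution are those of the chosen context.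
Moreover `k̂` is distributed as in a fresh encryption whatever the answers are. A quantum simulator
can therefore obtain it from an evaluation of its own, and a classical prover by evaluating a
constant circuit. -/

def IsBdd {α : Type*} (f : α → ℝ) : Prop := ∃ B, ∀ a, |f a| ≤ B

/-- Functions with values in the unit interval. -/
def IsUnit01 {α : Type*} (f : α → ℝ) : Prop := ∀ a, 0 ≤ f a ∧ f a ≤ 1

section Expect

variable {α β : Type*}

theorem IsUnit01.isBdd {f : α → ℝ} (h : IsUnit01 f) : IsBdd f :=
  ⟨1, fun a => abs_le.2 ⟨by linarith [(h a).1], (h a).2⟩⟩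

theorem IsUnit01.comp {f : β → ℝ} (h : IsUnit01 f) (g : α → β) : IsUnit01 fun a => f (g a) :=
  fun a => h (g a)

theorem isBdd_const (c : ℝ) : IsBdd fun _ : α => c := ⟨|c|, fun _ => le_rfl⟩

theorem IsBdd.add {f g : α → ℝ} (hf : IsBdd f) (hg : IsBdd g) : IsBdd fun a => f a + g a := by
  obtain ⟨B, hB⟩ := hf
  obtain ⟨B', hB'⟩ := hg
  exact ⟨B + B', fun a => (abs_add_le _ _).trans (add_le_add (hB a) (hB' a))⟩

theorem IsBdd.const_mul {f : α → ℝ} (hf : IsBdd f) (c : ℝ) : IsBdd fun a => c * f a := by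
  obtain ⟨B, hB⟩ := hf
  exact ⟨|c| * B, fun a => by
    rw [abs_mul]; exact mul_le_mul_of_nonneg_left (hB a) (abs_nonneg c)⟩

theorem IsBdd.sub {f g : α → ℝ} (hf : IsBdd f) (hg : IsBdd g) : IsBdd fun a => f a - g a := by
  simpa [sub_eq_add_neg] using hf.add (hg.const_mul (-1))

theorem IsBdd.sum {ι : Type*} (s : Finset ι) {f : ι → α → ℝ} (hf : ∀ i ∈ s, IsBdd (f i)) :
    IsBdd fun a => ∑ i ∈ s, f i a := by
  classical
  induction s using Finset.induction_on with
  | empty => simpa using isBdd_const 0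
  | insert i s hi ih =>
    simp only [Finset.sum_insert hi]
    exact (hf i (by simp)).add (ih fun j hj => hf j (by simp [hj]))

theorem summable_toReal (p : PMF α) : Summable fun a => (p a).toReal :=
  ENNReal.summable_toReal p.tsum_coe_ne_top

theorem tsum_toReal (p : PMF α) : ∑' a, (p a).toReal = 1 := by
  rw [← ENNReal.tsum_toReal_eq fun a => p.apply_ne_top a, p.tsum_coe, ENNReal.toReal_one]

/-- `expect` is a `tsum` and so has the default value 0 on non-summable families. Boundedness
excludes this case and is carried through all rules for expected values. -/
theorem summable_expect (p : PMF α) {f : α → ℝ} (hf : IsBdd f) :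
    Summable fun a => (p a).toReal * f a := by
  obtain ⟨B, hB⟩ := hf
  refine Summable.of_norm_bounded ((summable_toReal p).mul_right B) fun a => ?_
  rw [Real.norm_eq_abs, abs_mul, abs_of_nonneg ENNReal.toReal_nonneg]
  exact mul_le_mul_of_nonneg_left (hB a) ENNReal.toReal_nonneg

theorem expect_const (p : PMF α) (c : ℝ) : expect p (fun _ => c) = c := by
  simp [expect, tsum_mul_right, tsum_toReal]

theorem expect_add (p : PMF α) {f g : α → ℝ} (hf : IsBdd f) (hg : IsBdd g) :
    expect p (fun a => f a + g a) = expect p f + expect p g := by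
  simp only [expect, mul_add]
  exact (summable_expect p hf).tsum_add (summable_expect p hg)

theorem expect_const_mul (p : PMF α) (f : α → ℝ) (c : ℝ) :
    expect p (fun a => c * f a) = c * expect p f := by
  simp only [expect, ← tsum_mul_left]
  exact tsum_congr fun a => by ring

theorem expect_sub (p : PMF α) {f g : α → ℝ} (hf : IsBdd f) (hg : IsBdd g) :
    expect p (fun a => f a - g a) = expect p f - expect p g := by
  simp only [expect, mul_sub]
  exact (summable_expect p hf).tsum_sub (summable_expect p hg)

theorem expect_sum {ι : Type*} (p : PMF α) (s : Finset ι) {f : ι → α → ℝ}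
    (hf : ∀ i ∈ s, IsBdd (f i)) :
    expect p (fun a => ∑ i ∈ s, f i a) = ∑ i ∈ s, expect p (f i) := by
  simp only [expect, Finset.mul_sum]
  exact Summable.tsum_finsetSum fun i hi => summable_expect p (hf i hi)

theorem expect_congr {p : PMF α} {f g : α → ℝ} (h : ∀ a ∈ p.support, f a = g a) :
    expect p f = expect p g := by
  refine tsum_congr fun a => ?_
  by_cases ha : a ∈ p.support
  · rw [h a ha]
  · rw [PMF.mem_support_iff, not_not] at ha
    simp [ha]

theorem expect_mono {p : PMF α} {f g : α → ℝ} (hf : IsBdd f) (hg : IsBdd g)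
    (h : ∀ a ∈ p.support, f a ≤ g a) : expect p f ≤ expect p g := by
  refine (summable_expect p hf).tsum_le_tsum (fun a => ?_) (summable_expect p hg)
  by_cases ha : a ∈ p.support
  · exact mul_le_mul_of_nonneg_left (h a ha) ENNReal.toReal_nonneg
  · rw [PMF.mem_support_iff, not_not] at ha
    simp [ha]

theorem expect_le {p : PMF α} {f : α → ℝ} {c : ℝ} (hf : IsBdd f) (h : ∀ a ∈ p.support, f a ≤ c) :
    expect p f ≤ c :=
  (expect_mono hf (isBdd_const c) h).trans_eq (expect_const p c)

theorem le_expect {p : PMF α} {f : α → ℝ} {c : ℝ} (hf : IsBdd f) (h : ∀ a ∈ p.support, c ≤ f a) :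
    c ≤ expect p f :=
  (expect_const p c).symm.trans_le (expect_mono (isBdd_const c) hf h)

theorem abs_expect_sub_le {p : PMF α} {f g : α → ℝ} {c : ℝ} (hf : IsBdd f) (hg : IsBdd g)
    (h : ∀ a ∈ p.support, |f a - g a| ≤ c) : |expect p f - expect p g| ≤ c := by
  rw [← expect_sub p hf hg, abs_le]
  exact ⟨le_expect (hf.sub hg) fun a ha => (abs_le.1 (h a ha)).1,
    expect_le (hf.sub hg) fun a ha => (abs_le.1 (h a ha)).2⟩

theorem isUnit01_expect {g : α → PMF β} {f : α → β → ℝ} (hf : ∀ a, IsUnit01 (f a)) :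
    IsUnit01 fun a => expect (g a) (f a) := fun a =>
  ⟨le_expect (hf a).isBdd fun b _ => (hf a b).1, expect_le (hf a).isBdd fun b _ => (hf a b).2⟩

theorem isBdd_expect {g : α → PMF β} {f : β → ℝ} (hf : IsBdd f) :
    IsBdd fun a => expect (g a) f := by
  obtain ⟨B, hB⟩ := hf
  exact ⟨B, fun a => abs_le.2 ⟨le_expect ⟨B, hB⟩ fun b _ => (abs_le.1 (hB b)).1,
    expect_le ⟨B, hB⟩ fun b _ => (abs_le.1 (hB b)).2⟩⟩

theorem expect_pure (a : α) (f : α → ℝ) : expect (PMF.pure a) f = f a := by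
  classical
  rw [expect, tsum_eq_single a]
  · simp
  · intro b hb
    simp [PMF.pure_apply, hb]

theorem expect_bind (p : PMF α) (g : α → PMF β) {f : β → ℝ} (hf : IsBdd f) :
    expect (p.bind g) f = expect p fun a => expect (g a) f := by
  obtain ⟨B, hB⟩ := hf
  have h1 : ∀ b, ((p.bind g) b).toReal = ∑' a, (p a).toReal * (g a b).toReal := fun b => by
    rw [PMF.bind_apply, ENNReal.tsum_toReal_eq]
    · simp
    · exact fun a => ENNReal.mul_ne_top (p.apply_ne_top a) ((g a).apply_ne_top b)
  have hc : ∀ a, Summable fun b => (p a).toReal * (g a b).toReal := fun a =>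
    Summable.mul_left (p a).toReal (summable_toReal (g a))
  have hd : ∀ a, ∑' b, (p a).toReal * (g a b).toReal = (p a).toReal := fun a => by
    rw [tsum_mul_left, tsum_toReal, mul_one]
  have hs0 : Summable fun x : α × β => (p x.1).toReal * (g x.1 x.2).toReal := by
    refine (summable_prod_of_nonneg (f := fun x : α × β => (p x.1).toReal * (g x.1 x.2).toReal)
      fun x => mul_nonneg ENNReal.toReal_nonneg ENNReal.toReal_nonneg).2 ⟨hc, ?_⟩
    simpa only [hd] using summable_toReal p
  have hs : Summable fun x : α × β => (p x.1).toReal * (g x.1 x.2).toReal * f x.2 := by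
    refine Summable.of_norm_bounded (hs0.mul_right B) fun x => ?_
    rw [Real.norm_eq_abs, abs_mul, abs_of_nonneg (by positivity)]
    exact mul_le_mul_of_nonneg_left (hB x.2) (by positivity)
  simp only [expect, h1, ← tsum_mul_right, ← tsum_mul_left]
  rw [Summable.tsum_comm (f := fun a b => (p a).toReal * (g a b).toReal * f b)]
  · exact tsum_congr fun a => tsum_congr fun b => by ring
  · exact hs

theorem expect_map (p : PMF α) (g : α → β) {f : β → ℝ} (hf : IsBdd f) :
    expect (p.map g) f = expect p fun a => f (g a) := by
  rw [← PMF.bind_pure_comp, expect_bind _ _ hf]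
  simp [expect_pure]

theorem expect_comm (p : PMF α) (q : PMF β) {f : α → β → ℝ} (hf : IsBdd (Function.uncurry f)) :
    expect p (fun a => expect q (f a)) = expect q fun b => expect p fun a => f a b := by
  have h := congrArg (fun r => expect r (Function.uncurry f))
    (PMF.bind_comm p q fun a b => PMF.pure (a, b))
  simp only [expect_bind _ _ hf, expect_pure, Function.uncurry] at h
  exact h

theorem expect_fintype [Fintype α] (p : PMF α) (f : α → ℝ) :
    expect p f = ∑ a, (p a).toReal * f a := tsum_fintype _

theorem expect_uniformOfFinset (s : Finset α) (hs : s.Nonempty) (f : α → ℝ) :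
    expect (PMF.uniformOfFinset s hs) f = (∑ a ∈ s, f a) / s.card := by
  classical
  rw [expect, tsum_eq_sum (s := s), Finset.sum_div]
  · refine Finset.sum_congr rfl fun a ha => ?_
    rw [PMF.uniformOfFinset_apply_of_mem hs ha, ENNReal.toReal_inv, ENNReal.toReal_natCast]
    ring
  · intro a ha
    simp [PMF.uniformOfFinset_apply_of_notMem hs ha]

theorem expect_uniformOfFintype [Fintype α] [Nonempty α] (f : α → ℝ) :
    expect (PMF.uniformOfFintype α) f = (∑ a, f a) / Fintype.card α := by
  rw [expect_fintype, Finset.sum_div]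
  refine Finset.sum_congr rfl fun a _ => ?_
  rw [PMF.uniformOfFintype_apply, ENNReal.toReal_inv, ENNReal.toReal_natCast]
  ring

open scoped Classical in
theorem Pr_eq_expect (p : PMF α) (E : α → Prop) :
    Pr p E = expect p fun a => if E a then 1 else 0 := by
  rw [Pr, PMF.toOuterMeasure_apply, ENNReal.tsum_toReal_eq]
  · refine tsum_congr fun a => ?_
    by_cases h : E a <;> simp [h]
  · intro a
    by_cases h : E a <;> simp [h, p.apply_ne_top]

open scoped Classical in
theorem isUnit01_ite (E : α → Prop) : IsUnit01 fun a => if E a then (1 : ℝ) else 0 := fun a => by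
  by_cases h : E a <;> simp [h]

/-- Identities between distributions are reduced in this way to computations of expected values. -/
theorem ext_of_expect {p q : PMF α} (h : ∀ f, IsUnit01 f → expect p f = expect q f) : p = q := by
  classical
  have hx : ∀ (r : PMF α) a, expect r (fun b => if b = a then 1 else 0) = (r a).toReal := by
    intro r a
    rw [expect, tsum_eq_single a]
    · simp
    · intro b hb
      simp [hb]
  ext a
  have h' := h (fun b => if b = a then 1 else 0) (isUnit01_ite fun b => b = a)
  rwa [hx, hx, ENNReal.toReal_eq_toReal_iff' (p.apply_ne_top a) (q.apply_ne_top a)] at h'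

/-! ### Closeness of distributions -/

/-- The statistical distance of `p` and `q` is at most `ε`. -/
def Close (ε : ℝ) (p q : PMF α) : Prop :=
  ∀ f, IsUnit01 f → |expect p f - expect q f| ≤ ε

theorem Close.symm {ε : ℝ} {p q : PMF α} (h : Close ε p q) : Close ε q p := fun f hf => by
  rw [abs_sub_comm]
  exact h f hf

theorem Close.trans {ε δ : ℝ} {p q r : PMF α} (h : Close ε p q) (h' : Close δ q r) :
    Close (ε + δ) p r := fun f hf =>
  (abs_sub_le _ _ _).trans (add_le_add (h f hf) (h' f hf))

theorem Close.bind_right {ε : ℝ} {p q : PMF α} (h : Close ε p q) (g : α → PMF β) :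
    Close ε (p.bind g) (q.bind g) := fun f hf => by
  rw [expect_bind _ _ hf.isBdd, expect_bind _ _ hf.isBdd]
  exact h _ (isUnit01_expect fun _ => hf)

theorem Close.map {ε : ℝ} {p q : PMF α} (h : Close ε p q) (g : α → β) :
    Close ε (p.map g) (q.map g) := by
  simpa only [← PMF.bind_pure_comp] using h.bind_right (PMF.pure ∘ g)

theorem Close.bind_left {ε : ℝ} {p : PMF α} {g g' : α → PMF β}
    (h : ∀ a ∈ p.support, Close ε (g a) (g' a)) : Close ε (p.bind g) (p.bind g') := fun f hf => by
  rw [expect_bind _ _ hf.isBdd, expect_bind _ _ hf.isBdd]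
  exact abs_expect_sub_le (isBdd_expect hf.isBdd) (isBdd_expect hf.isBdd) fun a ha => h a ha f hf

open scoped Classical in
/-- Two processes which agree on the good values of `p`. -/
theorem close_bind_of_good {ε : ℝ} {p : PMF α} {g g' : α → PMF β} (good : α → Prop)
    (hp : Pr p (fun a => ¬ good a) ≤ ε) (h : ∀ a ∈ p.support, good a → g a = g' a) :
    Close ε (p.bind g) (p.bind g') := fun f hf => by
  rw [expect_bind _ _ hf.isBdd, expect_bind _ _ hf.isBdd,
    ← expect_sub p (isBdd_expect hf.isBdd) (isBdd_expect hf.isBdd)]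
  rw [Pr_eq_expect] at hp
  have hb := (isBdd_expect (g := g) hf.isBdd).sub (isBdd_expect (g := g') hf.isBdd)
  have hi := (isUnit01_ite fun a => ¬ good a).isBdd
  have h1 := isUnit01_expect (g := g) (f := fun _ => f) fun _ => hf
  have h2 := isUnit01_expect (g := g') (f := fun _ => f) fun _ => hf
  rw [abs_le]
  constructor
  · have := expect_mono (p := p) (hi.const_mul (-1)) hb fun a ha => by
      by_cases hg : good a
      · simp [hg, h a ha hg]
      · have := h1 a; have := h2 a
        simp only [hg, not_false_eq_true, if_true]
        linarith
    rw [expect_const_mul] at this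
    linarith
  · refine le_trans (expect_mono hb hi fun a ha => ?_) hp
    by_cases hg : good a
    · simp [hg, h a ha hg]
    · have := h1 a; have := h2 a
      simp only [hg, not_false_eq_true, if_true]
      linarith

/-- The total variation distance is attained. -/
theorem exists_tv_eq (p q : PMF α) : ∃ f, IsUnit01 f ∧ tv p q = expect p f - expect q f := by
  classical
  let f : α → ℝ := fun a => if (q a).toReal ≤ (p a).toReal then 1 else 0
  have hf : IsUnit01 f := isUnit01_ite fun a => (q a).toReal ≤ (p a).toReal
  refine ⟨f, hf, ?_⟩
  -- `f` is the indicator of `q ≤ p`. The correction term `p - q` sums to 0, since both masses are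
  -- 1.
  have e : ∀ a, |(p a).toReal - (q a).toReal| =
      2 * ((p a).toReal * f a - (q a).toReal * f a) - ((p a).toReal - (q a).toReal) := by
    intro a
    by_cases ha : (q a).toReal ≤ (p a).toReal
    · simp only [f, ha, if_true]
      rw [abs_of_nonneg (by linarith)]; ring
    · simp only [f, ha, if_false]
      rw [abs_of_neg (by linarith)]; ring
  have s1 := summable_expect p hf.isBdd
  have s2 := summable_expect q hf.isBdd
  simp only [tv, e]
  rw [((s1.sub s2).mul_left 2).tsum_sub ((summable_toReal p).sub (summable_toReal q)),
    tsum_mul_left, s1.tsum_sub s2, (summable_toReal p).tsum_sub (summable_toReal q),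
    tsum_toReal, tsum_toReal]
  simp only [expect]
  ring

theorem Close.tv_le {ε : ℝ} {p q : PMF α} (h : Close ε p q) : tv p q ≤ ε := by
  obtain ⟨f, hf, key⟩ := exists_tv_eq p q
  rw [key]
  exact (le_abs_self _).trans (h f hf)

/-- As `p` and `q` have the same mass, `f` may be shifted by `1/2`. The shifted test is bounded by
`1/2` in absolute value, which accounts for the factor in the total variation distance. -/
theorem close_of_abs_tsum_le {ε : ℝ} {p q : PMF α}
    (h : (1 / 2) * ∑' a, |(p a).toReal - (q a).toReal| ≤ ε) : Close ε p q := by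
  intro f hf
  have s1 := summable_expect p hf.isBdd
  have s2 := summable_expect q hf.isBdd
  have sd := (summable_toReal p).sub (summable_toReal q)
  have e : expect p f - expect q f =
      ∑' a, ((p a).toReal - (q a).toReal) * (f a - 1 / 2) := by
    have : ∀ a, ((p a).toReal - (q a).toReal) * (f a - 1 / 2) =
        ((p a).toReal * f a - (q a).toReal * f a) - ((p a).toReal - (q a).toReal) * (1 / 2) :=
      fun a => by ring
    simp only [this]
    rw [(s1.sub s2).tsum_sub (sd.mul_right _), s1.tsum_sub s2, tsum_mul_right,
      (summable_toReal p).tsum_sub (summable_toReal q), tsum_toReal, tsum_toReal]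
    simp [expect]
  rw [e]
  have hb : ∀ a, ‖((p a).toReal - (q a).toReal) * (f a - 1 / 2)‖ ≤
      (1 / 2) * |(p a).toReal - (q a).toReal| := fun a => by
    rw [Real.norm_eq_abs, abs_mul, mul_comm]
    refine mul_le_mul_of_nonneg_right (abs_le.2 ⟨?_, ?_⟩) (abs_nonneg _) <;>
      linarith [(hf a).1, (hf a).2]
  have := tsum_of_norm_bounded (sd.abs.mul_left (1 / 2)).hasSum hb
  rw [Real.norm_eq_abs, tsum_mul_left] at this
  exact this.trans h

theorem Close.mono {ε δ : ℝ} {p q : PMF α} (h : Close ε p q) (hδ : ε ≤ δ) : Close δ p q :=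
  fun f hf => (h f hf).trans hδ

theorem Close.abs_Pr_sub_le {ε : ℝ} {p q : PMF α} (h : Close ε p q) (E : α → Prop) :
    |Pr p E - Pr q E| ≤ ε := by
  classical
  rw [Pr_eq_expect, Pr_eq_expect]
  exact h _ (isUnit01_ite E)

theorem Pr_nonneg (p : PMF α) (E : α → Prop) : 0 ≤ Pr p E := ENNReal.toReal_nonneg

theorem Pr_bind (p : PMF α) (g : α → PMF β) (E : β → Prop) :
    Pr (p.bind g) E = expect p fun a => Pr (g a) E := by
  classical
  simp only [Pr_eq_expect]
  exact expect_bind _ _ (isUnit01_ite E).isBdd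

theorem Pr_map (p : PMF α) (g : α → β) (E : β → Prop) :
    Pr (p.map g) E = Pr p fun a => E (g a) := by
  classical
  simp only [Pr_eq_expect]
  exact expect_map _ _ (isUnit01_ite E).isBdd

theorem Pr_le_one (p : PMF α) (E : α → Prop) : Pr p E ≤ 1 := by
  classical
  rw [Pr_eq_expect]
  exact expect_le (isUnit01_ite E).isBdd fun a _ => (isUnit01_ite E a).2

theorem isUnit01_Pr (g : α → PMF β) (E : α → β → Prop) : IsUnit01 fun a => Pr (g a) (E a) :=
  fun _ => ⟨Pr_nonneg _ _, Pr_le_one _ _⟩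

theorem Pr_mono {p : PMF α} {E F : α → Prop} (h : ∀ a ∈ p.support, E a → F a) :
    Pr p E ≤ Pr p F := by
  classical
  rw [Pr_eq_expect, Pr_eq_expect]
  refine expect_mono (isUnit01_ite E).isBdd (isUnit01_ite F).isBdd fun a ha => ?_
  by_cases hE : E a
  · simp [hE, h a ha hE]
  · simp only [hE, if_false]; split_ifs <;> norm_num

theorem Pr_bind_le {p : PMF α} {g : α → PMF β} {E : β → Prop} {c : ℝ}
    (h : ∀ a ∈ p.support, Pr (g a) E ≤ c) :
    Pr (p.bind g) E ≤ c := by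
  rw [Pr_bind]
  exact expect_le (isUnit01_Pr _ _).isBdd h

end Expect

/-! ### Sampling -/

section Sample

theorem tsum_ofReal_ne {ι : Type*} {w : ι → ℝ} (hw : ∀ i, 0 ≤ w i) (hs : Summable w) (hpos : 0 < ∑' i, w i) :
    (∑' i, ENNReal.ofReal (w i)) ≠ 0 ∧ (∑' i, ENNReal.ofReal (w i)) ≠ ∞ := by
  rw [← ENNReal.ofReal_tsum_of_nonneg hw hs]
  exact ⟨by simpa using hpos, ENNReal.ofReal_ne_top⟩

variable {ι : Type*} [Nonempty ι]

theorem sampleBy_apply {f : ι → ℝ≥0∞} (h : (∑' i, f i) ≠ 0) (h' : (∑' i, f i) ≠ ∞) (i : ι) :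
    sampleBy f i = f i * (∑' i, f i)⁻¹ := by
  rw [sampleBy, dif_pos ⟨h, h'⟩, PMF.normalize_apply]

theorem sampleBy_ofReal_apply {w : ι → ℝ} (hw : ∀ i, 0 ≤ w i) (hs : Summable w)
    (hpos : 0 < ∑' i, w i) (i : ι) :
    (sampleBy (fun i => ENNReal.ofReal (w i)) i).toReal = w i / ∑' i, w i := by
  obtain ⟨h1, h2⟩ := tsum_ofReal_ne hw hs hpos
  rw [sampleBy_apply h1 h2, ← ENNReal.ofReal_tsum_of_nonneg hw hs, ENNReal.toReal_mul,
    ENNReal.toReal_inv, ENNReal.toReal_ofReal (hw i), ENNReal.toReal_ofReal hpos.le, div_eq_mul_inv]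

theorem expect_sampleBy {w : ι → ℝ} (hw : ∀ i, 0 ≤ w i) (hs : Summable w)
    (hpos : 0 < ∑' i, w i) (f : ι → ℝ) :
    expect (sampleBy fun i => ENNReal.ofReal (w i)) f = (∑' i, w i * f i) / ∑' i, w i := by
  rw [expect, ← tsum_div_const]
  exact tsum_congr fun i => by rw [sampleBy_ofReal_apply hw hs hpos]; ring

theorem expect_sampleBy_fintype [Fintype ι] {w : ι → ℝ} (hw : ∀ i, 0 ≤ w i)
    (hpos : 0 < ∑ i, w i) (f : ι → ℝ) :
    expect (sampleBy fun i => ENNReal.ofReal (w i)) f = (∑ i, w i * f i) / ∑ i, w i := by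
  rw [expect_sampleBy hw (hasSum_fintype w).summable (by rwa [tsum_fintype]), tsum_fintype,
    tsum_fintype]

theorem mem_support_sampleBy {w : ι → ℝ} (hw : ∀ i, 0 ≤ w i) (hs : Summable w)
    (hpos : 0 < ∑' i, w i) {i : ι} :
    i ∈ (sampleBy fun i => ENNReal.ofReal (w i)).support ↔ 0 < w i := by
  obtain ⟨h1, h2⟩ := tsum_ofReal_ne hw hs hpos
  rw [PMF.mem_support_iff, sampleBy_apply h1 h2]
  simp [h2]

end Sample

/-! ### Negligible functions -/

theorem Negligible.zero : Negligible fun _ => 0 := by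
  exact Asymptotics.superpolynomialDecay_zero Filter.atTop fun l : ℕ => (l : ℝ)

theorem Negligible.add {ε δ : ℕ → ℝ} (h : Negligible ε) (h' : Negligible δ) :
    Negligible fun l => ε l + δ l := Asymptotics.SuperpolynomialDecay.add h h'

theorem Negligible.const_mul {ε : ℕ → ℝ} (h : Negligible ε) (c : ℝ) :
    Negligible fun l => c * ε l := Asymptotics.SuperpolynomialDecay.const_mul h c

theorem Negligible.sum {ι : Type*} (s : Finset ι) {ε : ι → ℕ → ℝ} (h : ∀ i ∈ s, Negligible (ε i)) :
    Negligible fun l => ∑ i ∈ s, ε i l := by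
  classical
  induction s using Finset.induction_on with
  | empty => simpa using Negligible.zero
  | insert i s hi ih =>
    simp only [Finset.sum_insert hi]
    exact (h i (by simp)).add (ih fun j hj => h j (by simp [hj]))

/-! ### Auxiliary facts on discrete distributions -/

theorem bind_congr_support {α β : Type*} {p : PMF α} {f g : α → PMF β}
    (h : ∀ a ∈ p.support, f a = g a) : p.bind f = p.bind g := by
  ext b
  simp only [PMF.bind_apply]
  refine tsum_congr fun a => ?_
  by_cases ha : a ∈ p.support
  · rw [h a ha]
  · rw [PMF.mem_support_iff, not_not] at ha
    simp [ha]

theorem map_congr_support {α β : Type*} {p : PMF α} {f g : α → β}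
    (h : ∀ a ∈ p.support, f a = g a) : p.map f = p.map g := by
  rw [← PMF.bind_pure_comp, ← PMF.bind_pure_comp]
  exact bind_congr_support fun a ha => by simp [h a ha]

/-- A distribution that is dominated off a null point by another one is equal to it. -/
theorem pmf_eq_of_le {α : Type*} {p q : PMF α} (h : ∀ a ∈ p.support, p a ≤ q a) : p = q := by
  have hle : ∀ a, p a ≤ q a := fun a => by
    by_cases ha : a ∈ p.support
    · exact h a ha
    · rw [PMF.mem_support_iff, not_not] at ha
      simp [ha]
  ext a
  by_contra hne
  have hlt := ENNReal.tsum_lt_tsum (i := a) p.tsum_coe_ne_top hle (lt_of_le_of_ne (hle a) hne)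
  rw [p.tsum_coe, q.tsum_coe] at hlt
  exact lt_irrefl _ hlt

/-! ### The quantum memory -/

namespace QMem

theorem valid_vac : Valid vac := by
  refine ⟨(Set.finite_singleton (∅ : Finset ℕ)).subset fun S hS => ?_, fun h => ?_⟩
  · by_contra hne
    exact hS (by simp [vac, show S ≠ ∅ from hne])
  · simpa [vac] using congrFun h ∅

theorem summable_sq {v : QMem} (h : v.Valid) : Summable fun S => ‖v S‖ ^ 2 :=
  summable_of_hasFiniteSupport (h.1.subset fun S hS hv => hS (by simp [hv]))

theorem tsum_sq_pos {v : QMem} (h : v.Valid) : 0 < ∑' S, ‖v S‖ ^ 2 := by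
  obtain ⟨S, hS⟩ := Function.ne_iff.1 h.2
  have := norm_pos_iff.2 (show v S ≠ 0 from hS)
  exact (summable_sq h).tsum_pos (fun _ => by positivity) S (by positivity)

theorem mem_support_born {v : QMem} (h : v.Valid) {S : Finset ℕ} :
    S ∈ (born v).support ↔ v S ≠ 0 := by
  rw [born, mem_support_sampleBy (fun _ => by positivity) (summable_sq h) (tsum_sq_pos h)]
  constructor
  · rintro h0 h1
    simp [h1] at h0
  · intro h0
    positivity

theorem expect_born {v : QMem} (h : v.Valid) (f : Finset ℕ → ℝ) :
    expect (born v) f = (∑' S, ‖v S‖ ^ 2 * f S) / ∑' S, ‖v S‖ ^ 2 :=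
  expect_sampleBy (fun _ => by positivity) (summable_sq h) (tsum_sq_pos h) f

section Wires

variable {k : ℕ} {w : Fin k → ℕ}

theorem mem_write {y : Bits k} {S : Finset ℕ} {j : ℕ} :
    j ∈ write w y S ↔ (j ∈ S ∧ ∀ i, w i ≠ j) ∨ ∃ i, y i = true ∧ w i = j := by
  simp [write]

theorem read_write (hw : Function.Injective w) (y : Bits k) (S : Finset ℕ) :
    read w (write w y S) = y := by
  funext i
  rw [read, Bool.eq_iff_iff, decide_eq_true_iff, mem_write]
  constructor
  · rintro (⟨_, h⟩ | ⟨j, hj, hji⟩)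
    · exact absurd rfl (h i)
    · rwa [← hw hji]
  · exact fun h => Or.inr ⟨i, h, rfl⟩

theorem write_write (y y' : Bits k) (S : Finset ℕ) :
    write w y (write w y' S) = write w y S := by
  ext j
  simp only [mem_write]
  constructor
  · rintro (⟨(⟨h, _⟩ | ⟨i, _, h⟩), h'⟩ | h)
    · exact Or.inl ⟨h, h'⟩
    · exact absurd h (h' i)
    · exact Or.inr h
  · rintro (⟨h, h'⟩ | h)
    · exact Or.inl ⟨Or.inl ⟨h, h'⟩, h'⟩
    · exact Or.inr h

theorem write_read (S : Finset ℕ) : write w (read w S) S = S := by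
  ext j
  simp only [mem_write, read, decide_eq_true_iff]
  constructor
  · rintro (⟨h, _⟩ | ⟨i, h, rfl⟩)
    exacts [h, h]
  · intro h
    by_cases hj : ∃ i, w i = j
    · obtain ⟨i, rfl⟩ := hj
      exact Or.inr ⟨i, h, rfl⟩
    · exact Or.inl ⟨h, fun i hi => hj ⟨i, hi⟩⟩

theorem gate_of_injective (hw : Function.Injective w) (U : Matrix (Bits k) (Bits k) ℂ) (v : QMem) :
    gate U w v = fun S => ∑ y : Bits k, U (read w S) y * v (write w y S) := by
  simp [gate, hw]

theorem gate_mul (hw : Function.Injective w) (U V : Matrix (Bits k) (Bits k) ℂ) (v : QMem) :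
    gate U w (gate V w v) = gate (U * V) w v := by
  simp only [gate_of_injective hw, read_write hw, write_write]
  funext S
  simp only [Matrix.mul_apply, Finset.mul_sum, Finset.sum_mul]
  rw [Finset.sum_comm]
  simp only [mul_assoc]

theorem gate_one (hw : Function.Injective w) (v : QMem) :
    gate (1 : Matrix (Bits k) (Bits k) ℂ) w v = v := by
  rw [gate_of_injective hw]
  funext S
  simp [Matrix.one_apply, write_read]

theorem gate_zero (U : Matrix (Bits k) (Bits k) ℂ) : gate U w 0 = 0 := by
  by_cases hw : Function.Injective w
  · rw [gate_of_injective hw]; funext S; simp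
  · simp [gate, hw]

theorem gate_smul (U : Matrix (Bits k) (Bits k) ℂ) (z : ℂ) (v : QMem) :
    gate U w (z • v) = z • gate U w v := by
  by_cases hw : Function.Injective w
  · simp only [gate_of_injective hw]
    funext S
    simp only [Pi.smul_apply, smul_eq_mul, Finset.mul_sum]
    exact Finset.sum_congr rfl fun y _ => by ring
  · simp [gate, hw]

/-- The support stays finite since a gate only rewrites the `k` addressed bits of basis states in
the support. The result is nonzero since the gate of `star U` restores `v`. -/
theorem valid_gate (U : Unitary k) {v : QMem} (h : v.Valid) :
    (gate (U : Matrix (Bits k) (Bits k) ℂ) w v).Valid := by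
  by_cases hw : Function.Injective w
  · constructor
    · refine (Set.Finite.image2 (fun (y : Bits k) S => write w y S) Set.finite_univ h.1).subset
        fun S hS => ?_
      rw [Function.mem_support, gate_of_injective hw] at hS
      obtain ⟨y, _, hy⟩ := Finset.exists_ne_zero_of_sum_ne_zero hS
      exact ⟨read w S, trivial, write w y S, right_ne_zero_of_mul hy, by
        simp [write_write, write_read]⟩
    · intro h0
      have h1 := gate_mul hw (star (U : Matrix (Bits k) (Bits k) ℂ)) U v
      rw [h0, gate_zero, Matrix.UnitaryGroup.star_mul_self, gate_one hw] at h1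
      exact h.2 h1.symm
  · simpa [gate, hw] using h

end Wires

theorem valid_of_mem_measure {i : ℕ} {v : QMem} (h : v.Valid) {r : Bool × QMem}
    (hr : r ∈ (measure i v).support) : r.2.Valid := by
  rw [measure, PMF.mem_support_map_iff] at hr
  obtain ⟨S, hS, rfl⟩ := hr
  rw [mem_support_born h] at hS
  refine ⟨h.1.subset fun S' hS' hv => hS' (by simp [hv]), fun h0 => hS ?_⟩
  simpa using congrFun h0 S

theorem valid_of_mem_clear {m : ℕ} {v : QMem} (h : v.Valid) {w : QMem}
    (hw : w ∈ (clear m v).support) : w.Valid ∧ ∀ S, w S ≠ 0 → S ⊆ Finset.range m := by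
  rw [clear, PMF.mem_support_map_iff] at hw
  obtain ⟨S, hS, rfl⟩ := hw
  rw [mem_support_born h] at hS
  refine ⟨⟨(Finset.range m).powerset.finite_toSet.subset fun S' hS' => ?_, fun h0 => hS ?_⟩,
    fun S' hS' => ?_⟩
  · simp only [Finset.coe_powerset, Set.mem_preimage, Set.mem_powerset_iff, Finset.coe_subset]
    by_contra hn
    simp [hn] at hS'
  -- The low part of the drawn `S` receives the amplitude `v S`, which is nonzero because `S` was
  -- drawn.
  · have h1 := congrFun h0 (S.filter fun i => i < m)
    have h2 : S.filter (fun i => i < m) ∪ S.filter (fun i => m ≤ i) = S := by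
      ext j
      simp only [Finset.mem_union, Finset.mem_filter]
      have := lt_or_ge j m
      tauto
    have h3 : S.filter (fun i => i < m) ⊆ Finset.range m := fun j hj => by
      simpa using (Finset.mem_filter.1 hj).2
    simpa only [h3, if_true, h2, Pi.zero_apply] using h1
  · by_contra hn
    simp [hn] at hS'

theorem born_smul {z : ℂ} (hz : ‖z‖ = 1) (v : QMem) : born (z • v) = born v := by
  simp [born, hz]

theorem measure_smul {z : ℂ} (hz : ‖z‖ = 1) (i : ℕ) (v : QMem) :
    measure i (z • v) = (measure i v).map fun r => (r.1, z • r.2) := by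
  rw [measure, measure, born_smul hz, PMF.map_comp]
  congr 1
  funext S
  refine Prod.ext rfl (funext fun S' => ?_)
  simp only [Function.comp_apply, Pi.smul_apply]
  split_ifs <;> simp

theorem clear_smul {z : ℂ} (hz : ‖z‖ = 1) (m : ℕ) (v : QMem) :
    clear m (z • v) = (clear m v).map (z • ·) := by
  rw [clear, clear, born_smul hz, PMF.map_comp]
  congr 1
  funext S S'
  simp only [Function.comp_apply, Pi.smul_apply]
  split_ifs <;> simp

end QMem

theorem Data.one_le_size (x : Data) : 1 ≤ x.size := by
  cases x <;> simp [Data.size]; omega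

theorem Data.size_fst (x : Data) : x.fst.size ≤ x.size := by
  cases x <;> simp [Data.size, Data.fst]; omega

theorem Data.size_snd (x : Data) : x.snd.size ≤ x.size := by
  cases x <;> simp [Data.size, Data.snd]

theorem Data.size_bit (b : Bool) : (Data.bit b).size ≤ 3 := by
  cases b <;> simp [Data.size, Data.bit]

/-! ### Execution of programs -/

namespace Prog

theorem mem_support_andThen {p : PMF Res} {f : Data → QMem → PMF Res} {r : Res}
    (hr : r ∈ (andThen p f).support) :
    (none ∈ p.support ∧ r = none) ∨ ∃ x v c, some ((x, v), c) ∈ p.support ∧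
      ∃ s ∈ (f x v).support, r = s.map fun s => (s.1, c + s.2) := by
  rw [andThen, PMF.mem_support_bind_iff] at hr
  obtain ⟨_ | ⟨⟨x, v⟩, c⟩, h1, h2⟩ := hr
  · exact Or.inl ⟨h1, by simpa using h2⟩
  · rw [PMF.mem_support_map_iff] at h2
    obtain ⟨s, hs, rfl⟩ := h2
    exact Or.inr ⟨x, v, c, h1, s, hs, rfl⟩

/-- Results with valid memory whose size is bounded by the cost. -/
def Good (r : Res) : Prop := ∀ s, r = some s → s.1.2.Valid ∧ s.1.1.size ≤ s.2 + 1

theorem good_done {c : ℕ} {x : Data} {v : QMem} (hv : v.Valid) (hc : x.size ≤ c + 1) :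
    ∀ r ∈ (done c x v).support, Good r := by
  intro r hr s hs
  simp only [done, PMF.support_pure, Set.mem_singleton_iff] at hr
  rw [hr, Option.some_inj] at hs
  subst hs
  exact ⟨hv, hc⟩

theorem good_andThen {p : PMF Res} {f : Data → QMem → PMF Res} (hp : ∀ r ∈ p.support, Good r)
    (hf : ∀ x v, v.Valid → ∀ r ∈ (f x v).support, Good r) :
    ∀ r ∈ (andThen p f).support, Good r := by
  intro r hr
  obtain ⟨_, rfl⟩ | ⟨x, v, c, h1, s, h2, rfl⟩ := mem_support_andThen hr
  · intro s hs
    cases hs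
  · intro t ht
    obtain ⟨u, rfl, rfl⟩ := Option.map_eq_some_iff.1 ht
    obtain ⟨h3, h4⟩ := hf x v (hp _ h1 _ rfl).1 _ h2 _ rfl
    exact ⟨h3, h4.trans (by simp only; omega)⟩

theorem good_iter {body : Data → QMem → PMF Res}
    (hf : ∀ x v, v.Valid → ∀ r ∈ (body x v).support, Good r) (n : ℕ) :
    ∀ x v, v.Valid → ∀ r ∈ (iter body n x v).support, Good r := by
  induction n with
  | zero =>
    intro x v _ r hr s hs
    simp only [iter, PMF.support_pure, Set.mem_singleton_iff] at hr
    simp [hr] at hs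
  | succ n ih =>
    intro x v hv
    rw [iter]
    split
    · exact good_done hv (by omega)
    · exact good_andThen (good_done hv (by omega)) fun x v hv => good_andThen (hf x v hv) ih

/-- Bounding the size of the result by the cost is what makes running times compose: the next
program works on data of polynomial size. Validity matters because the promise `QPT.halts` is
restricted to valid memories. -/
theorem good_exec (p : Prog) (T : ℕ) :
    ∀ x v, v.Valid → ∀ r ∈ (exec p T x v).support, Good r := by
  induction p with
  | id => exact fun x v hv => good_done hv (by omega)
  | nil => exact fun x v hv => good_done hv (by simp [Data.size])
  | fst => exact fun x v hv => good_done hv (by have := x.size_fst; omega)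
  | snd => exact fun x v hv => good_done hv (by have := x.size_snd; omega)
  | pair f g hf hg =>
    intro x v hv r hr s hs
    rw [exec] at hr
    obtain ⟨_, rfl⟩ | ⟨y, v₁, c₁, h1, s₁, h2, rfl⟩ := mem_support_andThen hr
    · cases hs
    obtain ⟨u, rfl, rfl⟩ := Option.map_eq_some_iff.1 hs
    obtain ⟨_, h⟩ | ⟨z, v₂, c₂, h3, s₂, h4, h5⟩ := mem_support_andThen h2
    · cases h
    simp only [done, PMF.support_pure, Set.mem_singleton_iff] at h4
    subst h4
    simp only [Option.map_some, Option.some_inj] at h5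
    subst h5
    obtain ⟨a1, a2⟩ := hf x v hv _ h1 _ rfl
    obtain ⟨a3, a4⟩ := hg x v₁ a1 _ h3 _ rfl
    refine ⟨a3, ?_⟩
    -- The charge `1 + x.size ≥ 2` of the pairing pays for the new vertex and for one of the two `+
    -- 1` of the components.
    have := x.one_le_size
    simp only [Data.size] at *
    omega
  | seq f g hf hg =>
    exact fun x v hv => good_andThen (good_done hv (by omega)) fun x v hv =>
      good_andThen (hf x v hv) hg
  | ite c f g hc hf hg =>
    intro x v hv
    refine good_andThen (good_done hv (by omega)) fun x v hv =>
      good_andThen (hc x v hv) fun y v hv => ?_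
    split
    · exact hg x v hv
    · exact hf x v hv
  | loop f hf => exact good_iter hf T
  | coin =>
    intro x v hv r hr
    rw [exec, PMF.mem_support_bind_iff] at hr
    obtain ⟨b, _, hr⟩ := hr
    exact good_done hv (by have := Data.size_bit b; have := x.one_le_size; omega) r hr
  | gate k U => exact fun x v hv => good_done (QMem.valid_gate U hv) (by omega)
  | meas =>
    intro x v hv r hr
    rw [exec, PMF.mem_support_bind_iff] at hr
    obtain ⟨b, hb, hr⟩ := hr
    exact good_done (QMem.valid_of_mem_measure hv hb)
      (by have := Data.size_bit b.1; have := x.one_le_size; omega) r hr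
  | clear =>
    intro x v hv r hr
    rw [exec, PMF.mem_support_bind_iff] at hr
    obtain ⟨b, hb, hr⟩ := hr
    exact good_done (QMem.valid_of_mem_clear hv hb).1 (by omega) r hr

/-! #### More time -/

/-- Every result of `p` is at least as likely in `q`. -/
def Sub (p q : PMF Res) : Prop := ∀ s, p (some s) ≤ q (some s)

theorem Sub.refl (p : PMF Res) : Sub p p := fun _ => le_rfl

theorem sub_andThen {p q : PMF Res} {f g : Data → QMem → PMF Res} (h : Sub p q)
    (h' : ∀ x v, Sub (f x v) (g x v)) : Sub (andThen p f) (andThen q g) := by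
  intro s
  rw [andThen, andThen, PMF.bind_apply, PMF.bind_apply]
  refine ENNReal.tsum_le_tsum fun r => ?_
  rcases r with _ | ⟨⟨x, v⟩, c⟩
  · simp
  · refine mul_le_mul' (h _) ?_
    simp only [PMF.map_apply]
    refine ENNReal.tsum_le_tsum fun r => ?_
    rcases r with _ | r
    · simp
    · split_ifs
      · exact h' x v r
      · exact le_rfl

theorem sub_iter {f g : Data → QMem → PMF Res} (h : ∀ x v, Sub (f x v) (g x v)) {n m : ℕ}
    (hnm : n ≤ m) : ∀ x v, Sub (iter f n x v) (iter g m x v) := by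
  induction n generalizing m with
  | zero =>
    intro x v s
    simp [iter]
  | succ n ih =>
    intro x v
    obtain ⟨m, rfl⟩ : ∃ k, m = k + 1 := ⟨m - 1, by omega⟩
    rw [iter, iter]
    split
    · exact Sub.refl _
    · exact sub_andThen (Sub.refl _) fun x v => sub_andThen (h x v) (ih (by omega))

theorem sub_exec (p : Prog) {T T' : ℕ} (hT : T ≤ T') :
    ∀ x v, Sub (exec p T x v) (exec p T' x v) := by
  induction p with
  | pair f g hf hg =>
    exact fun x v => sub_andThen (hf x v) fun y v => sub_andThen (hg x v) fun _ _ => Sub.refl _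
  | seq f g hf hg =>
    exact fun x v => sub_andThen (Sub.refl _) fun x v => sub_andThen (hf x v) hg
  | ite c f g hc hf hg =>
    refine fun x v => sub_andThen (Sub.refl _) fun x v => sub_andThen (hc x v) fun y v => ?_
    split
    · exact hg x v
    · exact hf x v
  | loop f hf => exact sub_iter hf hT
  | _ => exact fun x v => Sub.refl _

/-- More time only turns cut-off runs into results. If nothing is cut off, the results already have
total mass 1, and a distribution of mass 1 dominated by another one is equal to it. -/
theorem exec_eq_of_le {p : Prog} {T T' : ℕ} (hT : T ≤ T') {x : Data} {v : QMem}
    (h : none ∉ (exec p T x v).support) : exec p T x v = exec p T' x v :=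
  pmf_eq_of_le fun r hr => by
    rcases r with _ | r
    · exact absurd hr h
    · exact sub_exec p hT x v r

/-! #### Maps of the memory -/

/-- Apply `h` to the memory. -/
def mapMem (h : QMem → QMem) : Res → Res := Option.map fun s => ((s.1.1, h s.1.2), s.2)

theorem map_done (h : QMem → QMem) (c : ℕ) (x : Data) (v : QMem) :
    done c x (h v) = (done c x v).map (mapMem h) := by
  simp [done, PMF.pure_map, mapMem]

theorem andThen_map {h : QMem → QMem} {p p' : PMF Res} {f f' : Data → QMem → PMF Res}
    (hp : p' = p.map (mapMem h)) (hf : ∀ x v, f' x (h v) = (f x v).map (mapMem h)) :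
    andThen p' f' = (andThen p f).map (mapMem h) := by
  rw [hp, andThen, andThen, PMF.bind_map, PMF.map_bind]
  congr 1
  funext r
  rcases r with _ | ⟨⟨x, v⟩, c⟩
  · simp [mapMem, PMF.pure_map]
  · simp only [Function.comp_apply, mapMem, Option.map_some, hf, PMF.map_comp]
    congr 1
    funext r
    rcases r with _ | r <;> rfl

theorem iter_map {h : QMem → QMem} {f : Data → QMem → PMF Res}
    (hf : ∀ x v, f x (h v) = (f x v).map (mapMem h)) (n : ℕ) :
    ∀ x v, iter f n x (h v) = (iter f n x v).map (mapMem h) := by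
  induction n with
  | zero => intro x v; simp [iter, PMF.pure_map, mapMem]
  | succ n ih =>
    intro x v
    rw [iter, iter]
    split
    · exact map_done h _ _ _
    · exact andThen_map (map_done h _ _ _) fun x v => andThen_map (hf x v) ih

/-- Programs commute with global phases; classical programs commute with all maps of the memory. -/
theorem exec_map {h : QMem → QMem} (T : ℕ) (p : Prog)
    (hp : p.IsClassical ∨ ∃ z : ℂ, ‖z‖ = 1 ∧ h = (z • ·)) :
    ∀ x v, exec p T x (h v) = (exec p T x v).map (mapMem h) := by
  induction p with
  | pair f g hf hg =>
    intro x v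
    exact andThen_map (hf (hp.imp_left (·.1)) x v) fun y v =>
      andThen_map (hg (hp.imp_left (·.2)) x v) fun z v => map_done h _ _ _
  | seq f g hf hg =>
    intro x v
    exact andThen_map (map_done h _ _ _) fun x v =>
      andThen_map (hf (hp.imp_left (·.1)) x v) (hg (hp.imp_left (·.2)))
  | ite c f g hc hf hg =>
    intro x v
    refine andThen_map (map_done h _ _ _) fun x v =>
      andThen_map (hc (hp.imp_left (·.1)) x v) fun y v => ?_
    split
    · exact hg (hp.imp_left (·.2.2)) x v
    · exact hf (hp.imp_left (·.2.1)) x v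
  | loop f hf => exact iter_map (hf (hp.imp_left fun h => h)) T
  | coin =>
    intro x v
    simp only [exec, PMF.map_bind]
    congr 1
    funext b
    exact map_done h _ _ _
  | gate k U =>
    intro x v
    obtain hp | ⟨z, hz, rfl⟩ := hp
    · exact hp.elim
    · simp only [exec, QMem.gate_smul]
      exact map_done (z • ·) _ _ _
  | meas =>
    intro x v
    obtain hp | ⟨z, hz, rfl⟩ := hp
    · exact hp.elim
    · simp only [exec, QMem.measure_smul hz, PMF.map_bind, PMF.bind_map]
      congr 1
      funext b
      exact map_done (z • ·) _ _ _
  | clear =>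
    intro x v
    obtain hp | ⟨z, hz, rfl⟩ := hp
    · exact hp.elim
    · simp only [exec, QMem.clear_smul hz, PMF.map_bind, PMF.bind_map]
      congr 1
      funext b
      exact map_done (z • ·) _ _ _
  | _ => exact fun x v => map_done h _ _ _

end Prog

/-! ### Polynomial-time processes -/

theorem eval_mono (τ : Polynomial ℕ) {a b : ℕ} (h : a ≤ b) : τ.eval a ≤ τ.eval b := by
  rw [Polynomial.eval_eq_sum_range, Polynomial.eval_eq_sum_range]
  gcongr

/-- A transformation of data and memory. -/
abbrev Procedure : Type := Data → QMem → PMF (Data × QMem)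

namespace Prog

def strip : Res → Option (Data × QMem) := Option.map Prod.fst

/-- The run `p` yields the outcome `μ` at cost at most `c`. -/
structure Spec (p : PMF Res) (μ : PMF (Data × QMem)) (c : ℕ) : Prop where
  map_strip : p.map strip = μ.map some
  cost : ∀ s, some s ∈ p.support → s.2 ≤ c
  good : ∀ r ∈ μ.support, r.2.Valid ∧ r.1.size ≤ c + 1

theorem Spec.none_notMem {p : PMF Res} {μ : PMF (Data × QMem)} {c : ℕ} (h : Spec p μ c) :
    none ∉ p.support := by
  intro hn
  have h1 : (none : Option (Data × QMem)) ∈ (p.map strip).support :=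
    (PMF.mem_support_map_iff _ _ _).2 ⟨none, hn, rfl⟩
  rw [h.map_strip, PMF.mem_support_map_iff] at h1
  obtain ⟨s, _, hs⟩ := h1
  cases hs

theorem Spec.mono {p : PMF Res} {μ : PMF (Data × QMem)} {c c' : ℕ} (h : Spec p μ c)
    (hc : c ≤ c') : Spec p μ c' :=
  ⟨h.map_strip, fun s hs => (h.cost s hs).trans hc, fun r hr =>
    ⟨(h.good r hr).1, (h.good r hr).2.trans (by omega)⟩⟩

theorem spec_done {c c' : ℕ} {x : Data} {v : QMem} (hv : v.Valid) (hx : x.size ≤ c' + 1)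
    (hc : c ≤ c') : Spec (done c x v) (PMF.pure (x, v)) c' := by
  refine ⟨by simp [done, PMF.pure_map, strip], fun s hs => ?_, fun r hr => ?_⟩
  · simp only [done, PMF.support_pure, Set.mem_singleton_iff, Option.some_inj] at hs
    rw [hs]
    exact hc
  · simp only [PMF.support_pure, Set.mem_singleton_iff] at hr
    rw [hr]
    exact ⟨hv, hx⟩

theorem spec_andThen {p : PMF Res} {μ : PMF (Data × QMem)} {c c' : ℕ}
    {f : Data → QMem → PMF Res} {G : Procedure} (hp : Spec p μ c)
    (hf : ∀ r ∈ μ.support, Spec (f r.1 r.2) (G r.1 r.2) c') :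
    Spec (andThen p f) (μ.bind fun r => G r.1 r.2) (c + c') := by
  refine ⟨?_, fun s hs => ?_, fun r hr => ?_⟩
  -- Once the costs are stripped, continuing a run is a bind that keeps `none`; `H` is its
  -- continuation.
  · let H : Option (Data × QMem) → PMF (Option (Data × QMem)) := fun o =>
      o.elim (PMF.pure none) fun s => (f s.1 s.2).map strip
    have h1 : (andThen p f).map strip = (p.map strip).bind H := by
      rw [andThen, PMF.map_bind, PMF.bind_map]
      congr 1
      funext r
      rcases r with _ | ⟨⟨x, v⟩, c⟩
      · simp [H, strip, PMF.pure_map]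
      · simp only [Function.comp_apply, strip, Option.map_some, H, Option.elim_some, PMF.map_comp]
        congr 1
        funext r
        rcases r with _ | r <;> rfl
    rw [h1, hp.map_strip, PMF.bind_map, PMF.map_bind]
    exact bind_congr_support fun r hr => (hf r hr).map_strip
  · obtain ⟨_, h⟩ | ⟨x, v, d, h1, t, h2, h3⟩ := mem_support_andThen hs
    · cases h
    obtain ⟨u, rfl, rfl⟩ := Option.map_eq_some_iff.1 h3.symm
    have hm : some (x, v) ∈ (μ.map some).support := by
      rw [← hp.map_strip]
      exact (PMF.mem_support_map_iff _ _ _).2 ⟨_, h1, rfl⟩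
    obtain ⟨r, hr, hr'⟩ := (PMF.mem_support_map_iff _ _ _).1 hm
    rw [Option.some_inj] at hr'
    subst hr'
    exact add_le_add (hp.cost _ h1) ((hf _ hr).cost _ h2)
  · obtain ⟨s, hs, hr⟩ := (PMF.mem_support_bind_iff _ _ _).1 hr
    obtain ⟨h1, h2⟩ := (hf s hs).good r hr
    exact ⟨h1, by omega⟩

theorem spec_bind {α : Type} {p : PMF α} {c : ℕ} {f : α → PMF Res} {G : α → PMF (Data × QMem)}
    (h : ∀ a ∈ p.support, Spec (f a) (G a) c) : Spec (p.bind f) (p.bind G) c := by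
  refine ⟨?_, fun s hs => ?_, fun r hr => ?_⟩
  · rw [PMF.map_bind, PMF.map_bind]
    exact bind_congr_support fun a ha => (h a ha).map_strip
  · obtain ⟨a, ha, hs⟩ := (PMF.mem_support_bind_iff _ _ _).1 hs
    exact (h a ha).cost s hs
  · obtain ⟨a, ha, hr⟩ := (PMF.mem_support_bind_iff _ _ _).1 hr
    exact (h a ha).good r hr

/-- In time `τ` the program `p` performs the process `F` (on valid memories). -/
def Implements (p : Prog) (τ : Polynomial ℕ) (F : Procedure) : Prop :=
  ∀ x v, v.Valid → ∀ T, τ.eval x.size ≤ T → Spec (exec p T x v) (F x v) (τ.eval x.size)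

end Prog

open Prog

/-- The process `F` can be performed in polynomial time, by a classical program if `cl` holds. -/
def Feasible (cl : Prop) (F : Procedure) : Prop :=
  ∃ p τ, (cl → p.IsClassical) ∧ Implements p τ F

namespace Feasible

variable {cl : Prop} {F G : Procedure}

theorem weaken (h : Feasible True F) : Feasible cl F := by
  obtain ⟨p, τ, h1, h2⟩ := h
  exact ⟨p, τ, fun _ => h1 trivial, h2⟩

theorem congr (h : Feasible cl F) (hFG : ∀ x v, v.Valid → F x v = G x v) : Feasible cl G := by
  obtain ⟨p, τ, h1, h2⟩ := h
  exact ⟨p, τ, h1, fun x v hv T hT => hFG x v hv ▸ h2 x v hv T hT⟩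

theorem basic {p : Prog} (hc : cl → p.IsClassical)
    (h : ∀ T x v, v.Valid → Spec (exec p T x v) (F x v) (x.size + 2)) : Feasible cl F :=
  ⟨p, Polynomial.X + 2, hc, fun x v hv T _ => by simpa using h T x v hv⟩

theorem id : Feasible cl fun x v => PMF.pure (x, v) :=
  basic (p := Prog.id) (fun _ => trivial) fun _ _ _ hv => spec_done hv (by omega) (by omega)

theorem nil : Feasible cl fun _ v => PMF.pure (Data.nil, v) :=
  basic (p := Prog.nil) (fun _ => trivial) fun _ _ _ hv =>
    spec_done hv (by simp [Data.size]) (by omega)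

theorem fst : Feasible cl fun x v => PMF.pure (x.fst, v) :=
  basic (p := Prog.fst) (fun _ => trivial) fun _ x _ hv =>
    spec_done hv (by have := x.size_fst; omega) (by omega)

theorem snd : Feasible cl fun x v => PMF.pure (x.snd, v) :=
  basic (p := Prog.snd) (fun _ => trivial) fun _ x _ hv =>
    spec_done hv (by have := x.size_snd; omega) (by omega)

theorem gate (k : ℕ) (U : Unitary k) : Feasible False fun x v => PMF.pure (x,
    QMem.gate (U : Matrix (Bits k) (Bits k) ℂ)
      (fun i : Fin k => (x.toList.getD i Data.nil).toNat) v) :=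
  basic (p := Prog.gate k U) (fun h => h.elim) fun _ _ _ hv =>
    spec_done (QMem.valid_gate U hv) (by omega) (by omega)

theorem meas : Feasible False fun x v =>
    (QMem.measure x.toNat v).map fun r => (Data.bit r.1, r.2) :=
  basic (p := Prog.meas) (fun h => h.elim) fun _ x _ hv =>
    spec_bind fun r hr => spec_done (QMem.valid_of_mem_measure hv hr)
      (by have := Data.size_bit r.1; have := x.one_le_size; omega) (by omega)

theorem clear : Feasible False fun x v => (QMem.clear x.toNat v).map fun w => (x, w) :=
  basic (p := Prog.clear) (fun h => h.elim) fun _ x _ hv =>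
    spec_bind fun r hr => spec_done (QMem.valid_of_mem_clear hv hr).1 (by omega) (by omega)

theorem seq (hF : Feasible cl F) (hG : Feasible cl G) :
    Feasible cl fun x v => (F x v).bind fun r => G r.1 r.2 := by
  obtain ⟨p, τ, hp, hF⟩ := hF
  obtain ⟨q, σ, hq, hG⟩ := hG
  -- The result of `p` has size at most its cost plus 1, so `q` costs at most `σ (τ + 1)`.
  refine ⟨Prog.seq p q, (1 + Polynomial.X) + (τ + σ.comp (τ + 1)),
    fun h => ⟨hp h, hq h⟩, fun x v hv T hT => ?_⟩
  simp only [Polynomial.eval_add, Polynomial.eval_comp, Polynomial.eval_one,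
    Polynomial.eval_X] at hT ⊢
  have := spec_andThen (c := 1 + x.size) (G := fun x v => (F x v).bind fun r => G r.1 r.2)
    (f := fun x v => andThen (exec p T x v) fun y v => exec q T y v)
    (spec_done (c := 1 + x.size) (x := x) hv (by omega) le_rfl) (c' := τ.eval x.size +
      σ.eval (τ.eval x.size + 1)) fun r hr => by
      simp only [PMF.support_pure, Set.mem_singleton_iff] at hr
      subst hr
      have h1 := hF x v hv T (by omega)
      refine spec_andThen h1 fun s hs => ?_
      obtain ⟨h2, h3⟩ := h1.good s hs
      have h4 := eval_mono σ h3
      exact (hG s.1 s.2 h2 T (by omega)).mono h4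
  rw [exec]
  simpa only [PMF.pure_bind] using this

theorem pair (hF : Feasible cl F) (hG : Feasible cl G) :
    Feasible cl fun x v => (F x v).bind fun r =>
      (G x r.2).map fun s => (Data.node r.1 s.1, s.2) := by
  obtain ⟨p, τ, hp, hF⟩ := hF
  obtain ⟨q, σ, hq, hG⟩ := hG
  -- The last bracket bounds both the charge `1 + x.size` of the pairing and the size of the new
  -- node, whose components have sizes at most `τ + 1` and `σ + 1`.
  refine ⟨Prog.pair p q, τ + (σ + (Polynomial.X + τ + σ + 3)),
    fun h => ⟨hp h, hq h⟩, fun x v hv T hT => ?_⟩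
  simp only [Polynomial.eval_add, Polynomial.eval_X, Polynomial.eval_ofNat] at hT ⊢
  have h1 := hF x v hv T (by omega)
  rw [exec]
  refine spec_andThen (G := fun y w => (G x w).map fun s => (Data.node y s.1, s.2)) h1
    fun r hr => ?_
  obtain ⟨h2, h3⟩ := h1.good r hr
  have h4 := hG x r.2 h2 T (by omega)
  rw [← PMF.bind_pure_comp]
  refine spec_andThen (G := fun z w => PMF.pure (Data.node r.1 z, w)) h4 fun s hs => ?_
  obtain ⟨h5, h6⟩ := h4.good s hs
  exact spec_done h5 (by simp only [Data.size]; omega) (by omega)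

open scoped Classical in
theorem ite {C : Procedure} (hC : Feasible cl C) (hF : Feasible cl F) (hG : Feasible cl G) :
    Feasible cl fun x v => (C x v).bind fun r => if r.1 = Data.nil then G x r.2 else F x r.2 := by
  obtain ⟨o, ρ, ho, hC⟩ := hC
  obtain ⟨p, τ, hp, hF⟩ := hF
  obtain ⟨q, σ, hq, hG⟩ := hG
  refine ⟨Prog.ite o p q, (1 + Polynomial.X) + (ρ + (τ + σ)),
    fun h => ⟨ho h, hp h, hq h⟩, fun x v hv T hT => ?_⟩
  simp only [Polynomial.eval_add, Polynomial.eval_one, Polynomial.eval_X] at hT ⊢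
  have := spec_andThen (c := 1 + x.size)
    (G := fun x v => (C x v).bind fun r => if r.1 = Data.nil then G x r.2 else F x r.2)
    (f := fun x v => andThen (exec o T x v) fun y v =>
      match y with
      | Data.nil => exec q T x v
      | Data.node _ _ => exec p T x v)
    (spec_done (c := 1 + x.size) (x := x) hv (by omega) le_rfl) (c' := ρ.eval x.size +
      (τ.eval x.size + σ.eval x.size)) fun r hr => by
      simp only [PMF.support_pure, Set.mem_singleton_iff] at hr
      subst hr
      have h1 := hC x v hv T (by omega)
      refine spec_andThen (G := fun y w => if y = Data.nil then G x w else F x w) h1 fun s hs => ?_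
      obtain ⟨h2, h3⟩ := h1.good s hs
      rcases s with ⟨_ | ⟨a, b⟩, w⟩
      · simpa using (hG x w h2 T (by omega)).mono (Nat.le_add_left _ (τ.eval x.size))
      · simpa using (hF x w h2 T (by omega)).mono (Nat.le_add_right _ (σ.eval x.size))
  simp only [PMF.pure_bind] at this
  exact this

/-- First `F`, then `G` on the pair of the input and the result of `F`. -/
theorem bind (hF : Feasible cl F) (hG : Feasible cl G) :
    Feasible cl fun x v => (F x v).bind fun r => G (Data.node x r.1) r.2 := by
  refine ((id.pair hF).seq hG).congr fun x v _ => ?_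
  simp [PMF.bind_map, Function.comp_def]

end Feasible

/-! #### Deterministic functions -/

/-- Functions that can be computed in polynomial time. -/
def Computable (f : Data → Data) : Prop := Feasible True fun x v => PMF.pure (f x, v)

namespace Computable

variable {f g : Data → Data}

theorem id : Computable fun x => x := Feasible.id

theorem fst (hf : Computable f) : Computable fun x => (f x).fst :=
  (Feasible.seq hf Feasible.fst).congr fun x v _ => by simp

theorem snd (hf : Computable f) : Computable fun x => (f x).snd :=
  (Feasible.seq hf Feasible.snd).congr fun x v _ => by simp

theorem comp (hf : Computable f) (hg : Computable g) : Computable fun x => f (g x) :=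
  (Feasible.seq hg hf).congr fun x v _ => by simp

theorem node (hf : Computable f) (hg : Computable g) :
    Computable fun x => Data.node (f x) (g x) :=
  (Feasible.pair hf hg).congr fun x v _ => by simp [PMF.pure_map]

theorem const (d : Data) : Computable fun _ => d := by
  induction d with
  | nil => exact Feasible.nil
  | node a b ha hb => exact ha.node hb

open scoped Classical in
theorem ite {c : Data → Data} (hc : Computable c) (hf : Computable f) (hg : Computable g) :
    Computable fun x => if c x = Data.nil then g x else f x :=
  (Feasible.ite hc hf hg).congr fun x v _ => by
    simp only [PMF.pure_bind]
    split_ifs <;> rfl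

end Computable

open scoped Classical in
/-- Predicates that can be decided in polynomial time. -/
def Checkable (P : Data → Prop) : Prop := Computable fun x => Data.bit (decide (P x))

namespace Checkable

variable {P R : Data → Prop} {f : Data → Data}

theorem congr (h : Checkable P) (hPR : ∀ x, P x ↔ R x) : Checkable R := by
  have : P = R := funext fun x => propext (hPR x)
  exact this ▸ h

theorem ne_nil (hf : Computable f) : Checkable fun x => f x ≠ Data.nil := by
  classical
  refine (hf.ite (Computable.const (Data.bit true)) (Computable.const (Data.bit false))).congr
    fun x v _ => ?_
  by_cases h : f x = Data.nil <;> simp [h]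

theorem not (h : Checkable P) : Checkable fun x => ¬ P x := by
  classical
  refine (Computable.ite h (Computable.const (Data.bit false))
    (Computable.const (Data.bit true))).congr fun x v _ => ?_
  by_cases h : P x <;> simp [h, Data.bit]

theorem and (h : Checkable P) (h' : Checkable R) : Checkable fun x => P x ∧ R x := by
  classical
  refine (Computable.ite h h' (Computable.const (Data.bit false))).congr fun x v _ => ?_
  by_cases h : P x <;> simp [h, Data.bit]

theorem comp (h : Checkable P) (hf : Computable f) : Checkable fun x => P (f x) :=
  Computable.comp h hf

/-- Only comparisons with constants are ever needed, so the recursion over `d` is unrolled into the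
program and no loop has to be written or analysed. -/
theorem eq_const (d : Data) : Checkable fun x => x = d := by
  induction d with
  | nil => exact (ne_nil Computable.id).not.congr fun x => by simp
  | node a b ha hb =>
    refine ((ne_nil Computable.id).and ((ha.comp Computable.id.fst).and
      (hb.comp Computable.id.snd))).congr fun x => ?_
    cases x <;> simp [Data.fst, Data.snd]

end Checkable

open scoped Classical in
theorem Feasible.cond {cl : Prop} {F G : Procedure} {P : Data → Prop} (hP : Checkable P)
    (hF : Feasible cl F) (hG : Feasible cl G) :
    Feasible cl fun x v => if P x then F x v else G x v :=
  (Feasible.ite (Feasible.weaken hP) hF hG).congr fun x v _ => by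
    by_cases h : P x <;> simp [h, Data.bit]

theorem partialInv_eq_some {α β : Type*} {f : α → β} (hf : Function.Injective f) {a : α} {b : β} :
    Function.partialInv f b = some a ↔ f a = b :=
  hf.isPartialInv a b

/-- Finitely many cases, which are distinguished by the value of a computable function. -/
theorem Feasible.cases {cl : Prop} {ι : Type*} [Finite ι] {key : ι → Data}
    (hkey : Function.Injective key) {f : Data → Data} (hf : Computable f) {F : ι → Procedure}
    (hF : ∀ i, Feasible cl (F i)) {G : Procedure} (hG : Feasible cl G) :
    Feasible cl fun x v =>
      (Function.partialInv key (f x)).elim (G x v) fun i => F i x v := by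
  classical
  have := Fintype.ofFinite ι
  -- The case distinction becomes a chain of comparisons with the constants `key i`, built by
  -- induction on a list of the cases.
  have h : ∀ l : List ι, Feasible cl fun x v =>
      (l.find? fun i => decide (f x = key i)).elim (G x v) fun i => F i x v := by
    intro l
    induction l with
    | nil => simpa using hG
    | cons i l ih =>
      refine (Feasible.cond ((Checkable.eq_const (key i)).comp hf) (hF i) ih).congr fun x v _ => ?_
      by_cases h : f x = key i <;> simp [h]
  refine (h Finset.univ.toList).congr fun x v _ => ?_
  congr 1
  cases hx : Function.partialInv key (f x) with
  | none =>
    rw [List.find?_eq_none]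
    intro i _ hi
    rw [decide_eq_true_iff] at hi
    rw [(partialInv_eq_some hkey).2 hi.symm] at hx
    cases hx
  | some i =>
    rw [partialInv_eq_some hkey] at hx
    have : (fun j => decide (f x = key j)) = fun j => decide (i = j) := by
      funext j
      rw [← hx]
      simp [hkey.eq_iff]
    rw [this]
    cases hfd : List.find? (fun j => decide (i = j)) Finset.univ.toList with
    | none =>
      rw [List.find?_eq_none] at hfd
      exact absurd (hfd i (by simp)) (by simp)
    | some j =>
      have := List.find?_some hfd
      rw [decide_eq_true_iff] at this
      rw [this]

/-- Functions given by finite tables are computable. -/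
theorem Computable.table {ι : Type*} [Finite ι] {key : ι → Data} (hkey : Function.Injective key)
    (val : ι → Data) (dflt : Data) :
    Computable fun x => (Function.partialInv key x).elim dflt val :=
  (Feasible.cases hkey Computable.id (F := fun i _ v => PMF.pure (val i, v))
    (fun i => Computable.const (val i)) (G := fun _ v => PMF.pure (dflt, v))
    (Computable.const dflt)).congr fun x v _ => by
      beta_reduce
      cases Function.partialInv key x <;> rfl

/-! #### Randomised functions -/

/-- Randomised functions that can be computed in polynomial time. -/
def PolyTime (f : Data → PMF Data) : Prop := Feasible True fun x v => (f x).map fun y => (y, v)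

namespace PolyTime

variable {f g : Data → PMF Data}

theorem pure {h : Data → Data} (hh : Computable h) : PolyTime fun x => PMF.pure (h x) :=
  hh.congr fun x v _ => by simp [PMF.pure_map]

theorem comp {h : Data → Data} (hf : PolyTime f) (hh : Computable h) : PolyTime fun x => f (h x) :=
  (Feasible.seq hh hf).congr fun x v _ => by simp

theorem bind (hf : PolyTime f) (hg : PolyTime g) :
    PolyTime fun x => (f x).bind fun y => g (Data.node x y) :=
  (Feasible.bind hf hg).congr fun x v _ => by
    simp [PMF.bind_map, PMF.map_bind, Function.comp_def]

theorem map {h : Data → Data} (hf : PolyTime f) (hh : Computable h) :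
    PolyTime fun x => (f x).map h :=
  (Feasible.seq hf hh).congr fun x v _ => by
    simp only [PMF.bind_map, Function.comp_def]
    rw [PMF.map_comp, ← PMF.bind_pure_comp]
    rfl

theorem cases {ι : Type*} [Finite ι] {key : ι → Data} (hkey : Function.Injective key)
    {h : Data → Data} (hh : Computable h) {F : ι → Data → PMF Data} (hF : ∀ i, PolyTime (F i))
    (hg : PolyTime g) :
    PolyTime fun x => (Function.partialInv key (h x)).elim (g x) fun i => F i x :=
  (Feasible.cases hkey hh hF hg).congr fun x v _ => by
    beta_reduce
    cases Function.partialInv key (h x) <;> rfl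

end PolyTime

/-! #### Algorithms -/

theorem Prog.mem_support_within {p : Prog} {T : ℕ} {x : Data} {v : QMem} {r : Option (Data × QMem)} :
    r ∈ (p.within T x v).support ↔ ∃ s ∈ (exec p T x v).support,
      (s.bind fun s => if s.2 ≤ T then some s.1 else none) = r :=
  PMF.mem_support_map_iff _ _ _

/-- `halts` speaks of the run with exactly the promised bound, whereas a subroutine runs with the
larger bound of the program around it; `exec_eq_of_le` identifies the two runs. -/
theorem QPT.implements (A : QPT) : Implements A.prog A.time A.run := by
  intro x v hv T hT
  have h := A.halts x v hv
  have h1 : ∀ r ∈ (exec A.prog (A.time.eval x.size) x v).support, ∃ s, r = some s ∧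
      s.2 ≤ A.time.eval x.size := by
    intro r hr
    rcases r with _ | s
    · exact absurd (mem_support_within.2 ⟨_, hr, rfl⟩) h
    · refine ⟨s, rfl, ?_⟩
      by_contra hs
      exact h (mem_support_within.2 ⟨_, hr, by simp [hs]⟩)
  have h2 : none ∉ (exec A.prog (A.time.eval x.size) x v).support := fun hn => by
    obtain ⟨s, hs, _⟩ := h1 _ hn
    cases hs
  rw [← exec_eq_of_le hT h2]
  refine ⟨?_, fun s hs => ?_, fun r hr => ?_⟩
  · rw [QPT.run, within, PMF.map_comp, PMF.map_comp]
    refine map_congr_support fun r hr => ?_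
    obtain ⟨s, rfl, hs⟩ := h1 r hr
    simp [strip, hs]
  · obtain ⟨t, ht, hs⟩ := h1 _ hs
    cases ht
    exact hs
  · rw [QPT.run, within, PMF.map_comp, PMF.mem_support_map_iff] at hr
    obtain ⟨s, hs, rfl⟩ := hr
    have hg := good_exec A.prog _ x v hv s hs
    obtain ⟨t, rfl, ht⟩ := h1 s hs
    obtain ⟨h3, h4⟩ := hg t rfl
    simp only [Function.comp_apply, Option.bind_some, ht, if_true, Option.getD_some]
    exact ⟨h3, by omega⟩

theorem QPT.feasible (A : QPT) : Feasible False A.run :=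
  ⟨A.prog, A.time, False.elim, A.implements⟩

theorem Prog.Implements.halts {p : Prog} {τ : Polynomial ℕ} {F : Procedure} (h : Implements p τ F)
    (x : Data) (v : QMem) (hv : v.Valid) :
    none ∉ (p.within (τ.eval x.size) x v).support := by
  intro hn
  obtain ⟨s, hs, h'⟩ := mem_support_within.1 hn
  have hsp := h x v hv _ le_rfl
  rcases s with _ | s
  · exact hsp.none_notMem hs
  · simp [hsp.cost s hs] at h'

theorem Prog.Implements.run_eq {p : Prog} {τ : Polynomial ℕ} {F : Procedure} (h : Implements p τ F)
    (x : Data) (v : QMem) (hv : v.Valid) :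
    QPT.run ⟨p, τ, h.halts⟩ x v = F x v := by
  have hsp := h x v hv _ le_rfl
  have h1 : ((exec p (τ.eval x.size) x v).map strip).map (fun r => r.getD (Data.nil, v)) = F x v := by
    rw [hsp.map_strip, PMF.map_comp]
    exact PMF.map_id _
  rw [← h1, QPT.run, within, PMF.map_comp, PMF.map_comp]
  refine map_congr_support fun r hr => ?_
  rcases r with _ | s
  · exact absurd hr hsp.none_notMem
  · simp [strip, hsp.cost s hr]

theorem Feasible.exists_qpt {F : Procedure} (h : Feasible False F) :
    ∃ A : QPT, ∀ x v, v.Valid → A.run x v = F x v := by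
  obtain ⟨p, τ, _, h⟩ := h
  exact ⟨⟨p, τ, h.halts⟩, h.run_eq⟩

theorem QPT.valid_of_mem_run (A : QPT) {x : Data} {v : QMem} (hv : v.Valid) {r : Data × QMem}
    (hr : r ∈ (A.run x v).support) : r.2.Valid := by
  exact ((A.implements x v hv _ le_rfl).good r hr).1

theorem QPT.run_map (A : QPT) {h : QMem → QMem}
    (hA : A.prog.IsClassical ∨ ∃ z : ℂ, ‖z‖ = 1 ∧ h = (z • ·)) (x : Data) (v : QMem) :
    A.run x (h v) = (A.run x v).map fun r => (r.1, h r.2) := by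
  simp only [QPT.run, within, exec_map _ _ hA, PMF.map_comp]
  congr 1
  funext r
  rcases r with _ | s
  · rfl
  · by_cases hs : s.2 ≤ A.time.eval x.size <;> simp [mapMem, hs]

/-- A classical program commutes with every map of the memory, in particular with the constant map
to `v`. So its run on `v` is the run on the empty memory with `v` put back, and classical algorithms
may be used as subroutines next to quantum data. -/
theorem PPT.polyTime (A : PPT) : PolyTime A.run := by
  refine ⟨A.prog, A.time, fun _ => A.classical, ?_⟩
  have key : ∀ x v, A.toQPT.run x v = (A.run x).map fun y => (y, v) := fun x v => by
    rw [PPT.run, PMF.map_comp]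
    exact A.toQPT.run_map (h := fun _ => v) (Or.inl A.classical) x QMem.vac
  intro x v hv T hT
  beta_reduce
  rw [← key]
  exact A.toQPT.implements x v hv T hT

theorem PolyTime.exists_ppt {f : Data → PMF Data} (h : PolyTime f) : ∃ A : PPT, A.run = f := by
  obtain ⟨p, τ, hc, h⟩ := h
  refine ⟨⟨⟨p, τ, h.halts⟩, hc trivial⟩, funext fun x => ?_⟩
  rw [PPT.run, h.run_eq x _ QMem.valid_vac, PMF.map_comp]
  exact PMF.map_id _

/-! ### Probabilities of events -/

section Events

variable {α : Type*}

theorem Pr_not (p : PMF α) (E : α → Prop) : Pr p (fun a => ¬ E a) = 1 - Pr p E := by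
  classical
  have h := expect_sub p (isBdd_const 1) (isUnit01_ite E).isBdd
  rw [expect_const] at h
  rw [Pr_eq_expect, Pr_eq_expect, ← h]
  refine expect_congr fun a _ => ?_
  by_cases h : E a <;> simp [h]

theorem Pr_exists_le {ι : Type*} (p : PMF α) (s : Finset ι) (E : ι → α → Prop) :
    Pr p (fun a => ∃ i ∈ s, E i a) ≤ ∑ i ∈ s, Pr p (E i) := by
  classical
  simp only [Pr_eq_expect]
  rw [← expect_sum p s fun i _ => (isUnit01_ite (E i)).isBdd]
  refine expect_mono (isUnit01_ite _).isBdd (IsBdd.sum s fun i _ => (isUnit01_ite (E i)).isBdd)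
    fun a _ => ?_
  have h0 : ∀ i ∈ s, (0 : ℝ) ≤ if E i a then 1 else 0 := fun i _ => (isUnit01_ite (E i) a).1
  by_cases h : ∃ i ∈ s, E i a
  · obtain ⟨i, hi, hE⟩ := h
    rw [if_pos ⟨i, hi, hE⟩]
    exact (by simp [hE] : (1 : ℝ) = if E i a then 1 else 0).trans_le
      (Finset.single_le_sum h0 hi)
  · rw [if_neg h]
    exact Finset.sum_nonneg h0

theorem Pr_congr {p : PMF α} {E F : α → Prop} (h : ∀ a ∈ p.support, E a ↔ F a) :
    Pr p E = Pr p F :=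
  le_antisymm (Pr_mono fun a ha => (h a ha).1) (Pr_mono fun a ha => (h a ha).2)

theorem Pr_pure (a : α) (E : α → Prop) [Decidable (E a)] :
    Pr (PMF.pure a) E = if E a then 1 else 0 := by
  classical
  rw [Pr_eq_expect, expect_pure]
  congr

theorem Pr_false (p : PMF α) {E : α → Prop} (h : ∀ a ∈ p.support, ¬ E a) : Pr p E = 0 := by
  classical
  rw [Pr_congr (F := fun _ => False) fun a ha => by simp [h a ha], Pr_eq_expect]
  simp [expect_const]

theorem sum_weights [Fintype α] (p : PMF α) : ∑ a, (p a).toReal = 1 := by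
  rw [← tsum_fintype (L := .unconditional α), tsum_toReal]

theorem expect_finite_support (p : PMF α) (hp : p.support.Finite) (f : α → ℝ) :
    expect p f = ∑ a ∈ hp.toFinset, (p a).toReal * f a := by
  refine tsum_eq_sum fun a ha => ?_
  rw [Set.Finite.mem_toFinset, PMF.mem_support_iff, not_not] at ha
  simp [ha]

theorem sum_weights_support (p : PMF α) (hp : p.support.Finite) :
    ∑ a ∈ hp.toFinset, (p a).toReal = 1 := by
  simpa [expect_const] using (expect_finite_support p hp fun _ => 1).symm

end Events

/-! ### Encodings as data -/

@[simp] theorem Data.fst_node (a b : Data) : (Data.node a b).fst = a := rfl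

@[simp] theorem Data.snd_node (a b : Data) : (Data.node a b).snd = b := rfl

theorem Data.ofList_injective : Function.Injective Data.ofList := by
  intro a
  induction a with
  | nil => intro b h; cases b <;> simp_all [Data.ofList]
  | cons x a ih =>
    intro b h
    cases b with
    | nil => simp [Data.ofList] at h
    | cons y b =>
      simp only [Data.ofList, Data.node.injEq] at h
      rw [h.1, ih h.2]

theorem Data.bit_injective : Function.Injective Data.bit := by
  intro a b h
  cases a <;> cases b <;> simp_all [Data.bit]

theorem Data.toList_ofList (l : List Data) : (Data.ofList l).toList = l := by
  induction l with
  | nil => rfl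
  | cons a l ih => simp [Data.ofList, Data.toList, ih]

theorem Data.toNat_unary (n : ℕ) : (Data.unary n).toNat = n := by
  simp [Data.toNat, Data.unary, Data.toList_ofList]

theorem Data.unary_injective : Function.Injective Data.unary :=
  Function.LeftInverse.injective Data.toNat_unary

theorem ofBits_injective {n : ℕ} : Function.Injective (ofBits : Bits n → Data) := by
  intro x y h
  have := List.ofFn_injective (Data.ofList_injective h)
  exact funext fun i => Data.bit_injective (congrFun this i)

theorem toBits_ofBits {n : ℕ} (x : Bits n) : toBits n (ofBits x) = x := by
  funext i
  rw [toBits, ofBits, Data.toList_ofList, List.getD_eq_getElem _ _ (by simp)]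
  cases h : x i <;> simp [h, Data.bit]

variable {Q : Type} [Fintype Q] [DecidableEq Q]

/-! ### Truth tables and the constant of the game -/

namespace Game

variable (G : Game Q)

/-- Otherwise the point mass at `τ` would be a non-contextual strategy of value 1. -/
theorem exists_context_not_pred (hG : G.valNC < 1) (τ : Q → G.A) :
    ∃ C : G.contexts, G.pred C.1 (G.restrict τ C.1) = false := by
  classical
  by_contra! h
  simp only [ne_eq, Bool.not_eq_false] at h
  refine not_le.2 hG (le_csSup ?_ ?_)
  -- A crude bound is enough: `le_csSup` only asks that the values be bounded above.
  · refine ⟨∑ C : G.contexts, ∑ _a : C.1 → G.A, (G.D C).toReal, ?_⟩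
    rintro v ⟨P, ⟨μ, hμ⟩, rfl⟩
    refine Finset.sum_le_sum fun C _ => Finset.sum_le_sum fun a _ => ?_
    refine mul_le_of_le_one_left ENNReal.toReal_nonneg ?_
    split_ifs
    · rw [hμ C.1 C.2 a]
      exact Pr_le_one _ _
    · exact zero_le_one
  · refine ⟨fun C a => Pr (PMF.pure τ) fun τ => G.restrict τ C = a, ⟨PMF.pure τ, fun _ _ _ => rfl⟩, ?_⟩
    rw [val, ← sum_weights G.D]
    refine Finset.sum_congr rfl fun C _ => ?_
    rw [Finset.sum_eq_single (G.restrict τ C.1)]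
    · simp [h C, Pr_pure]
    · intro a _ ha
      simp [Pr_pure, Ne.symm ha]
    · simp

theorem nonempty_contexts : Nonempty G.contexts := G.D.support_nonempty.to_type

theorem const₁_le (C : G.contexts) : G.const₁ ≤ (G.D C).toReal / (C.1.card : ℝ) :=
  ciInf_le (Set.finite_range _).bddBelow C

theorem const₁_nonneg : 0 ≤ G.const₁ :=
  have := G.nonempty_contexts
  le_ciInf fun _ => by positivity

theorem card_pos (C : G.contexts) : (0 : ℝ) < C.1.card := by
  exact_mod_cast (G.context_nonempty C.1 C.2).card_pos

end Game

/-! ### Soundness: rewinding a classical prover -/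

section Soundness

variable (G : Game Q) (E : QFHE) {n : ℕ} (P : OPad n (E.K n) (E.keyCode n)) (cd : Coding G)

/-- The verifier of the compiled game accepts. -/
def Accepts (C : G.contexts) (q : Q) (sk t₃ t₇ : Data) : Prop :=
  ∃ a : C.1 → G.A, ofBits (cd.vec C.1 a) = E.decFun sk t₃ ∧
    G.pred C.1 a = true ∧ ∃ h : q ∈ C.1, cd.ans (a ⟨q, h⟩) = t₇

/-- The answer which is described by `y`, or an arbitrary one. -/
def readAns (y : Data) : G.A := (Function.partialInv cd.ans y).getD (Classical.arbitrary G.A)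

/-- Codes of truth tables. -/
def tableCode (τ : Q → G.A) : Data := Data.unary (Fintype.equivFin (Q → G.A) τ)

theorem tableCode_injective : Function.Injective (tableCode G) := fun _ _ h =>
  (Fintype.equivFin _).injective (Fin.ext (Data.unary_injective h))

theorem readAns_ans (a : G.A) : readAns G cd (cd.ans a) = a := by
  rw [readAns, (partialInv_eq_some cd.ans_inj).2 rfl, Option.getD_some]

/-- A truth table from the answers of `A` to the questions in a list. -/
def extract (A : PPT) (k m : Data) : List Q → PMF (Q → G.A)
  | [] => PMF.pure fun _ => Classical.arbitrary G.A
  | q :: L => (A.run (Data.node m.snd.snd (Data.node (cd.que q) k))).bind fun r =>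
      (extract A k m L).map fun τ => Function.update τ q (readAns G cd r.fst)

/-- The extraction consists of one run of `A` for each entry of a fixed list. Decoding an answer and
updating a truth table are functions on finite sets, hence finite tables; the key `k` is hard-wired.
-/
theorem polyTime_extract (A : PPT) (k : Data) (L : List Q) :
    PolyTime fun m => (extract G cd A k m L).map (tableCode G) := by
  induction L with
  | nil =>
    simp only [extract, PMF.pure_map]
    exact PolyTime.pure (Computable.const _)
  | cons q L ih =>
    have h1 : PolyTime fun m => A.run (Data.node m.snd.snd (Data.node (cd.que q) k)) :=
      A.polyTime.comp (Computable.id.snd.snd.node (Computable.const _))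
    have h2 : Computable fun x => cd.ans (readAns G cd x) := by
      refine (Computable.table cd.ans_inj cd.ans (cd.ans (Classical.arbitrary G.A))).congr
        fun x v _ => ?_
      simp only [readAns]
      cases Function.partialInv cd.ans x <;> rfl
    have hk : Function.Injective fun p : (Q → G.A) × G.A =>
        Data.node (tableCode G p.1) (cd.ans p.2) := by
      intro p p' h
      simp only [Data.node.injEq] at h
      exact Prod.ext (tableCode_injective G h.1) (cd.ans_inj h.2)
    have h3 := Computable.table hk (fun p => tableCode G (Function.update p.1 q p.2)) Data.nil
    have h4 := h1.bind ((ih.comp Computable.id.fst).bind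
      (PolyTime.pure (h3.comp (Computable.id.snd.node (h2.comp Computable.id.fst.snd.fst)))))
    refine h4.congr fun x v _ => ?_
    congr 1
    simp only [extract, PMF.map_bind, Data.fst_node, Data.snd_node]
    congr 1
    funext r
    rw [PMF.bind_map, PMF.map_comp, ← PMF.bind_pure_comp]
    congr 1
    funext τ
    simp only [Function.comp_apply]
    have h5 := (partialInv_eq_some hk (a := (τ, readAns G cd r.fst))).2 rfl
    simp only at h5
    rw [h5]
    rfl

/-- The value of the table at `q` comes from the run for the first occurrence of `q` in `L`, and a
run that answers with the code of `b` sets it to `b`. The inequality may be strict, because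
malformed answers are read as a default value. -/
theorem Pr_extract_ne_le (A : PPT) (k m : Data) (q : Q) (b : G.A) {L : List Q} (hq : q ∈ L) :
    Pr (extract G cd A k m L) (fun τ => τ q ≠ b) ≤
      Pr (A.run (Data.node m.snd.snd (Data.node (cd.que q) k))) fun r => cd.ans b ≠ r.fst := by
  induction L with
  | nil => simp at hq
  | cons q' L ih =>
    rw [extract]
    by_cases h : q = q'
    · subst h
      rw [Pr_bind]
      classical
      rw [Pr_eq_expect (A.run _)]
      refine expect_mono (isUnit01_Pr _ _).isBdd (isUnit01_ite _).isBdd fun r _ => ?_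
      rw [Pr_map]
      simp only [Function.update_self]
      split_ifs with hr
      · exact Pr_le_one _ _
      · rw [not_not] at hr
        rw [Pr_false]
        intro _ _
        rw [← hr, readAns_ans, not_not]
    · refine Pr_bind_le fun r _ => ?_
      rw [Pr_map]
      simp only [Function.update_of_ne h]
      exact ih (by simpa [h] using hq)

/-- If the extracted truth table violates the predicate, then some question of the context is
answered wrongly. -/
theorem sum_Pr_accepts_le (A : PPT) (k m sk t₃ : Data) (C : G.contexts) :
    ∑ q ∈ C.1, Pr (A.run (Data.node m.snd.snd (Data.node (cd.que q) k)))
        (fun r => Accepts G E cd C q sk t₃ r.fst) ≤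
      C.1.card - Pr (extract G cd A k m Finset.univ.toList) fun τ =>
        G.pred C.1 (G.restrict τ C.1) = false := by
  -- Whether the ciphertext decrypts to a satisfying vector does not depend on the question. If it
  -- does not, nothing is accepted, and the bound is nonnegative since contexts are nonempty.
  by_cases h : ∃ a : C.1 → G.A, ofBits (cd.vec C.1 a) = E.decFun sk t₃ ∧ G.pred C.1 a = true
  · obtain ⟨a, ha, hp⟩ := h
    have h1 : Pr (extract G cd A k m Finset.univ.toList)
        (fun τ => G.pred C.1 (G.restrict τ C.1) = false) ≤
        ∑ q ∈ C.1.attach, Pr (extract G cd A k m Finset.univ.toList) fun τ => τ q ≠ a q := by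
      -- A table that violates the predicate cannot agree with the satisfying vector `a` on all of
      -- `C`; then a union bound over the questions.
      refine le_trans (Pr_mono fun τ _ hτ => ?_) (Pr_exists_le _ _ _)
      by_contra! hne
      have : G.restrict τ C.1 = a := funext fun q => hne q (Finset.mem_attach _ _)
      rw [this, hp] at hτ
      cases hτ
    have h2 : ∀ q ∈ C.1.attach,
        Pr (A.run (Data.node m.snd.snd (Data.node (cd.que q) k)))
          (fun r => Accepts G E cd C q sk t₃ r.fst) ≤
        1 - Pr (extract G cd A k m Finset.univ.toList) fun τ => τ q ≠ a q := by
      intro q _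
      have h3 := Pr_extract_ne_le G cd A k m q.1 (a q) (L := Finset.univ.toList) (by simp)
      rw [Pr_not _ fun r => cd.ans (a q) = Data.fst r] at h3
      have h4 : Pr (A.run (Data.node m.snd.snd (Data.node (cd.que q) k)))
          (fun r => Accepts G E cd C q sk t₃ r.fst) ≤
          Pr (A.run (Data.node m.snd.snd (Data.node (cd.que q) k)))
            fun r => cd.ans (a q) = r.fst := by
        refine Pr_mono fun r _ => ?_
        rintro ⟨a', h5, _, _, h6⟩
        rwa [cd.vec_inj C.1 C.2 (ofBits_injective (h5.trans ha.symm))] at h6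
      linarith
    rw [← Finset.sum_attach]
    refine (Finset.sum_le_sum h2).trans ?_
    rw [Finset.sum_sub_distrib]
    simp only [Finset.sum_const, Finset.card_attach, nsmul_eq_mul, mul_one]
    linarith
  · have h0 : ∀ q ∈ C.1, Pr (A.run (Data.node m.snd.snd (Data.node (cd.que q) k)))
        (fun r => Accepts G E cd C q sk t₃ r.fst) = 0 := fun q _ =>
      Pr_false _ fun r _ ⟨a, h1, h2, _⟩ => h ⟨a, h1, h2⟩
    rw [Finset.sum_eq_zero h0]
    have h1 : (1 : ℝ) ≤ C.1.card := by exact_mod_cast (G.context_nonempty C.1 C.2).card_pos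
    have := Pr_le_one (extract G cd A k m Finset.univ.toList) fun τ =>
      G.pred C.1 (G.restrict τ C.1) = false
    linarith

/-- The secret key and the first message of a prover with seed `d`, for an encryption of `C`. -/
def firstView (A : PPT) (d : Data) (C : Finset Q) (l pk : Data) : PMF (Data × Data) :=
  (E.gen.run l).bind fun sk => (E.encBits sk (cd.ctx C)).bind fun c =>
    (A.run (Data.node d (Data.node l (Data.node c pk)))).map fun m => (sk, m)

/-- The probability that a prover with seed `d` answers the question `q` in the context `C`
correctly, if it gets the key `key`. -/
def answerProb (A₁ A₂ : PPT) (d : Data) (C : G.contexts) (q : Q)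
    (key : Data → Data × Data → E.K n) (l : ℕ) : ℝ :=
  expect (P.gen.run (Data.unary l)) fun keys =>
    expect (firstView G E cd A₁ d C.1 (Data.unary l) keys.fst) fun x =>
      Pr (A₂.run (Data.node x.2.snd.snd (Data.node (cd.que q) (E.keyCode n (key keys x)))))
        fun r => Accepts G E cd C q x.1 x.2.fst r.fst

/-- The key sent by the verifier. -/
def realKey (keys : Data) (x : Data × Data) : E.K n :=
  P.decFun keys.snd x.2.snd.fst.snd * E.decKeyFun x.1 n x.2.snd.fst.fst

/-- The probability that the truth table extracted from an encryption of `C'` violates the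
predicate in the context `C`. -/
def violation (A₁ A₂ : PPT) (d : Data) (k : E.K n) (C' C : Finset Q) (l : ℕ) : ℝ :=
  expect (P.gen.run (Data.unary l)) fun keys =>
    expect (firstView G E cd A₁ d C' (Data.unary l) keys.fst) fun x =>
      Pr (extract G cd A₂ (E.keyCode n k) x.2 Finset.univ.toList) fun τ =>
        G.pred C (G.restrict τ C) = false

theorem sum_answerProb_le (A₁ A₂ : PPT) (d : Data) (C : G.contexts) (k : E.K n) (l : ℕ) :
    ∑ q ∈ C.1, answerProb G E P cd A₁ A₂ d C q (fun _ _ => k) l ≤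
      C.1.card - violation G E P cd A₁ A₂ d k C.1 C.1 l := by
  simp only [answerProb, violation]
  rw [← expect_sum _ _ fun q _ => (isUnit01_expect fun _ => isUnit01_Pr _ _).isBdd,
    ← expect_const (P.gen.run (Data.unary l)) (C.1.card : ℝ),
    ← expect_sub _ (isBdd_const _) (isUnit01_expect fun _ => isUnit01_Pr _ _).isBdd]
  refine expect_mono (IsBdd.sum _ fun q _ => (isUnit01_expect fun _ => isUnit01_Pr _ _).isBdd)
    ((isBdd_const _).sub (isUnit01_expect fun _ => isUnit01_Pr _ _).isBdd) fun keys _ => ?_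
  rw [← expect_sum _ _ fun q _ => (isUnit01_Pr _ _).isBdd,
    ← expect_const (firstView G E cd A₁ d C.1 (Data.unary l) keys.fst) (C.1.card : ℝ),
    ← expect_sub _ (isBdd_const _) (isUnit01_Pr _ _).isBdd]
  refine expect_mono (IsBdd.sum _ fun q _ => (isUnit01_Pr _ _).isBdd)
    ((isBdd_const _).sub (isUnit01_Pr _ _).isBdd) fun x _ => ?_
  exact sum_Pr_accepts_le G E cd A₂ _ _ _ _ C

/-- Every single extracted table violates the predicate somewhere, whichever context `C'` was
encrypted; the union bound over the contexts gives the sum. -/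
theorem one_le_sum_violation (hG : G.valNC < 1) (A₁ A₂ : PPT) (d : Data) (k : E.K n)
    (C' : Finset Q) (l : ℕ) :
    1 ≤ ∑ C : G.contexts, violation G E P cd A₁ A₂ d k C' C.1 l := by
  simp only [violation]
  rw [← expect_sum _ _ fun q _ => (isUnit01_expect fun _ => isUnit01_Pr _ _).isBdd]
  refine le_expect (IsBdd.sum _ fun q _ => (isUnit01_expect fun _ => isUnit01_Pr _ _).isBdd)
    fun keys _ => ?_
  rw [← expect_sum _ _ fun q _ => (isUnit01_Pr _ _).isBdd]
  refine le_expect (IsBdd.sum _ fun q _ => (isUnit01_Pr _ _).isBdd) fun x _ => ?_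
  refine le_trans ?_ (Pr_exists_le _ _ _)
  classical
  rw [Pr_eq_expect]
  refine le_expect (isUnit01_ite _).isBdd fun τ _ => ?_
  obtain ⟨C, hC⟩ := G.exists_context_not_pred hG τ
  rw [if_pos ⟨C, Finset.mem_univ C, hC⟩]

end Soundness

theorem expect_comm_unit {α β : Type*} (p : PMF α) (q : PMF β) {f : α → β → ℝ}
    (hf : ∀ a, IsUnit01 (f a)) :
    expect p (fun a => expect q (f a)) = expect q fun b => expect p fun a => f a b :=
  expect_comm p q (IsUnit01.isBdd fun x => hf x.1 x.2)

theorem ofBits_cast {m n : ℕ} (h : m = n) (x : Bits n) :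
    ofBits (fun i : Fin m => x (Fin.cast h i)) = ofBits x := by
  subst h
  rfl

section Soundness

variable (G : Game Q) (E : QFHE) {n : ℕ} (P : OPad n (E.K n) (E.keyCode n)) (cd : Coding G)

open scoped Classical in
theorem computable_truthTable (R : (Q → G.A) → Prop) : ∃ f : Data → Data, Computable f ∧
    ∀ τ, f (tableCode G τ) = Data.bit (decide (R τ)) := by
  refine ⟨_, Computable.table (tableCode_injective G) (fun τ => Data.bit (decide (R τ))) Data.nil,
    fun τ => ?_⟩
  rw [(partialInv_eq_some (tableCode_injective G)).2 rfl, Option.elim_some]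

/-- The extracted truth tables depend only negligibly on the encrypted context. -/
theorem violation_close (hE : E.Secure) (A₁ A₂ : PPT) (d : Data) (k : E.K n) (C₀ C' C : Finset Q) :
    ∃ ε, Negligible ε ∧ ∀ l, |violation G E P cd A₁ A₂ d k C₀ C l -
      violation G E P cd A₁ A₂ d k C' C l| ≤ ε l := by
  classical
  obtain ⟨f, hf, hfτ⟩ := computable_truthTable G fun τ => G.pred C (G.restrict τ C) = false
  -- The distinguisher makes its own pad keys, runs the first stage of the prover on the challenge
  -- ciphertext, extracts a table and reports whether it violates the predicate in `C`. It needs no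
  -- secret key because `k` is a constant.
  have h1 : PolyTime fun x => P.gen.run x.fst := P.gen.polyTime.comp Computable.id.fst
  have h2 : PolyTime fun x => A₁.run
      (Data.node d (Data.node x.fst.fst (Data.node x.fst.snd x.snd.fst))) :=
    A₁.polyTime.comp ((Computable.const d).node
      (Computable.id.fst.fst.node (Computable.id.fst.snd.node Computable.id.snd.fst)))
  have h3 := ((polyTime_extract G cd A₂ (E.keyCode n k) Finset.univ.toList).comp
    Computable.id.snd).map hf
  obtain ⟨B, hB⟩ := (h1.bind (h2.bind h3)).exists_ppt
  -- Codes of contexts have a fixed length, hence the constant polynomial; the casts below only undo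
  -- its evaluation.
  obtain ⟨ε, hε, h⟩ := hE B (Polynomial.C cd.ctxLen)
  have hlen : ∀ l, (Polynomial.C cd.ctxLen).eval l = cd.ctxLen := fun l => Polynomial.eval_C
  refine ⟨ε, hε, fun l => ?_⟩
  have key : ∀ C', violation G E P cd A₁ A₂ d k C' C l =
      Pr ((E.gen.run (Data.unary l)).bind fun sk =>
        (E.encBits sk fun i => cd.ctx C' (Fin.cast (hlen l) i)).bind fun c =>
          B.run (Data.node (Data.unary l) c)) (· = Data.bit true) := by
    intro C'
    have hu : ∀ m, IsUnit01 fun _ : Data => Pr (extract G cd A₂ (E.keyCode n k) m Finset.univ.toList)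
        fun τ => G.pred C (G.restrict τ C) = false := fun m _ => ⟨Pr_nonneg _ _, Pr_le_one _ _⟩
    have hu2 : IsUnit01 fun x : Data × Data => Pr (extract G cd A₂ (E.keyCode n k) x.2
        Finset.univ.toList) fun τ => G.pred C (G.restrict τ C) = false := isUnit01_Pr _ _
    simp only [violation, firstView, hB, Pr_bind, expect_bind _ _ hu2.isBdd,
      expect_map _ _ hu2.isBdd, QFHE.encBits, ofBits_cast, Data.fst_node, Data.snd_node, Pr_map, hfτ]
    rw [expect_comm_unit]
    · refine expect_congr fun sk _ => ?_
      rw [expect_comm_unit]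
      · refine expect_congr fun c _ => expect_congr fun keys _ => expect_congr fun m _ =>
          Pr_congr fun τ _ => ?_
        by_cases h : G.pred C (G.restrict τ C) = false <;> simp [h, Data.bit]
      · exact fun keys => isUnit01_expect fun c => isUnit01_Pr _ _
    · exact fun keys => isUnit01_expect fun c => isUnit01_expect fun _ => isUnit01_Pr _ _
  rw [key, key]
  exact h l _ _

/-- Once the answers are decrypted, acceptance is a condition on two strings which only finitely
many pairs satisfy, so the verdict is a finite table. -/
theorem computable_accepts (C : G.contexts) (q : Q) : ∃ f : Data → Data, Computable f ∧
    ∀ c t, (f (Data.node c t) = Data.bit true ∨ f (Data.node c t) = Data.bit false) ∧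
      (f (Data.node c t) = Data.bit true ↔ ∃ a : C.1 → G.A, ofBits (cd.vec C.1 a) = c ∧
        G.pred C.1 a = true ∧ ∃ h : q ∈ C.1, cd.ans (a ⟨q, h⟩) = t) := by
  let ι := {a : C.1 → G.A // G.pred C.1 a = true ∧ q ∈ C.1}
  let key : ι → Data := fun a => Data.node (ofBits (cd.vec C.1 a.1)) (cd.ans (a.1 ⟨q, a.2.2⟩))
  have hk : Function.Injective key := fun a b h => by
    simp only [key, Data.node.injEq] at h
    exact Subtype.ext (cd.vec_inj C.1 C.2 (ofBits_injective h.1))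
  refine ⟨_, Computable.table hk (fun _ => Data.bit true) (Data.bit false), fun c t => ?_⟩
  cases h : Function.partialInv key (Data.node c t) with
  | none =>
    refine ⟨Or.inr rfl, fun h' => by simp [Data.bit] at h', ?_⟩
    rintro ⟨a, h1, h2, h3, h4⟩
    have := (partialInv_eq_some hk (a := ⟨a, h2, h3⟩)).2 (show _ = Data.node c t by
      simp only [key, h1, h4])
    rw [h] at this
    cases this
  | some a =>
    rw [partialInv_eq_some hk] at h
    simp only [key, Data.node.injEq] at h
    exact ⟨Or.inl rfl, fun _ => ⟨a.1, h.1, a.2.1, a.2.2, h.2⟩, fun _ => rfl⟩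

/-- The number `n` is fixed, so the multiplication table of the finite group `K n` can be
hard-wired. -/
theorem computable_mul : ∃ f : Data → Data, Computable f ∧
    ∀ a b : E.K n, f (Data.node (E.keyCode n a) (E.keyCode n b)) = E.keyCode n (a * b) := by
  have hk : Function.Injective fun p : E.K n × E.K n =>
      Data.node (E.keyCode n p.1) (E.keyCode n p.2) := fun p p' h => by
    simp only [Data.node.injEq] at h
    exact Prod.ext (E.keyCode_inj n h.1) (E.keyCode_inj n h.2)
  refine ⟨_, Computable.table hk (fun p => E.keyCode n (p.1 * p.2)) Data.nil, fun a b => ?_⟩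
  have := (partialInv_eq_some hk (a := (a, b))).2 rfl
  simp only at this
  rw [this, Option.elim_some]

/-- The key sent by the verifier may be replaced by a uniformly random one. -/
theorem answerProb_real_le (hE : E.WellFormed) (hP : P.Sound) (A₁ A₂ : PPT) (d : Data)
    (C : G.contexts) (q : Q) :
    ∃ ε, Negligible ε ∧ ∀ l, answerProb G E P cd A₁ A₂ d C q (realKey E P) l ≤
      (∑ k, answerProb G E P cd A₁ A₂ d C q (fun _ _ => k) l) / Fintype.card (E.K n) + ε l := by
  classical
  -- First stage `B₁` of an adversary against the pad: it encrypts `C` under a secret key of its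
  -- own, runs `A₁` on `c` and the given `pk`, and outputs the string `s'` of the reply. It keeps
  -- the secret key and the whole reply.
  have h1 : PolyTime fun x => E.gen.run x.fst := E.gen.polyTime.comp Computable.id.fst
  have h2 : PolyTime fun x => E.enc.run (Data.node x.snd (ofBits (cd.ctx C.1))) :=
    E.enc.polyTime.comp (Computable.id.snd.node (Computable.const _))
  have h3 : PolyTime fun x => A₁.run
      (Data.node d (Data.node x.fst.fst.fst (Data.node x.snd x.fst.fst.snd))) :=
    A₁.polyTime.comp ((Computable.const d).node
      (Computable.id.fst.fst.fst.node (Computable.id.snd.node Computable.id.fst.fst.snd)))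
  have h4 : Computable fun x => Data.node x.snd.snd.fst.snd (Data.node x.fst.fst.snd x.snd) :=
    Computable.id.snd.snd.fst.snd.node (Computable.id.fst.fst.snd.node Computable.id.snd)
  obtain ⟨B₁, hB₁⟩ := (h1.bind (h2.bind (h3.bind (PolyTime.pure h4)))).exists_ppt
  obtain ⟨mul, hmul, hmul'⟩ := computable_mul E (n := n)
  obtain ⟨acc, hacc, hacc'⟩ := computable_accepts G cd C q
  -- Second stage `B₂`: it multiplies the element received by the decrypted `k''`, runs `A₂` on `q`
  -- with this key, and guesses that the element was the real one exactly if the verifier would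
  -- accept.
  have h5 : PolyTime fun x => E.decKey.run (Data.node x.fst.fst
      (Data.node (Data.unary n) x.fst.snd.snd.fst.fst)) :=
    E.decKey.polyTime.comp (Computable.id.fst.fst.node
      ((Computable.const _).node Computable.id.fst.snd.snd.fst.fst))
  have h6 : PolyTime fun x => A₂.run (Data.node x.fst.fst.snd.snd.snd
      (Data.node (cd.que q) (mul (Data.node x.fst.snd x.snd)))) :=
    A₂.polyTime.comp (Computable.id.fst.fst.snd.snd.snd.node
      ((Computable.const _).node (hmul.comp (Computable.id.fst.snd.node Computable.id.snd))))
  have h7 : PolyTime fun x => E.dec.run (Data.node x.fst.fst.fst.fst x.fst.fst.fst.snd.fst) :=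
    E.dec.polyTime.comp (Computable.id.fst.fst.fst.fst.node Computable.id.fst.fst.fst.snd.fst)
  have h8 : Computable fun x => acc (Data.node x.snd x.fst.snd.fst) :=
    hacc.comp (Computable.id.snd.node Computable.id.fst.snd.fst)
  obtain ⟨B₂, hB₂⟩ := (h5.bind (h6.bind (h7.bind (PolyTime.pure h8)))).exists_ppt
  obtain ⟨ε, hε, h⟩ := hP B₁ B₂
  -- The guess is right with probability `1/2 + (real - random)/2`, whence the factor 2.
  refine ⟨_, hε.const_mul 2, fun l => ?_⟩
  have r1 : ∀ pk, B₁.run (Data.node (Data.unary l) pk) =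
      (firstView G E cd A₁ d C.1 (Data.unary l) pk).map fun x =>
        Data.node x.2.snd.fst.snd (Data.node x.1 x.2) := by
    intro pk
    simp only [hB₁, firstView, PMF.map_bind, PMF.map_comp, Data.fst_node, Data.snd_node]
    rfl
  have r2 : ∀ sk m k, B₂.run (Data.node (Data.node sk m) (E.keyCode n k)) =
      (A₂.run (Data.node m.snd.snd (Data.node (cd.que q)
        (E.keyCode n (k * E.decKeyFun sk n m.snd.fst.fst))))).map fun r =>
          acc (Data.node (E.decFun sk m.fst) r.fst) := by
    intro sk m k
    simp only [hB₂, Data.fst_node, Data.snd_node, hE.decKey_eq, PMF.pure_bind, hmul',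
      hE.dec_eq _]
    rfl
  set g : Data → Data × Data → E.K n → ℝ := fun keys x k =>
    Pr (A₂.run (Data.node x.2.snd.snd (Data.node (cd.que q) (E.keyCode n k))))
        fun r => Accepts G E cd C q x.1 x.2.fst r.fst with hg
  have hu : ∀ keys (k : Data × Data → E.K n), IsUnit01 fun x => g keys x (k x) := fun keys k =>
    isUnit01_Pr _ _
  have r3 : ∀ sk m k, Pr (B₂.run (Data.node (Data.node sk m) (E.keyCode n k)))
      (· = Data.bit true) = g Data.nil (sk, m) (k * E.decKeyFun sk n m.snd.fst.fst) := by
    intro sk m k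
    rw [r2, Pr_map]
    exact Pr_congr fun r _ => (hacc' _ _).2
  have r4 : ∀ sk m k, Pr (B₂.run (Data.node (Data.node sk m) (E.keyCode n k)))
      (· = Data.bit false) = 1 - g Data.nil (sk, m) (k * E.decKeyFun sk n m.snd.fst.fst) := by
    intro sk m k
    rw [← r3, ← Pr_not]
    rw [r2, Pr_map, Pr_map]
    refine Pr_congr fun r _ => ?_
    obtain hx | hx := (hacc' (E.decFun sk m.fst) r.fst).1 <;> simp [hx, Data.bit]
  have r5 : Pr (P.game B₁ B₂ l) (· = true) = expect (P.gen.run (Data.unary l)) fun keys =>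
      expect (firstView G E cd A₁ d C.1 (Data.unary l) keys.fst) fun x =>
        1 / 2 + 1 / 2 * (g keys x (realKey E P keys x) -
          (∑ k, g keys x k) / Fintype.card (E.K n)) := by
    rw [OPad.game, Pr_bind]
    refine expect_congr fun keys _ => ?_
    rw [r1, PMF.bind_map, Pr_bind]
    refine expect_congr fun x _ => ?_
    simp only [Function.comp_apply, Data.fst_node, Data.snd_node, Pr_bind,
      expect_uniformOfFintype, Fintype.sum_bool, Pr_map, decide_eq_true_iff, Fintype.card_bool,
      if_true, Bool.false_eq_true, if_false, r3, r4]
    -- Right translation by `k''` permutes the group, so a uniformly random `k'` makes the product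
    -- `k'k''` uniform.
    have e1 : ∑ k, g Data.nil (x.1, x.2) (k * E.decKeyFun x.1 n x.2.snd.fst.fst) =
        ∑ k, g Data.nil (x.1, x.2) k :=
      Equiv.sum_comp (Equiv.mulRight (E.decKeyFun x.1 n x.2.snd.fst.fst))
        (fun k => g Data.nil (x.1, x.2) k)
    have hc : (Fintype.card (E.K n) : ℝ) ≠ 0 := by exact_mod_cast Fintype.card_ne_zero
    rw [Finset.sum_sub_distrib, e1]
    simp only [Finset.sum_const, Finset.card_univ, nsmul_eq_mul, mul_one, realKey, hg]
    field_simp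
    push_cast
    ring
  have h9 := h l
  rw [r5] at h9
  have hs : ∀ keys, IsBdd fun x : Data × Data => (∑ k, g keys x k) / Fintype.card (E.K n) :=
    fun keys => by
      simpa only [div_eq_inv_mul] using
        (IsBdd.sum Finset.univ fun k _ => (hu keys fun _ => k).isBdd).const_mul _
  have e2 : ∀ keys, expect (firstView G E cd A₁ d C.1 (Data.unary l) keys.fst) (fun x =>
        1 / 2 + 1 / 2 * (g keys x (realKey E P keys x) -
          (∑ k, g keys x k) / Fintype.card (E.K n))) =
      1 / 2 + 1 / 2 * (expect (firstView G E cd A₁ d C.1 (Data.unary l) keys.fst)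
        (fun x => g keys x (realKey E P keys x)) -
        (∑ k, expect (firstView G E cd A₁ d C.1 (Data.unary l) keys.fst) (fun x => g keys x k)) /
          Fintype.card (E.K n)) := by
    intro keys
    rw [expect_add _ (isBdd_const _) (((hu keys _).isBdd.sub (hs keys)).const_mul _), expect_const,
      expect_const_mul, expect_sub _ (hu keys _).isBdd (hs keys)]
    congr 3
    simp only [div_eq_inv_mul]
    rw [expect_const_mul, expect_sum _ _ fun k _ => (hu keys fun _ => k).isBdd]
  simp only [e2] at h9
  have hu1 : IsUnit01 fun keys => expect (firstView G E cd A₁ d C.1 (Data.unary l) (Data.fst keys))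
        (fun x => g keys x (realKey E P keys x)) := isUnit01_expect fun keys => hu keys _
  have hu2 : ∀ k, IsUnit01 fun keys => expect (firstView G E cd A₁ d C.1 (Data.unary l)
      (Data.fst keys)) (fun x => g keys x k) := fun k => isUnit01_expect fun keys => hu keys _
  have hs2 := (IsBdd.sum Finset.univ fun k _ => (hu2 k).isBdd).const_mul
    (Fintype.card (E.K n) : ℝ)⁻¹
  simp only [div_eq_inv_mul _ (Fintype.card (E.K n) : ℝ)] at h9 ⊢
  rw [expect_add _ (isBdd_const _) ((hu1.isBdd.sub hs2).const_mul _), expect_const,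
    expect_const_mul, expect_sub _ hu1.isBdd hs2, expect_const_mul,
    expect_sum _ _ fun k _ => (hu2 k).isBdd] at h9
  simp only [answerProb]
  simp only [hg] at h9
  linarith

end Soundness

/-- Each two successive draws are bundled into one draw of a pair; this leaves a single exchange of
independent draws. -/
theorem expect_comm₂ {α β γ δ : Type*} (p : PMF α) (q : α → PMF β) (r : PMF γ) (s : PMF δ)
    {f : α → β → γ → δ → ℝ} (hf : ∀ a b c, IsUnit01 (f a b c)) :
    expect p (fun a => expect (q a) fun b => expect r fun c => expect s (f a b c)) =
      expect r fun c => expect s fun d => expect p fun a => expect (q a) fun b => f a b c d := by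
  have h := expect_comm_unit (p.bind fun a => (q a).map fun b => (a, b))
    (r.bind fun c => s.map fun d => (c, d)) (f := fun x y => f x.1 x.2 y.1 y.2)
    fun x y => hf _ _ _ _
  have h1 : ∀ x : α × β, IsUnit01 fun y : γ × δ => f x.1 x.2 y.1 y.2 := fun x y => hf _ _ _ _
  have h2 : ∀ y : γ × δ, IsUnit01 fun x : α × β => f x.1 x.2 y.1 y.2 := fun x y => hf _ _ _ _
  have k1 : IsBdd fun x : α × β => expect (r.bind fun c => s.map fun d => (c, d))
      fun y => f x.1 x.2 y.1 y.2 := (isUnit01_expect h1).isBdd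
  have k2 : IsBdd fun y : γ × δ => expect (p.bind fun a => (q a).map fun b => (a, b))
      fun x => f x.1 x.2 y.1 y.2 := (isUnit01_expect h2).isBdd
  rw [expect_bind _ _ k1, expect_bind _ _ k2] at h
  simp only [expect_map _ _ k1, expect_map _ _ k2] at h
  have k3 : ∀ a b, IsBdd fun y : γ × δ => f a b y.1 y.2 := fun a b => (h1 (a, b)).isBdd
  have k4 : ∀ c d, IsBdd fun x : α × β => f x.1 x.2 c d := fun c d => (h2 (c, d)).isBdd
  simpa only [expect_bind _ _ (k3 _ _), expect_map _ _ (k3 _ _), expect_bind _ _ (k4 _ _),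
    expect_map _ _ (k4 _ _)] using h

/-! ### Soundness: averaging over contexts, keys and seeds -/

section Soundness

variable (G : Game Q) (E : QFHE) {n : ℕ} (P : OPad n (E.K n) (E.keyCode n)) (cd : Coding G)

/-- The winning probability of a prover with a fixed seed. -/
def seedValue (A₁ A₂ : PPT) (d : Data) (l : ℕ) : ℝ :=
  ∑ C : G.contexts, (G.D C).toReal *
    ((∑ q ∈ C.1, answerProb G E P cd A₁ A₂ d C q (realKey E P) l) / C.1.card)

/-- Context, seed, pad keys and secret key are drawn independently. The draws can therefore be
reordered so that the context and the seed come first and may be fixed. -/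
theorem winProb_toProver (A : PPTProver) (l : ℕ) :
    (compiled G E P cd).winProb (A.toProver.withInfo _) l =
      expect A.seed fun d => seedValue G E P cd A.A₁ A.A₂ d l := by
  have hu : ∀ C q keys, IsUnit01 fun x : Data × Data => Pr (A.A₂.run (Data.node x.2.snd.snd
      (Data.node (cd.que q) (E.keyCode n (realKey E P keys x)))))
        fun r => Accepts G E cd C q x.1 x.2.fst r.fst := fun _ _ _ => isUnit01_Pr _ _
  have step1 : (compiled G E P cd).winProb (A.toProver.withInfo _) l =
      expect (E.gen.run (Data.unary l)) fun sk => expect G.D fun C =>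
        expect (E.encBits sk (cd.ctx C.1)) fun c => expect (P.gen.run (Data.unary l)) fun keys =>
          expect A.seed fun d => expect (A.A₁.run (Data.node d
              (Data.node (Data.unary l) (Data.node c keys.fst)))) fun m =>
            expect (PMF.uniformOfFinset C.1 (G.context_nonempty _ C.2)) fun q =>
              Pr (A.A₂.run (Data.node m.snd.snd
                (Data.node (cd.que q) (E.keyCode n (realKey E P keys (sk, m))))))
              fun r => Accepts G E cd C q sk m.fst r.fst := by
    simp only [Verifier.winProb, Verifier.transcript, Verifier.exec, compiled, PPTProver.toProver,
      Prover.withInfo, Pr_map, Pr_bind, PMF.bind_bind, PMF.bind_map, PMF.map_bind, PMF.map_comp,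
      Function.comp_def, decide_eq_true_iff]
    rfl
  have step2 : ∀ (C : G.contexts) (d : Data),
      (expect (P.gen.run (Data.unary l)) fun keys =>
        expect (firstView G E cd A.A₁ d C.1 (Data.unary l) keys.fst) fun x =>
          expect (PMF.uniformOfFinset C.1 (G.context_nonempty _ C.2)) fun q =>
            Pr (A.A₂.run (Data.node x.2.snd.snd
              (Data.node (cd.que q) (E.keyCode n (realKey E P keys x)))))
              fun r => Accepts G E cd C q x.1 x.2.fst r.fst) =
        (∑ q ∈ C.1, answerProb G E P cd A.A₁ A.A₂ d C q (realKey E P) l) / C.1.card := by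
    intro C d
    simp only [expect_uniformOfFinset, div_eq_inv_mul, expect_const_mul, answerProb]
    congr 1
    rw [← expect_sum _ _ fun q _ => (isUnit01_expect fun keys => hu C q keys).isBdd]
    refine expect_congr fun keys _ => ?_
    rw [expect_sum _ _ fun q _ => (hu C q keys).isBdd]
  have step3 : expect A.seed (fun d => seedValue G E P cd A.A₁ A.A₂ d l) =
      expect G.D fun C => expect A.seed fun d => expect (P.gen.run (Data.unary l)) fun keys =>
        expect (firstView G E cd A.A₁ d C.1 (Data.unary l) keys.fst) fun x =>
          expect (PMF.uniformOfFinset C.1 (G.context_nonempty _ C.2)) fun q =>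
            Pr (A.A₂.run (Data.node x.2.snd.snd
              (Data.node (cd.que q) (E.keyCode n (realKey E P keys x)))))
              fun r => Accepts G E cd C q x.1 x.2.fst r.fst := by
    rw [expect_comm_unit]
    · refine expect_congr fun d _ => ?_
      rw [seedValue, expect_fintype]
      simp only [step2]
    · exact fun C => isUnit01_expect fun d => isUnit01_expect fun keys =>
        isUnit01_expect fun x => isUnit01_Pr _ _
  rw [step1, step3, expect_comm_unit]
  · refine expect_congr fun C _ => ?_
    have hu2 : ∀ keys, IsUnit01 fun x : Data × Data =>
        expect (PMF.uniformOfFinset C.1 (G.context_nonempty _ C.2)) fun q =>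
            Pr (A.A₂.run (Data.node x.2.snd.snd
              (Data.node (cd.que q) (E.keyCode n (realKey E P keys x)))))
              fun r => Accepts G E cd C q x.1 x.2.fst r.fst := fun keys =>
      isUnit01_expect fun x => isUnit01_Pr _ _
    simp only [firstView, expect_bind _ _ (hu2 _).isBdd, expect_map _ _ (hu2 _).isBdd]
    rw [expect_comm_unit (p := A.seed) (q := P.gen.run (Data.unary l))]
    · rw [expect_comm₂]
      exact fun sk c keys => isUnit01_expect fun d => isUnit01_expect fun m => isUnit01_Pr _ _
    · exact fun d => isUnit01_expect fun keys => isUnit01_expect fun sk => isUnit01_expect fun c =>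
        isUnit01_expect fun m => isUnit01_Pr _ _
  · exact fun sk => isUnit01_expect fun c => isUnit01_expect fun keys => isUnit01_expect fun d =>
      isUnit01_expect fun m => isUnit01_expect fun q => isUnit01_Pr _ _

theorem violation_nonneg (A₁ A₂ : PPT) (d : Data) (k : E.K n) (C' C : Finset Q) (l : ℕ) :
    0 ≤ violation G E P cd A₁ A₂ d k C' C l :=
  le_expect (isUnit01_expect fun _ => isUnit01_Pr _ _).isBdd fun _ _ =>
    le_expect (isUnit01_Pr _ _).isBdd fun _ _ => Pr_nonneg _ _

/-- Let `w C = Pr(C)/|C|` and let `v k C` be the violation in the context `C` when `C` itself is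
encrypted. Up to negligible terms the value is at most the average over `k` of `∑ w C (|C| - v k C)
= 1 - ∑ w C v k C`. Here `w C ≥ const₁`, and `∑ v k C` is at least 1 up to a negligible error. -/
theorem seedValue_le (hG : G.valNC < 1) (hE : E.WellFormed) (hEs : E.Secure) (hP : P.Sound)
    (A₁ A₂ : PPT) (d : Data) : ∃ ε, Negligible ε ∧
      ∀ l, seedValue G E P cd A₁ A₂ d l ≤ 1 - G.const₁ + ε l := by
  classical
  -- An arbitrary reference context: tables extracted from an encryption of `C` are compared with
  -- those from an encryption of `C₀`, where one table serves all contexts.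
  obtain ⟨C₀⟩ := G.nonempty_contexts
  choose ε hε h using fun (C : G.contexts) q => answerProb_real_le G E P cd hE hP A₁ A₂ d C q
  choose δ hδ h' using fun (k : E.K n) (C : G.contexts) =>
    violation_close G E P cd hEs A₁ A₂ d k C.1 C₀.1 C.1
  set N : ℝ := (Fintype.card (E.K n) : ℝ) with hN
  have hN0 : 0 < N := Nat.cast_pos.2 Fintype.card_pos
  refine ⟨fun l => G.const₁ * (N⁻¹ * ∑ k, ∑ C, δ k C l) +
      ∑ C : G.contexts, (G.D C).toReal / C.1.card * ∑ q ∈ C.1, ε C q l,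
    ((Negligible.sum _ fun k _ => Negligible.sum _ fun C _ => hδ k C).const_mul _).const_mul _ |>.add
      (Negligible.sum _ fun C _ => (Negligible.sum _ fun q _ => hε C q).const_mul _), fun l => ?_⟩
  set w : G.contexts → ℝ := fun C => (G.D C).toReal / C.1.card
  have hw : ∀ C, G.const₁ ≤ w C := G.const₁_le
  have hw0 : ∀ C, 0 ≤ w C := fun C => G.const₁_nonneg.trans (hw C)
  have hw1 : ∑ C, w C * (C.1.card : ℝ) = 1 := by
    rw [← sum_weights G.D]
    exact Finset.sum_congr rfl fun C _ => div_mul_cancel₀ _ (G.card_pos C).ne'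
  set v : E.K n → G.contexts → ℝ := fun k C => violation G E P cd A₁ A₂ d k C.1 C.1 l with hv
  have h1 : seedValue G E P cd A₁ A₂ d l ≤
      ∑ C, w C * (N⁻¹ * ∑ k, (C.1.card - v k C) + ∑ q ∈ C.1, ε C q l) := by
    refine Finset.sum_le_sum fun C _ => ?_
    rw [mul_div_assoc', mul_div_right_comm]
    refine mul_le_mul_of_nonneg_left ?_ (hw0 C)
    refine (Finset.sum_le_sum fun q _ => h C q l).trans ?_
    rw [Finset.sum_add_distrib, ← Finset.sum_div, Finset.sum_comm, div_eq_inv_mul]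
    gcongr with k
    exact sum_answerProb_le G E P cd A₁ A₂ d C k l
  have h2 : ∀ k, 1 ≤ ∑ C, (v k C + δ k C l) := by
    intro k
    refine (one_le_sum_violation G E P cd hG A₁ A₂ d k C₀.1 l).trans
      (Finset.sum_le_sum fun C _ => ?_)
    have := (abs_le.1 (h' k C l)).1
    linarith
  have h3 : ∀ k, ∑ C, w C * v k C ≥ G.const₁ * (1 - ∑ C, δ k C l) := by
    intro k
    have h4 : G.const₁ * ∑ C, v k C ≤ ∑ C, w C * v k C := by
      rw [Finset.mul_sum]
      refine Finset.sum_le_sum fun C _ => mul_le_mul_of_nonneg_right (hw C) ?_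
      exact violation_nonneg G E P cd A₁ A₂ d k C.1 C.1 l
    have h5 := h2 k
    rw [Finset.sum_add_distrib] at h5
    exact (mul_le_mul_of_nonneg_left (by linarith) G.const₁_nonneg).trans h4
  have h6 : ∑ C, w C * (N⁻¹ * ∑ k, (C.1.card - v k C) + ∑ q ∈ C.1, ε C q l) =
      N⁻¹ * ∑ k, (1 - ∑ C, w C * v k C) + ∑ C, w C * ∑ q ∈ C.1, ε C q l := by
    simp only [mul_add, Finset.sum_add_distrib]
    congr 1
    simp only [← hw1, ← Finset.sum_sub_distrib, ← mul_sub]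
    rw [Finset.sum_comm, Finset.mul_sum]
    refine Finset.sum_congr rfl fun C _ => ?_
    rw [← Finset.mul_sum]
    ring
  have h7 : N⁻¹ * ∑ k, (1 - ∑ C, w C * v k C) ≤
      N⁻¹ * ∑ k, (1 - G.const₁ * (1 - ∑ C, δ k C l)) := by
    gcongr with k
    exact h3 k
  have h8 : N⁻¹ * ∑ k : E.K n, (1 - G.const₁ * (1 - ∑ C, δ k C l)) =
      1 - G.const₁ + G.const₁ * (N⁻¹ * ∑ k, ∑ C, δ k C l) := by
    have : ∀ k : E.K n, 1 - G.const₁ * (1 - ∑ C, δ k C l) =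
        (1 - G.const₁) + G.const₁ * ∑ C, δ k C l := fun k => by ring
    simp only [this, Finset.sum_add_distrib, Finset.sum_const, Finset.card_univ, nsmul_eq_mul,
      ← Finset.mul_sum, ← hN]
    field_simp
  linarith

/-- No probabilistic polynomial-time prover wins with probability noticeably larger than
`1 - const₁`. -/
theorem winProb_toProver_le (hG : G.valNC < 1) (hE : E.WellFormed) (hEs : E.Secure)
    (hP : P.Sound) (A : PPTProver) : ∃ ε, Negligible ε ∧ ∀ l : ℕ,
      (compiled G E P cd).winProb (A.toProver.withInfo _) l ≤ 1 - G.const₁ + ε l := by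
  choose ε hε h using seedValue_le G E P cd hG hE hEs hP A.A₁ A.A₂
  refine ⟨fun l => ∑ d ∈ A.seed_finite.toFinset, (A.seed d).toReal * ε d l,
    Negligible.sum _ fun d _ => (hε d).const_mul _, fun l => ?_⟩
  rw [winProb_toProver, expect_finite_support _ A.seed_finite]
  have h1 := sum_weights_support _ A.seed_finite
  calc _ ≤ ∑ d ∈ A.seed_finite.toFinset, ((A.seed d).toReal * (1 - G.const₁) +
        (A.seed d).toReal * ε d l) := Finset.sum_le_sum fun d _ => by
          rw [← mul_add]
          exact mul_le_mul_of_nonneg_left (h d l) ENNReal.toReal_nonneg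
    _ = _ := by rw [Finset.sum_add_distrib, ← Finset.sum_mul, h1, one_mul]

end Soundness

/-! ### Joint measurements -/

namespace QStrat

variable {G : Game Q} {H : Type} [NormedAddCommGroup H] [InnerProductSpace ℂ H]
  [CompleteSpace H] (S : QStrat G H)

theorem mem_eigen {R : Finset Q} {a : R → G.A} {v : H} :
    v ∈ S.eigen R a ↔ ∀ q : R, S.O q v = ((a q : ℝ) : ℂ) • v := by
  simp [eigen, funext_iff, sub_eq_zero]

theorem proj_mem (R : Finset Q) (a : R → G.A) (v : H) : S.proj R a v ∈ S.eigen R a :=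
  Submodule.starProjection_apply_mem _ _

theorem proj_eq_self {R : Finset Q} {a : R → G.A} {v : H} (hv : v ∈ S.eigen R a) :
    S.proj R a v = v := Submodule.starProjection_eq_self_iff.2 hv

theorem inner_eigen_eq_zero {R R' : Finset Q} {a : R → G.A} {b : R' → G.A} {q : Q} (hq : q ∈ R)
    (hq' : q ∈ R') (hab : a ⟨q, hq⟩ ≠ b ⟨q, hq'⟩) {u v : H} (hu : u ∈ S.eigen R a)
    (hv : v ∈ S.eigen R' b) : inner ℂ u v = 0 := by
  have h1 := (S.mem_eigen.1 hu) ⟨q, hq⟩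
  have h2 := (S.mem_eigen.1 hv) ⟨q, hq'⟩
  have h3 := (S.selfAdjoint q).isSymmetric u v
  simp only [ContinuousLinearMap.coe_coe] at h3
  rw [h1, h2, inner_smul_left, inner_smul_right, Complex.conj_ofReal] at h3
  have h4 : (((a ⟨q, hq⟩ : ℝ) : ℂ) - ((b ⟨q, hq'⟩ : ℝ) : ℂ)) * inner ℂ u v = 0 := by
    rw [sub_mul, h3, sub_self]
  refine (mul_eq_zero.1 h4).resolve_left fun h => hab (Subtype.ext ?_)
  exact_mod_cast sub_eq_zero.1 h

theorem proj_eq_zero {R R' : Finset Q} {a : R → G.A} {b : R' → G.A} {q : Q} (hq : q ∈ R)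
    (hq' : q ∈ R') (hab : a ⟨q, hq⟩ ≠ b ⟨q, hq'⟩) {v : H} (hv : v ∈ S.eigen R' b) :
    S.proj R a v = 0 := by
  rw [proj, Submodule.starProjection_apply_eq_zero_iff, Submodule.mem_orthogonal]
  exact fun u hu => S.inner_eigen_eq_zero hq hq' hab hu hv

theorem eigen_mono {R R' : Finset Q} (h : R ⊆ R') (b : R' → G.A) :
    S.eigen R' b ≤ S.eigen R fun q => b ⟨q, h q.2⟩ := fun v hv => by
  rw [mem_eigen] at hv ⊢
  exact fun q => hv ⟨q, h q.2⟩

theorem orthogonalFamily_eigen (R : Finset Q) :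
    OrthogonalFamily ℂ (fun a => S.eigen R a) fun a => (S.eigen R a).subtypeₗᵢ := by
  intro a b hab u v
  obtain ⟨q, hq⟩ := Function.ne_iff.1 hab
  exact S.inner_eigen_eq_zero q.2 q.2 hq u.2 v.2

/-- The observables in `R` can be measured jointly. -/
def Compatible (R : Finset Q) : Prop := ∀ q ∈ R, ∀ q' ∈ R, Commute (S.O q) (S.O q')

theorem compatible_singleton (q : Q) : S.Compatible {q} := by
  intro p hp p' hp'
  rw [Finset.mem_singleton] at hp hp'
  rw [hp, hp']

/-- Commuting self-adjoint operators in finite dimension have joint eigenspaces that span. A nonzero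
joint eigenvector has its eigenvalues in the spectra, hence in `A`, so the eigenspaces labelled by
answers are enough. -/
theorem sum_proj [FiniteDimensional ℂ H] {R : Finset Q} (hR : S.Compatible R) (v : H) :
    ∑ a, S.proj R a v = v := by
  refine (S.orthogonalFamily_eigen R).sum_projection_of_mem_iSup v ?_
  have h := LinearMap.IsSymmetric.iSup_iInf_eq_top_of_commute
    (T := fun q : R => ((S.O q : H →L[ℂ] H) : H →ₗ[ℂ] H))
    (fun q => (S.selfAdjoint q).isSymmetric) (fun q q' _ => by
      have := hR q q.2 q' q'.2
      exact LinearMap.ext fun x => congrArg (fun T : H →L[ℂ] H => T x) this.eq)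
  have hle : (⨆ χ : R → ℂ, ⨅ q : R, Module.End.eigenspace ((S.O q : H →L[ℂ] H) : H →ₗ[ℂ] H) (χ q)) ≤
      ⨆ a, S.eigen R a := by
    refine iSup_le fun χ u hu => ?_
    rw [Submodule.mem_iInf] at hu
    by_cases hu0 : u = 0
    · rw [hu0]; exact Submodule.zero_mem _
    have hχ : ∀ q : R, ∃ a : G.A, ((a : ℝ) : ℂ) = χ q := by
      intro q
      have h1 : χ q ∈ spectrum ℂ (S.O q) := by
        rw [spectrum.mem_iff]
        intro hunit
        obtain ⟨w, hw⟩ := hunit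
        have h2 : (w : H →L[ℂ] H) u = 0 := by
          rw [hw]
          have := Module.End.mem_eigenspace_iff.1 (hu q)
          simp only [ContinuousLinearMap.coe_coe] at this
          simp [Algebra.algebraMap_eq_smul_one, this]
        have h3 : ((w⁻¹ : (H →L[ℂ] H)ˣ) : H →L[ℂ] H) ((w : H →L[ℂ] H) u) = u := by
          rw [← mul_apply_eq_comp, Units.inv_mul]
          rfl
        rw [h2, map_zero] at h3
        exact hu0 h3.symm
      obtain ⟨r, hr, hrχ⟩ := S.spectrum_subset q h1
      exact ⟨⟨r, hr⟩, hrχ⟩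
    choose a ha using hχ
    refine Submodule.mem_iSup_of_mem a (S.mem_eigen.2 fun q => ?_)
    rw [ha q]
    exact Module.End.mem_eigenspace_iff.1 (hu q)
  exact hle (h ▸ Submodule.mem_top)

theorem inner_proj_proj (R : Finset Q) (a : R → G.A) (u v : H) :
    inner ℂ (S.proj R a u) (S.proj R a v) = inner ℂ u (S.proj R a v) := by
  rw [proj, Submodule.inner_starProjection_left_eq_right,
    Submodule.starProjection_eq_self_iff.2 (Submodule.starProjection_apply_mem _ _)]

theorem norm_proj_sq (R : Finset Q) (a : R → G.A) (u : H) :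
    ((‖S.proj R a u‖ ^ 2 : ℝ) : ℂ) = inner ℂ u (S.proj R a u) := by
  rw [← inner_proj_proj, inner_self_eq_norm_sq_to_K]
  simp

theorem sum_norm_proj_sq [FiniteDimensional ℂ H] {R : Finset Q} (hR : S.Compatible R) (v : H) :
    ∑ a, ‖S.proj R a v‖ ^ 2 = ‖v‖ ^ 2 := by
  have : ((∑ a, ‖S.proj R a v‖ ^ 2 : ℝ) : ℂ) = ((‖v‖ ^ 2 : ℝ) : ℂ) := by
    rw [Complex.ofReal_sum]
    simp only [norm_proj_sq]
    rw [← inner_sum, S.sum_proj hR, inner_self_eq_norm_sq_to_K]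
    simp
  exact_mod_cast this

theorem expect_outcome [FiniteDimensional ℂ H] {R : Finset Q} (hR : S.Compatible R) {u : H}
    (hu : u ≠ 0) (f : (R → G.A) → ℝ) :
    expect (S.outcome u R) f = (∑ a, ‖S.proj R a u‖ ^ 2 * f a) / ‖u‖ ^ 2 := by
  have h := S.sum_norm_proj_sq hR u
  rw [outcome, expect_sampleBy_fintype (fun _ => by positivity), h]
  rw [h]
  positivity

theorem mem_support_outcome [FiniteDimensional ℂ H] {R : Finset Q} (hR : S.Compatible R) {u : H}
    (hu : u ≠ 0) {a : R → G.A} : a ∈ (S.outcome u R).support ↔ S.proj R a u ≠ 0 := by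
  have h := S.sum_norm_proj_sq hR u
  rw [outcome, mem_support_sampleBy (fun _ => by positivity) (hasSum_fintype _).summable]
  · constructor
    · rintro h1 h2
      simp [h2] at h1
    · intro h1
      have := norm_pos_iff.2 h1
      positivity
  · rw [tsum_fintype, h]
    positivity

theorem outcome_smul {z : ℂ} (hz : ‖z‖ = 1) (u : H) (R : Finset Q) :
    S.outcome (z • u) R = S.outcome u R := by
  simp [outcome, norm_smul, hz]

/-- Measuring an observable of `R` on a joint eigenvector. -/
theorem outcome_eigen [FiniteDimensional ℂ H] {R : Finset Q} {a : R → G.A} {u : H} (hu : u ≠ 0)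
    (hua : u ∈ S.eigen R a) {q : Q} (hq : q ∈ R) :
    S.outcome u {q} = PMF.pure fun _ => a ⟨q, hq⟩ := by
  refine ext_of_expect fun f _ => ?_
  have hq1 : q ∈ ({q} : Finset Q) := Finset.mem_singleton_self q
  rw [S.expect_outcome (S.compatible_singleton q) hu, expect_pure,
    Finset.sum_eq_single fun _ => a ⟨q, hq⟩]
  · rw [S.proj_eq_self]
    · have := norm_pos_iff.2 hu
      field_simp
    · rw [mem_eigen]
      rintro ⟨q', hq'⟩
      obtain rfl := Finset.mem_singleton.1 hq'
      exact S.mem_eigen.1 hua ⟨q', hq⟩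
  · intro b _ hb
    rw [S.proj_eq_zero hq1 hq (v := u) (b := a) _ hua]
    · simp
    · intro h
      refine hb (funext ?_)
      rintro ⟨q', hq'⟩
      obtain rfl := Finset.mem_singleton.1 hq'
      exact h
  · simp

theorem ψ_ne_zero : S.ψ ≠ 0 := fun h => by simpa [h] using S.norm_ψ

theorem compatible_context {C : Finset Q} (hC : C ∈ G.contexts) : S.Compatible C := S.commute C hC

/-- The marginals of a joint measurement of compatible observables. -/
theorem outcome_map_restrict [FiniteDimensional ℂ H] {R R' : Finset Q} (h : R ⊆ R')
    (hR' : S.Compatible R') {u : H} (hu : u ≠ 0) :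
    (S.outcome u R').map (fun b (q : R) => b ⟨q, h q.2⟩) = S.outcome u R := by
  classical
  have hR : S.Compatible R := fun q hq q' hq' => hR' q (h hq) q' (h hq')
  refine ext_of_expect fun f hf => ?_
  rw [expect_map _ _ hf.isBdd, S.expect_outcome hR' hu, S.expect_outcome hR hu]
  congr 1
  -- The projection for `a` on `R` is the sum of the projections on `R'` for all extensions of `a`,
  -- and squared norms of projections are linear when written as `⟨u, P u⟩`.
  have key : ∀ a : R → G.A, ‖S.proj R a u‖ ^ 2 =
      ∑ b : R' → G.A, if (fun q : R => b ⟨q, h q.2⟩) = a then ‖S.proj R' b u‖ ^ 2 else 0 := by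
    intro a
    have h1 : S.proj R a u = ∑ b : R' → G.A,
        if (fun q : R => b ⟨q, h q.2⟩) = a then S.proj R' b u else 0 := by
      conv_lhs => rw [← S.sum_proj hR' u, map_sum]
      refine Finset.sum_congr rfl fun b _ => ?_
      split_ifs with hb
      · exact S.proj_eq_self (hb ▸ S.eigen_mono h b (S.proj_mem _ _ _))
      · obtain ⟨q, hq⟩ := Function.ne_iff.1 hb
        exact S.proj_eq_zero q.2 (h q.2) (Ne.symm hq) (S.proj_mem _ _ _)
    have h2 : ((‖S.proj R a u‖ ^ 2 : ℝ) : ℂ) = ((∑ b : R' → G.A,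
        if (fun q : R => b ⟨q, h q.2⟩) = a then ‖S.proj R' b u‖ ^ 2 else 0 : ℝ) : ℂ) := by
      rw [S.norm_proj_sq, h1, inner_sum, Complex.ofReal_sum]
      refine Finset.sum_congr rfl fun b _ => ?_
      split_ifs with hb
      · rw [S.norm_proj_sq]
      · simp
    exact_mod_cast h2
  simp only [key, Finset.sum_mul]
  rw [Finset.sum_comm]
  refine Finset.sum_congr rfl fun b _ => ?_
  simp [ite_mul]

end QStrat

/-! ### Effects -/

/-- The functions `φ ↦ ⟨φ|E|φ⟩ / ⟨φ|φ⟩` for effects `E`. -/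
def IsEffect {n : ℕ} (g : Ket n → ℝ) : Prop :=
  ∃ M : Matrix (Bits n) (Bits n) ℂ, Effect M ∧ ∀ φ, φ ≠ 0 → g φ = effectProb M φ

section Effects

variable {n : ℕ}

theorem sum_sq_pos {φ : Ket n} (h : φ ≠ 0) : 0 < ∑ x, ‖φ x‖ ^ 2 := by
  obtain ⟨x, hx⟩ := Function.ne_iff.1 h
  exact Finset.sum_pos' (fun _ _ => by positivity)
    ⟨x, Finset.mem_univ x, by have := norm_pos_iff.2 hx; positivity⟩

theorem dotProduct_star_self (φ : Ket n) :
    dotProduct (star φ) φ = ((∑ x, ‖φ x‖ ^ 2 : ℝ) : ℂ) := by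
  rw [dotProduct, Complex.ofReal_sum]
  refine Finset.sum_congr rfl fun x _ => ?_
  rw [Pi.star_apply, RCLike.star_def, RCLike.conj_mul]
  simp

theorem effectProb_sum {ι : Type*} (s : Finset ι) (w : ι → ℝ)
    (M : ι → Matrix (Bits n) (Bits n) ℂ) (φ : Ket n) :
    effectProb (∑ i ∈ s, (w i : ℂ) • M i) φ = ∑ i ∈ s, w i * effectProb (M i) φ := by
  simp only [effectProb, mul_div_assoc', ← Finset.sum_div]
  congr 1
  rw [Matrix.sum_mulVec, dotProduct_sum, Complex.re_sum]
  refine Finset.sum_congr rfl fun i _ => ?_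
  rw [Matrix.smul_mulVec, dotProduct_smul, smul_eq_mul, Complex.re_ofReal_mul]

theorem effectProb_one {φ : Ket n} (h : φ ≠ 0) : effectProb 1 φ = 1 := by
  rw [effectProb, Matrix.one_mulVec, dotProduct_star_self, Complex.ofReal_re,
    div_self (sum_sq_pos h).ne']

theorem posSemidef_ofReal_smul {M : Matrix (Bits n) (Bits n) ℂ} (h : M.PosSemidef) {c : ℝ}
    (hc : 0 ≤ c) : ((c : ℂ) • M).PosSemidef := h.smul (by exact_mod_cast hc)

theorem effect_sum {ι : Type*} (s : Finset ι) {w : ι → ℝ} (hw : ∀ i ∈ s, 0 ≤ w i)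
    (hw1 : ∑ i ∈ s, w i = 1) {M : ι → Matrix (Bits n) (Bits n) ℂ} (hM : ∀ i ∈ s, Effect (M i)) :
    Effect (∑ i ∈ s, (w i : ℂ) • M i) := by
  refine ⟨Matrix.posSemidef_sum s fun i hi => posSemidef_ofReal_smul (hM i hi).1 (hw i hi), ?_⟩
  have : 1 - ∑ i ∈ s, (w i : ℂ) • M i = ∑ i ∈ s, (w i : ℂ) • (1 - M i) := by
    simp only [smul_sub, Finset.sum_sub_distrib, ← Finset.sum_smul, ← Complex.ofReal_sum, hw1]
    simp
  rw [this]
  exact Matrix.posSemidef_sum s fun i hi => posSemidef_ofReal_smul (hM i hi).2 (hw i hi)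

theorem IsEffect.sum {ι : Type*} (s : Finset ι) {w : ι → ℝ} (hw : ∀ i ∈ s, 0 ≤ w i)
    (hw1 : ∑ i ∈ s, w i = 1) {g : ι → Ket n → ℝ} (hg : ∀ i ∈ s, IsEffect (g i)) :
    IsEffect fun φ => ∑ i ∈ s, w i * g i φ := by
  choose! M hM h using hg
  exact ⟨_, effect_sum s hw hw1 hM, fun φ hφ => by
    rw [effectProb_sum]
    exact Finset.sum_congr rfl fun i hi => by rw [h i hi φ hφ]⟩

theorem IsEffect.uniform {ι : Type*} (s : Finset ι) (hs : s.Nonempty) {g : ι → Ket n → ℝ}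
    (hg : ∀ i ∈ s, IsEffect (g i)) :
    IsEffect fun φ => expect (PMF.uniformOfFinset s hs) fun i => g i φ := by
  have hc : (s.card : ℝ) ≠ 0 := by exact_mod_cast hs.card_pos.ne'
  have := IsEffect.sum s (w := fun _ => (s.card : ℝ)⁻¹) (fun _ _ => by positivity)
    (by simp [hc]) hg
  simpa only [expect_uniformOfFinset, div_eq_inv_mul, Finset.mul_sum] using this

theorem isEffect_const {c : ℝ} (h0 : 0 ≤ c) (h1 : c ≤ 1) : IsEffect fun _ : Ket n => c := by
  refine ⟨(c : ℂ) • 1, ⟨posSemidef_ofReal_smul Matrix.PosSemidef.one h0, ?_⟩, fun φ hφ => ?_⟩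
  · have : (1 : Matrix (Bits n) (Bits n) ℂ) - (c : ℂ) • 1 = ((1 - c : ℝ) : ℂ) • 1 := by
      rw [Complex.ofReal_sub, sub_smul, Complex.ofReal_one, one_smul]
    rw [this]
    exact posSemidef_ofReal_smul Matrix.PosSemidef.one (by linarith)
  · have := effectProb_sum {()} (fun _ => c) (fun _ => 1) φ
    simp only [Finset.sum_singleton] at this
    rw [this, effectProb_one hφ, mul_one]

/-- The Heisenberg picture: the unitary is moved from the state to the effect. The numerator
identity with the identity matrix as effect also shows that the norm is preserved. -/
theorem effectProb_act (M V : Matrix (Bits n) (Bits n) ℂ) (hV : V.conjTranspose * V = 1)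
    (φ : Ket n) : effectProb M (act V φ) = effectProb (V.conjTranspose * M * V) φ := by
  have h1 : ∀ N : Matrix (Bits n) (Bits n) ℂ, dotProduct (star (act V φ)) (N.mulVec (act V φ)) =
      dotProduct (star φ) ((V.conjTranspose * N * V).mulVec φ) := by
    intro N
    rw [act, Matrix.star_mulVec, ← Matrix.dotProduct_mulVec, Matrix.mulVec_mulVec,
      Matrix.mulVec_mulVec, Matrix.mul_assoc]
  have h2 : ∑ x, ‖act V φ x‖ ^ 2 = ∑ x, ‖φ x‖ ^ 2 := by
    have := h1 1
    rw [Matrix.one_mulVec, Matrix.mul_one, hV, Matrix.one_mulVec, dotProduct_star_self,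
      dotProduct_star_self] at this
    exact_mod_cast this
  rw [effectProb, effectProb, h1, h2]

theorem act_ne_zero {V : Matrix (Bits n) (Bits n) ℂ} (hV : V.conjTranspose * V = 1) {φ : Ket n}
    (h : φ ≠ 0) : act V φ ≠ 0 := fun h0 => h <| by
  have : act V.conjTranspose (act V φ) = φ := by
    rw [act, act, Matrix.mulVec_mulVec, hV, Matrix.one_mulVec]
  rw [← this, h0, act, Matrix.mulVec_zero]

theorem Effect.conj {M V : Matrix (Bits n) (Bits n) ℂ} (h : Effect M)
    (hV : V.conjTranspose * V = 1) : Effect (V.conjTranspose * M * V) := by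
  refine ⟨h.1.conjTranspose_mul_mul_same V, ?_⟩
  have : 1 - V.conjTranspose * M * V = V.conjTranspose * (1 - M) * V := by
    rw [Matrix.mul_sub, Matrix.sub_mul, Matrix.mul_one, hV]
  rw [this]
  exact h.2.conjTranspose_mul_mul_same V

theorem IsEffect.act {g : Ket n → ℝ} (hg : IsEffect g) {V : Matrix (Bits n) (Bits n) ℂ}
    (hV : V.conjTranspose * V = 1) : IsEffect fun φ => g (act V φ) := by
  obtain ⟨M, hM, h⟩ := hg
  exact ⟨_, hM.conj hV, fun φ hφ => by
    rw [← effectProb_act _ _ hV, ← h _ (act_ne_zero hV hφ)]⟩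

theorem effectProb_smul (M : Matrix (Bits n) (Bits n) ℂ) {z : ℂ} (hz : z ≠ 0) (φ : Ket n) :
    effectProb M (z • φ) = effectProb M φ := by
  have h1 : dotProduct (star (z • φ)) (M.mulVec (z • φ)) =
      ((‖z‖ ^ 2 : ℝ) : ℂ) * dotProduct (star φ) (M.mulVec φ) := by
    rw [Matrix.mulVec_smul, star_smul, smul_dotProduct, dotProduct_smul, smul_eq_mul, smul_eq_mul,
      ← mul_assoc, RCLike.star_def, RCLike.conj_mul]
    simp
  have h2 : ∑ x, ‖(z • φ) x‖ ^ 2 = ‖z‖ ^ 2 * ∑ x, ‖φ x‖ ^ 2 := by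
    simp [Finset.mul_sum, mul_pow]
  have := norm_pos_iff.2 hz
  rw [effectProb, effectProb, h1, h2, Complex.re_ofReal_mul, mul_div_mul_left]
  positivity

theorem IsEffect.smul {g : Ket n → ℝ} (hg : IsEffect g) {z : ℂ} (hz : z ≠ 0) {φ : Ket n}
    (hφ : φ ≠ 0) : g (z • φ) = g φ := by
  obtain ⟨M, _, h⟩ := hg
  rw [h _ (smul_ne_zero hz hφ), h φ hφ, effectProb_smul _ hz]

theorem Effect.unit {M : Matrix (Bits n) (Bits n) ℂ} (h : Effect M) {φ : Ket n} (hφ : φ ≠ 0) :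
    0 ≤ effectProb M φ ∧ effectProb M φ ≤ 1 := by
  have h1 : ∀ N : Matrix (Bits n) (Bits n) ℂ, N.PosSemidef → 0 ≤ effectProb N φ := fun N hN =>
    div_nonneg (Complex.le_def.1 (hN.dotProduct_mulVec_nonneg φ)).1 (sum_sq_pos hφ).le
  refine ⟨h1 M h.1, ?_⟩
  have h2 := h1 _ h.2
  -- Linearity with the weights `1` and `-1`: the effect `1 - M` has the complementary probability.
  have h3 := effectProb_sum (Finset.univ : Finset Bool) (fun b => if b then 1 else -1)
    (fun b => if b then 1 else M) φ
  simp only [Fintype.sum_bool, if_true, Bool.false_eq_true, if_false, effectProb_one hφ] at h3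
  have h4 : ((1 : ℝ) : ℂ) • (1 : Matrix (Bits n) (Bits n) ℂ) + ((-1 : ℝ) : ℂ) • M = 1 - M := by
    simp [sub_eq_add_neg]
  rw [h4] at h3
  linarith

/-- Trace closeness, for functions that are effects. -/
theorem TraceClose.abs_sub_le {X : Type} {ε : ℝ} {p q : PMF (X × Ket n)} (h : TraceClose ε p q)
    (hp : ∀ r ∈ p.support, r.2 ≠ 0) (hq : ∀ r ∈ q.support, r.2 ≠ 0) {g : X → Ket n → ℝ}
    (hg : ∀ x, IsEffect (g x)) :
    |expect p (fun r => g r.1 r.2) - expect q fun r => g r.1 r.2| ≤ ε := by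
  choose M hM hgM using hg
  have h1 : expect p (fun r => g r.1 r.2) = expect p fun r => effectProb (M r.1) r.2 :=
    expect_congr fun r hr => hgM _ _ (hp r hr)
  have h2 : expect q (fun r => g r.1 r.2) = expect q fun r => effectProb (M r.1) r.2 :=
    expect_congr fun r hr => hgM _ _ (hq r hr)
  rw [h1, h2]
  exact h M hM

/-- Measurements of an observable are effects. -/
theorem isEffect_outcome {G : Game Q} (S : QStrat G (QubitSpace n)) {R : Finset Q}
    (hR : S.Compatible R) {f : (R → G.A) → ℝ} (hf : IsUnit01 f) :
    IsEffect fun φ : Ket n => expect (S.outcome (WithLp.toLp 2 φ) R) f := by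
  -- The effect is `∑ f a • M a`, where the matrices `M a` of the joint spectral projections are
  -- positive and sum to 1.
  let M : (R → G.A) → Matrix (Bits n) (Bits n) ℂ := fun a =>
    Matrix.toEuclideanLin.symm (S.proj R a : QubitSpace n →ₗ[ℂ] QubitSpace n)
  have hM : ∀ a (φ : Ket n), WithLp.toLp 2 ((M a).mulVec φ) = S.proj R a (WithLp.toLp 2 φ) := by
    intro a φ
    have : Matrix.toEuclideanLin (M a) = (S.proj R a : QubitSpace n →ₗ[ℂ] QubitSpace n) :=
      Matrix.toEuclideanLin.apply_symm_apply _
    have h2 := congrArg (fun T : QubitSpace n →ₗ[ℂ] QubitSpace n => T (WithLp.toLp 2 φ)) this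
    exact h2
  have hdot : ∀ a (φ : Ket n), dotProduct (star φ) ((M a).mulVec φ) =
      ((‖S.proj R a (WithLp.toLp 2 φ)‖ ^ 2 : ℝ) : ℂ) := by
    intro a φ
    rw [S.norm_proj_sq, ← hM, EuclideanSpace.inner_eq_star_dotProduct, dotProduct_comm]
  have hpos : ∀ a, (M a).PosSemidef := by
    intro a
    rw [← Matrix.isPositive_toEuclideanLin_iff]
    have : Matrix.toEuclideanLin (M a) = (S.proj R a : QubitSpace n →ₗ[ℂ] QubitSpace n) :=
      Matrix.toEuclideanLin.apply_symm_apply _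
    rw [this]
    refine ⟨Submodule.starProjection_isSymmetric _, fun u => ?_⟩
    rw [← inner_conj_symm, ContinuousLinearMap.coe_coe, ← S.norm_proj_sq,
      Complex.conj_ofReal, RCLike.re_eq_complex_re, Complex.ofReal_re]
    positivity
  have hsum : ∑ a, M a = 1 := by
    rw [← map_sum Matrix.toEuclideanLin.symm, LinearEquiv.symm_apply_eq]
    refine LinearMap.ext fun v => ?_
    simpa [Matrix.toEuclideanLin] using S.sum_proj hR v
  refine ⟨∑ a, (f a : ℂ) • M a, ⟨Matrix.posSemidef_sum _ fun a _ =>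
    posSemidef_ofReal_smul (hpos a) (hf a).1, ?_⟩, fun φ hφ => ?_⟩
  · have : 1 - ∑ a, (f a : ℂ) • M a = ∑ a, ((1 - f a : ℝ) : ℂ) • M a := by
      rw [← hsum, ← Finset.sum_sub_distrib]
      refine Finset.sum_congr rfl fun a _ => ?_
      rw [Complex.ofReal_sub, sub_smul, Complex.ofReal_one, one_smul]
    rw [this]
    exact Matrix.posSemidef_sum _ fun a _ => posSemidef_ofReal_smul (hpos a) (by linarith [(hf a).2])
  · have hφ' : (WithLp.toLp 2 φ : QubitSpace n) ≠ 0 := by simpa using hφ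
    rw [effectProb_sum]
    beta_reduce
    rw [S.expect_outcome hR hφ', Finset.sum_div]
    refine Finset.sum_congr rfl fun a _ => ?_
    have hn : ‖(WithLp.toLp 2 φ : QubitSpace n)‖ ^ 2 = ∑ x, ‖φ x‖ ^ 2 :=
      EuclideanSpace.norm_sq_eq _
    rw [effectProb, hdot, Complex.ofReal_re, hn]
    ring

end Effects

theorem basisKet_ne_zero {n : ℕ} (x : Bits n) : basisKet x ≠ 0 := fun h => by
  simpa [basisKet] using congrFun h x

theorem prod_ne_zero {a n : ℕ} {ξ : Ket a} {φ : Ket n} (hξ : ξ ≠ 0) (hφ : φ ≠ 0) :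
    (fun i : Bits a × Bits n => ξ i.1 * φ i.2) ≠ 0 := fun h => by
  obtain ⟨x, hx⟩ := Function.ne_iff.1 hξ
  obtain ⟨y, hy⟩ := Function.ne_iff.1 hφ
  exact mul_ne_zero hx hy (congrFun h (x, y))

/-! ### Circuits as isometries -/

namespace Circuit

variable {a n : ℕ}

theorem sum_sq_pos {C : Circuit a n} (hC : C.IsCircuit) {ξ : Ket a} {φ : Ket n} (hξ : ξ ≠ 0)
    (hφ : φ ≠ 0) : 0 < ∑ o, ‖C.V.mulVec (fun i => ξ i.1 * φ i.2) o‖ ^ 2 := by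
  have h : C.V.mulVec (fun i => ξ i.1 * φ i.2) ≠ 0 := fun h0 => prod_ne_zero hξ hφ <| by
    have : C.V.conjTranspose.mulVec (C.V.mulVec fun i => ξ i.1 * φ i.2) =
        fun i => ξ i.1 * φ i.2 := by
      rw [Matrix.mulVec_mulVec, hC, Matrix.one_mulVec]
    rw [← this, h0, Matrix.mulVec_zero]
  obtain ⟨x, hx⟩ := Function.ne_iff.1 h
  exact Finset.sum_pos' (fun _ _ => by positivity)
    ⟨x, Finset.mem_univ x, by have := norm_pos_iff.2 hx; positivity⟩

theorem expect_apply {C : Circuit a n} (hC : C.IsCircuit) {ξ : Ket a} {φ : Ket n} (hξ : ξ ≠ 0)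
    (hφ : φ ≠ 0) {f : Bits C.cbits × Ket C.qbits → ℝ} (hf : IsBdd f) :
    expect (C.apply ξ φ) f = (∑ o, ‖C.V.mulVec (fun i => ξ i.1 * φ i.2) o‖ ^ 2 *
      f (o.1, fun y => C.V.mulVec (fun i => ξ i.1 * φ i.2) (o.1, y, o.2.2))) /
        ∑ o, ‖C.V.mulVec (fun i => ξ i.1 * φ i.2) o‖ ^ 2 := by
  rw [apply, expect_map _ _ hf, expect_sampleBy_fintype (fun _ => by positivity)
    (sum_sq_pos hC hξ hφ)]

theorem mem_support_apply {C : Circuit a n} (hC : C.IsCircuit) {ξ : Ket a} {φ : Ket n}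
    (hξ : ξ ≠ 0) (hφ : φ ≠ 0) {r : Bits C.cbits × Ket C.qbits} (hr : r ∈ (C.apply ξ φ).support) :
    ∃ o, C.V.mulVec (fun i => ξ i.1 * φ i.2) o ≠ 0 ∧
      r = (o.1, fun y => C.V.mulVec (fun i => ξ i.1 * φ i.2) (o.1, y, o.2.2)) := by
  rw [apply, PMF.mem_support_map_iff] at hr
  obtain ⟨o, ho, rfl⟩ := hr
  rw [mem_support_sampleBy (fun _ => by positivity) (hasSum_fintype _).summable
    (by rw [tsum_fintype]; exact sum_sq_pos hC hξ hφ)] at ho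
  refine ⟨o, fun h => ?_, rfl⟩
  simp [h] at ho

theorem ne_zero_of_mem_apply {C : Circuit a n} (hC : C.IsCircuit) {ξ : Ket a} {φ : Ket n}
    (hξ : ξ ≠ 0) (hφ : φ ≠ 0) {r : Bits C.cbits × Ket C.qbits} (hr : r ∈ (C.apply ξ φ).support) :
    r.2 ≠ 0 := by
  obtain ⟨o, ho, rfl⟩ := mem_support_apply hC hξ hφ hr
  exact fun h => ho (congrFun h o.2.1)

/-- The matrix of `ofFun f`. -/
def funMatrix {n l : ℕ} (f : Bits n → Bits l) :
    Matrix (Bits l × Bits 0 × Bits n) (Bits 0 × Bits n) ℂ :=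
  fun o i => if o.1 = f i.2 ∧ o.2.2 = i.2 then 1 else 0

theorem funMatrix_isometry {n l : ℕ} (f : Bits n → Bits l) :
    (funMatrix f).conjTranspose * funMatrix f = 1 := by
  ext ⟨i, i'⟩ ⟨j, j'⟩
  have hij : i = j := Subsingleton.elim _ _
  subst hij
  rw [Matrix.mul_apply, Fintype.sum_eq_single (f i', Fin.elim0, i')]
  · by_cases h : i' = j' <;> simp [funMatrix, Matrix.one_apply, h]
  · intro o ho
    have h1 : ¬ (o.1 = f i' ∧ o.2.2 = i') := fun h =>
      ho (Prod.ext h.1 (Prod.ext (Subsingleton.elim _ _) h.2))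
    simp [funMatrix, h1]

theorem isCircuit_ofFun {n l : ℕ} (f : Bits n → Bits l) : (ofFun f).IsCircuit :=
  funMatrix_isometry f

theorem funMatrix_mulVec_ne_zero {n l : ℕ} {f : Bits n → Bits l} {y : Bits n}
    {o : Bits l × Bits 0 × Bits n}
    (ho : (funMatrix f).mulVec (fun i => basisKet Fin.elim0 i.1 * basisKet y i.2) o ≠ 0) :
    o.1 = f y := by
  rw [Matrix.mulVec, dotProduct] at ho
  obtain ⟨i, _, hi⟩ := Finset.exists_ne_zero_of_sum_ne_zero ho
  have h1 : o.1 = f i.2 ∧ o.2.2 = i.2 := by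
    by_contra h
    exact hi (by rw [funMatrix, if_neg h, zero_mul])
  have h2 : i.2 = y := by
    by_contra h
    exact hi (by simp [basisKet, h])
  exact h1.1.trans (by rw [h2])

theorem fst_of_mem_apply_ofFun {n l : ℕ} (f : Bits n → Bits l) {y : Bits n}
    {r : Bits l × Ket 0} (hr : r ∈ ((ofFun f).apply (basisKet Fin.elim0) (basisKet y)).support) :
    r.1 = f y := by
  obtain ⟨o, ho, rfl⟩ := mem_support_apply (isCircuit_ofFun f) (basisKet_ne_zero _)
    (basisKet_ne_zero _) hr
  exact funMatrix_mulVec_ne_zero ho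

/-- The isometry that does nothing. -/
def idleMatrix (n : ℕ) : Matrix (Bits 0 × Bits n × Bits 0) (Bits 0 × Bits n) ℂ :=
  fun o i => if o.2.1 = i.2 then 1 else 0

/-- The circuit that does nothing. -/
def idle (n : ℕ) : Circuit 0 n where
  cbits := 0
  qbits := n
  rest := 0
  V := idleMatrix n

theorem isCircuit_idle (n : ℕ) : (idle n).IsCircuit := by
  change (idleMatrix n).conjTranspose * idleMatrix n = 1
  ext ⟨i, i'⟩ ⟨j, j'⟩
  have hij : i = j := Subsingleton.elim _ _
  subst hij
  rw [Matrix.mul_apply, Fintype.sum_eq_single (Fin.elim0, i', Fin.elim0)]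
  · by_cases h : i' = j' <;> simp [idleMatrix, Matrix.one_apply, h]
  · intro o ho
    have h1 : ¬ (o.2.1 = i') := fun h =>
      ho (Prod.ext (Subsingleton.elim _ _) (Prod.ext h (Subsingleton.elim _ _)))
    simp [idleMatrix, h1]

theorem idleMatrix_mulVec {n : ℕ} (φ : Ket n) (o : Bits 0 × Bits n × Bits 0) :
    (idleMatrix n).mulVec (fun i => basisKet Fin.elim0 i.1 * φ i.2) o = φ o.2.1 := by
  rw [Matrix.mulVec, dotProduct, Fintype.sum_eq_single (Fin.elim0, o.2.1)]
  · simp [idleMatrix, basisKet]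
  · intro i hi
    have h1 : ¬ o.2.1 = i.2 := fun h => hi (Prod.ext (Subsingleton.elim _ _) h.symm)
    simp [idleMatrix, h1]

theorem snd_of_mem_apply_idle {n : ℕ} {φ : Ket n} (hφ : φ ≠ 0) {r : Bits 0 × Ket n}
    (hr : r ∈ ((idle n).apply (basisKet Fin.elim0) φ).support) : r.2 = φ := by
  obtain ⟨o, ho, rfl⟩ := mem_support_apply (isCircuit_idle n) (basisKet_ne_zero _) hφ hr
  exact funext fun y => idleMatrix_mulVec φ (o.1, y, o.2.2)

end Circuit

/-! ### The circuit of the joint measurement -/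

section Measure

variable {G : Game Q} {n : ℕ} (cd : Coding G) (S : QStrat G (QubitSpace n))

/-- The unnormalised post-measurement state for the encoded answers `o`. -/
def branch (C : Finset Q) (o : Bits cd.vecLen) (u : QubitSpace n) : QubitSpace n :=
  ∑ a : C → G.A, if cd.vec C a = o then S.proj C a u else 0

theorem branch_vec {C : Finset Q} (hC : C ∈ G.contexts) (a : C → G.A) (u : QubitSpace n) :
    branch cd S C (cd.vec C a) u = S.proj C a u := by
  classical
  rw [branch, Finset.sum_eq_single a]
  · simp
  · intro b _ hb
    rw [if_neg fun h => hb (cd.vec_inj C hC h)]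
  · simp

/-- Strings that encode no answer vector have the zero branch, so only codes contribute, and these
correspond bijectively to answer vectors. -/
theorem sum_branch {M : Type*} [AddCommMonoid M] {C : Finset Q} (hC : C ∈ G.contexts)
    {g : Bits cd.vecLen → M} (hg : ∀ o, (∀ u, branch cd S C o u = 0) → g o = 0) :
    ∑ o, g o = ∑ a : C → G.A, g (cd.vec C a) := by
  classical
  refine (Finset.sum_of_injOn (cd.vec C) (fun _ _ _ _ h => cd.vec_inj C hC h)
    (fun _ _ => by simp) (fun o _ ho => hg o fun u => ?_) fun _ _ => rfl).symm
  rw [branch]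
  refine Finset.sum_eq_zero fun a _ => if_neg fun h => ho ⟨a, by simp, h⟩

theorem branch_sum_single (C : Finset Q) (o : Bits cd.vecLen) (u : QubitSpace n) :
    ∑ i, u i • branch cd S C o (EuclideanSpace.single i 1) = branch cd S C o u := by
  have hu : u = ∑ i, u i • (EuclideanSpace.single i (1 : ℂ) : QubitSpace n) := by
    ext y
    simp [Finset.sum_apply, Pi.single_apply]
  conv_rhs => rw [hu]
  simp only [branch, Finset.smul_sum, map_sum, map_smul]
  rw [Finset.sum_comm]
  refine Finset.sum_congr rfl fun a _ => ?_
  split_ifs <;> simp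

/-- The isometry of `measureCircuit`. -/
def measureMatrix : Matrix (Bits cd.vecLen × Bits n × Bits cd.ctxLen) (Bits n × Bits cd.ctxLen) ℂ :=
  (measureCircuit cd S).V

theorem measureMatrix_apply {C : Finset Q} (hC : C ∈ G.contexts)
    (o : Bits cd.vecLen × Bits n × Bits cd.ctxLen) (i : Bits n) :
    measureMatrix cd S o (i, cd.ctx C) =
      if o.2.2 = cd.ctx C then branch cd S C o.1 (EuclideanSpace.single i 1) o.2.1 else 0 := by
  classical
  have hf : G.contexts.filter (fun C' => cd.ctx C' = cd.ctx C) = {C} := by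
    ext C'
    simp only [Finset.mem_filter, Finset.mem_singleton]
    exact ⟨fun h => cd.ctx_inj h.1 hC h.2, by rintro rfl; exact ⟨hC, rfl⟩⟩
  have hex : ∃ C' ∈ G.contexts, cd.ctx C' = cd.ctx C := ⟨C, hC, rfl⟩
  by_cases h : o.2.2 = cd.ctx C
  · simp only [measureMatrix, measureCircuit, h, ne_eq, not_true, if_false, hex, if_true, branch]
    convert_to ∑ C' ∈ ({C} : Finset (Finset Q)), ∑ a : C' → G.A, (if cd.vec C' a = o.1 then
      (S.proj C' a (EuclideanSpace.single i 1)) o.2.1 else 0) = _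
    · rw [← hf]
    rw [Finset.sum_singleton, WithLp.ofLp_sum, Finset.sum_apply]
    refine Finset.sum_congr rfl fun a _ => ?_
    split_ifs <;> simp
  · simp [measureMatrix, measureCircuit, h]

theorem sum_star_mul (u w : QubitSpace n) : ∑ y, star (u y) * w y = inner ℂ u w := by
  rw [EuclideanSpace.inner_eq_star_dotProduct, dotProduct]
  exact Finset.sum_congr rfl fun y _ => by simp [mul_comm]

/-- The context register is copied to the output, so different contents are orthogonal. On the code
of a context, `∑ ⟨P_a e_i, P_a e_j⟩ = ⟨e_i, ∑ P_a e_j⟩ = ⟨e_i, e_j⟩`. On any other content the state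
is left alone and the zero string is written. -/
theorem isCircuit_measureCircuit : (measureCircuit cd S).IsCircuit := by
  classical
  change (measureMatrix cd S).conjTranspose * measureMatrix cd S = 1
  ext ⟨i, x⟩ ⟨j, x'⟩
  rw [Matrix.mul_apply]
  by_cases hx : x = x'
  · subst hx
    by_cases hex : ∃ C ∈ G.contexts, cd.ctx C = x
    · obtain ⟨C, hC, rfl⟩ := hex
      simp only [Matrix.conjTranspose_apply]
      have h1 : ∀ o : Bits cd.vecLen, ∑ p : Bits n × Bits cd.ctxLen,
          star (measureMatrix cd S (o, p) (i, cd.ctx C)) *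
            measureMatrix cd S (o, p) (j, cd.ctx C) =
          inner ℂ (branch cd S C o (EuclideanSpace.single i 1))
            (branch cd S C o (EuclideanSpace.single j 1)) := by
        intro o
        rw [← sum_star_mul, Fintype.sum_prod_type]
        refine Finset.sum_congr rfl fun y _ => ?_
        rw [Finset.sum_eq_single (cd.ctx C)]
        · simp only [measureMatrix_apply cd S hC, if_true]
        · intro r _ hr
          simp only [measureMatrix_apply cd S hC, hr, if_false, mul_zero]
        · simp
      refine (Fintype.sum_prod_type _).trans ((Finset.sum_congr rfl fun o _ => h1 o).trans ?_)
      rw [sum_branch cd S hC fun o ho => by rw [ho, inner_zero_left]]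
      simp only [branch_vec cd S hC, S.inner_proj_proj]
      rw [← inner_sum, S.sum_proj (S.compatible_context hC)]
      simp [Matrix.one_apply, EuclideanSpace.inner_single_left]
    · have hV : ∀ o (k : Bits n), measureMatrix cd S o (k, x) =
          if o = ((fun _ => false), k, x) then 1 else 0 := by
        intro o k
        simp only [measureMatrix, measureCircuit, hex, if_false, Prod.ext_iff, ne_eq]
        by_cases h1 : o.2.2 = x <;> simp [h1]
      simp only [Matrix.conjTranspose_apply, hV]
      rw [Finset.sum_eq_single ((fun _ => false), i, x)]
      · by_cases hij : i = j <;> simp [Matrix.one_apply, hij]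
      · intro o _ ho
        simp [ho]
      · simp
  · have h0 : ∀ o, star (measureMatrix cd S o (i, x)) *
        measureMatrix cd S o (j, x') = 0 := by
      intro o
      by_cases h1 : o.2.2 = x
      · have : o.2.2 ≠ x' := fun h => hx (h1.symm.trans h)
        have h2 : measureMatrix cd S o (j, x') = 0 := by simp [measureMatrix, measureCircuit, this]
        rw [h2, mul_zero]
      · have h2 : measureMatrix cd S o (i, x) = 0 := by simp [measureMatrix, measureCircuit, h1]
        rw [h2, star_zero, zero_mul]
    simp only [Matrix.conjTranspose_apply, h0, Finset.sum_const_zero]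
    simp [hx]

theorem ofLp_ψ_ne_zero : (S.ψ : QubitSpace n).ofLp ≠ 0 := fun h =>
  S.ψ_ne_zero (by ext y; exact congrFun h y)

theorem measureMatrix_mulVec {C : Finset Q} (hC : C ∈ G.contexts)
    (o : Bits cd.vecLen × Bits n × Bits cd.ctxLen) :
    (measureMatrix cd S).mulVec
        (fun i => (S.ψ : QubitSpace n).ofLp i.1 * basisKet (cd.ctx C) i.2) o =
      if o.2.2 = cd.ctx C then branch cd S C o.1 S.ψ o.2.1 else 0 := by
  classical
  rw [Matrix.mulVec, dotProduct, Fintype.sum_prod_type]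
  have h1 : ∀ i : Bits n, ∑ x, measureMatrix cd S o (i, x) *
      ((S.ψ : QubitSpace n).ofLp i * basisKet (cd.ctx C) x) =
        if o.2.2 = cd.ctx C then
          (S.ψ : QubitSpace n).ofLp i * branch cd S C o.1 (EuclideanSpace.single i 1) o.2.1
        else 0 := by
    intro i
    rw [Finset.sum_eq_single (cd.ctx C)]
    · rw [measureMatrix_apply cd S hC]
      split_ifs <;> simp [basisKet, mul_comm]
    · intro x _ hx
      simp [basisKet, hx]
    · simp
  rw [Finset.sum_congr rfl fun i _ => h1 i]
  split_ifs
  · conv_rhs => rw [← branch_sum_single]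
    rw [WithLp.ofLp_sum, Finset.sum_apply]
    rfl
  · simp

/-- The circuit performs the joint measurement of the observables of the context. -/
theorem measureCircuit_apply {C : Finset Q} (hC : C ∈ G.contexts) :
    (measureCircuit cd S).apply (S.ψ : QubitSpace n).ofLp (basisKet (cd.ctx C)) =
      (S.outcome S.ψ C).map fun a => (cd.vec C a, (S.proj C a S.ψ).ofLp) := by
  refine ext_of_expect fun f hf => ?_
  have key : ∀ g : Bits cd.vecLen × Ket n → ℝ,
      ∑ o, ‖(measureMatrix cd S).mulVec
        (fun i => (S.ψ : QubitSpace n).ofLp i.1 * basisKet (cd.ctx C) i.2) o‖ ^ 2 *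
          g (o.1, fun y => (measureMatrix cd S).mulVec
            (fun i => (S.ψ : QubitSpace n).ofLp i.1 * basisKet (cd.ctx C) i.2) (o.1, y, o.2.2)) =
      ∑ a, ‖S.proj C a S.ψ‖ ^ 2 * g (cd.vec C a, (S.proj C a S.ψ).ofLp) := by
    intro g
    refine (Fintype.sum_prod_type _).trans ?_
    have h1 : ∀ o : Bits cd.vecLen, ∑ p : Bits n × Bits cd.ctxLen,
        ‖(measureMatrix cd S).mulVec (fun i => (S.ψ : QubitSpace n).ofLp i.1 *
          basisKet (cd.ctx C) i.2) (o, p)‖ ^ 2 * g (o, fun y => (measureMatrix cd S).mulVec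
            (fun i => (S.ψ : QubitSpace n).ofLp i.1 * basisKet (cd.ctx C) i.2) (o, y, p.2)) =
        ‖branch cd S C o S.ψ‖ ^ 2 * g (o, (branch cd S C o S.ψ).ofLp) := by
      intro o
      rw [EuclideanSpace.norm_sq_eq, Finset.sum_mul, Fintype.sum_prod_type]
      refine Finset.sum_congr rfl fun y _ => ?_
      rw [Finset.sum_eq_single (cd.ctx C)]
      · simp only [measureMatrix_mulVec cd S hC, if_true]
      · intro r _ hr
        simp [measureMatrix_mulVec cd S hC, hr]
      · simp
    refine (Finset.sum_congr rfl fun o _ => h1 o).trans ?_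
    rw [sum_branch cd S hC fun o ho => by rw [ho]; simp]
    simp only [branch_vec cd S hC]
  have key1 := key fun _ => 1
  simp only [mul_one] at key1
  have hr : ∀ g : Bits cd.vecLen × Ket n → ℝ, IsUnit01 g →
      expect ((S.outcome S.ψ C).map fun a => (cd.vec C a, (S.proj C a S.ψ).ofLp)) g =
        (∑ o, ‖(measureMatrix cd S).mulVec
          (fun i => (S.ψ : QubitSpace n).ofLp i.1 * basisKet (cd.ctx C) i.2) o‖ ^ 2 *
            g (o.1, fun y => (measureMatrix cd S).mulVec
              (fun i => (S.ψ : QubitSpace n).ofLp i.1 * basisKet (cd.ctx C) i.2) (o.1, y, o.2.2))) /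
          ∑ o, ‖(measureMatrix cd S).mulVec
            (fun i => (S.ψ : QubitSpace n).ofLp i.1 * basisKet (cd.ctx C) i.2) o‖ ^ 2 := by
    intro g hg
    rw [expect_map _ _ hg.isBdd, S.expect_outcome (S.compatible_context hC) S.ψ_ne_zero,
      ← S.sum_norm_proj_sq (S.compatible_context hC), ← key1, ← key g]
  exact (Circuit.expect_apply (isCircuit_measureCircuit cd S) (ofLp_ψ_ne_zero S)
    (basisKet_ne_zero _) hf.isBdd).trans (hr f hf).symm

end Measure

/-! ### Loading states into the memory -/

namespace QMem

variable {m : ℕ}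

/-- All qubits from the address `m` on are `0`. -/
def Below (m : ℕ) (v : QMem) : Prop := ∀ S, v S ≠ 0 → S ⊆ Finset.range m

theorem write_val_subset (y : Bits m) : write (fun i : Fin m => (i : ℕ)) y ∅ ⊆ Finset.range m := by
  intro j hj
  rw [mem_write] at hj
  obtain ⟨h, _⟩ | ⟨i, _, rfl⟩ := hj
  · simp at h
  · simp

theorem write_val_of_subset {S : Finset ℕ} (hS : S ⊆ Finset.range m) (y : Bits m) :
    write (fun i : Fin m => (i : ℕ)) y S = write (fun i : Fin m => (i : ℕ)) y ∅ := by
  ext j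
  rw [mem_write, mem_write]
  constructor
  · rintro (⟨h1, h2⟩ | h)
    · exact absurd rfl (h2 ⟨j, Finset.mem_range.1 (hS h1)⟩)
    · exact Or.inr h
  · rintro (⟨h1, _⟩ | h)
    · simp at h1
    · exact Or.inr h

theorem subset_of_write_subset {S : Finset ℕ} {y : Bits m}
    (h : write (fun i : Fin m => (i : ℕ)) y S ⊆ Finset.range m) : S ⊆ Finset.range m := by
  intro j hj
  by_contra hjm
  refine hjm (h (mem_write.2 (Or.inl ⟨hj, fun i hi => hjm ?_⟩)))
  rw [← hi]
  simp

theorem write_val_injective : Function.Injective fun y : Bits m =>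
    write (fun i : Fin m => (i : ℕ)) y ∅ :=
  Function.LeftInverse.injective (g := read fun i : Fin m => (i : ℕ)) fun y =>
    read_write Fin.val_injective y ∅

theorem load_write (φ : Ket m) (y : Bits m) :
    load φ (write (fun i : Fin m => (i : ℕ)) y ∅) = φ y := by
  rw [load, if_pos (write_val_subset y), read_write Fin.val_injective]

theorem load_of_not_subset (φ : Ket m) {S : Finset ℕ} (h : ¬ S ⊆ Finset.range m) :
    load φ S = 0 := if_neg h

theorem below_load (φ : Ket m) : (load φ).Below m := fun S hS => by
  by_contra h
  exact hS (load_of_not_subset φ h)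

theorem ket_load (φ : Ket m) : ket m (load φ) = φ := funext fun y => load_write φ y

theorem load_ket {v : QMem} (hv : v.Below m) : load (ket m v) = v := by
  funext S
  by_cases h : S ⊆ Finset.range m
  · rw [load, if_pos h, ket, ← write_val_of_subset h, write_read]
  · rw [load_of_not_subset _ h]
    by_contra h0
    exact h (hv S (Ne.symm h0))

theorem ket_ne_zero {v : QMem} (hv : v.Below m) (h : v.Valid) : ket m v ≠ 0 := fun h0 => h.2 <| by
  rw [← load_ket hv, h0]
  funext S
  exact ite_self _

theorem tsum_load (φ : Ket m) (f : Finset ℕ → ℝ) :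
    ∑' S, ‖load φ S‖ ^ 2 * f S =
      ∑ y, ‖φ y‖ ^ 2 * f (write (fun i : Fin m => (i : ℕ)) y ∅) := by
  rw [← write_val_injective.tsum_eq, tsum_fintype]
  · exact Finset.sum_congr rfl fun y _ => by rw [load_write]
  · intro S hS
    have h : S ⊆ Finset.range m := below_load φ S fun h0 => hS (by simp [h0])
    exact ⟨read (fun i : Fin m => (i : ℕ)) S, by
      beta_reduce
      rw [← write_val_of_subset h, write_read]⟩

theorem valid_load {φ : Ket m} (h : φ ≠ 0) : (load φ).Valid := by
  refine ⟨(Finset.range m).powerset.finite_toSet.subset fun S hS => 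
    Finset.mem_coe.2 (Finset.mem_powerset.2 (below_load φ S hS)), fun h0 => h ?_⟩
  rw [← ket_load φ, h0]
  rfl

theorem born_load {φ : Ket m} (h : φ ≠ 0) (f : Finset ℕ → ℝ) :
    expect (born (load φ)) f =
      (∑ y, ‖φ y‖ ^ 2 * f (write (fun i : Fin m => (i : ℕ)) y ∅)) / ∑ y, ‖φ y‖ ^ 2 := by
  have h1 := tsum_load φ fun _ => 1
  simp only [mul_one] at h1
  rw [expect_born (valid_load h), tsum_load, h1]

theorem gate_load (U : Matrix (Bits m) (Bits m) ℂ) (φ : Ket m) :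
    gate U (fun i : Fin m => (i : ℕ)) (load φ) = load (act U φ) := by
  rw [gate_of_injective Fin.val_injective]
  funext S
  by_cases h : S ⊆ Finset.range m
  · simp only [write_val_of_subset h, load_write]
    rw [load, if_pos h]
    rfl
  · rw [load_of_not_subset _ h]
    refine Finset.sum_eq_zero fun y _ => ?_
    rw [load_of_not_subset _ fun h' => h (subset_of_write_subset h'), mul_zero]

theorem load₂_eq_load {a n : ℕ} (ξ : Ket a) (φ : Ket n) :
    load₂ ξ φ = load fun y : Bits (a + n) =>
      ξ (fun i => y (Fin.castAdd n i)) * φ (fun i => y (Fin.natAdd a i)) := rfl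

theorem valid_load₂ {a n : ℕ} {ξ : Ket a} {φ : Ket n} (hξ : ξ ≠ 0) (hφ : φ ≠ 0) :
    (load₂ ξ φ).Valid := by
  rw [load₂_eq_load]
  refine valid_load fun h => ?_
  obtain ⟨x, hx⟩ := Function.ne_iff.1 hξ
  obtain ⟨y, hy⟩ := Function.ne_iff.1 hφ
  refine mul_ne_zero hx hy ?_
  simpa [Fin.append_left, Fin.append_right] using congrFun h (Fin.append x y)

theorem vac_eq_load (m : ℕ) : vac = load (basisKet fun _ : Fin m => false) := by
  have : vac.Below m := fun S hS => by
    by_cases h : S = ∅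
    · simp [h]
    · exact absurd (by simp [vac, h]) hS
  rw [← load_ket this]
  congr 1
  funext y
  by_cases h : y = fun _ => false
  · subst h
    have : write (fun i : Fin m => (i : ℕ)) (fun _ => false) ∅ = ∅ := by
      ext j
      simp [mem_write]
    simp [ket, vac, basisKet, this]
  · have h' : write (fun i : Fin m => (i : ℕ)) y ∅ ≠ ∅ := fun h0 => h <| by
      rw [← read_write (w := fun i : Fin m => (i : ℕ)) Fin.val_injective y ∅, h0]
      funext i
      simp [read]
    simp [ket, vac, basisKet, h, h']

theorem below_of_mem_clear {v : QMem} (h : v.Valid) {w : QMem} (hw : w ∈ (clear m v).support) :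
    w.Valid ∧ w.Below m := valid_of_mem_clear h hw

/-- The joint distribution of the value of a qubit and of all qubits after its measurement. -/
theorem measure_bind_born {α : Type*} {v : QMem} (h : v.Valid) (i : ℕ)
    (g : Bool → Finset ℕ → α) :
    ((measure i v).bind fun r => (born r.2).map (g r.1)) =
      (born v).map fun S => g (decide (i ∈ S)) S := by
  classical
  refine ext_of_expect fun f hf => ?_
  -- `u b` is the unnormalised branch of `v` in which qubit `i` has the value `b`.
  let u : Bool → QMem := fun b (S : Finset ℕ) => if decide (i ∈ S) = b then v S else 0
  have hu : ∀ S : Finset ℕ, (fun S' => if (i ∈ S' ↔ i ∈ S) then v S' else 0) = u (decide (i ∈ S)) := by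
    intro S
    funext S'
    by_cases h1 : i ∈ S <;> by_cases h2 : i ∈ S' <;> simp [u, h1, h2]
  have hfin : ∀ b, (Function.support (u b)).Finite := fun b =>
    h.1.subset fun S hS hv => hS (by simp [u, hv])
  have hsq : ∀ b (F : Finset ℕ → ℝ), Summable fun S => ‖u b S‖ ^ 2 * F S := fun b F =>
    summable_of_hasFiniteSupport ((hfin b).subset fun S hS hv => hS (by simp [hv]))
  have hsplit : ∀ F : Bool → Finset ℕ → ℝ, ∑' S, ‖v S‖ ^ 2 * F (decide (i ∈ S)) S =
      ∑' S, ‖u true S‖ ^ 2 * F true S + ∑' S, ‖u false S‖ ^ 2 * F false S := by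
    intro F
    rw [← (hsq true _).tsum_add (hsq false _)]
    refine tsum_congr fun S => ?_
    by_cases hS : i ∈ S <;> simp [u, hS]
  -- The squared norm of a branch is the weight of its outcome and cancels the normalisation in
  -- `born`. For a zero branch both sides vanish, whatever default `born` takes.
  have hE : ∀ b (F : Finset ℕ → ℝ),
      (∑' S, ‖u b S‖ ^ 2) * expect (born (u b)) F = ∑' S, ‖u b S‖ ^ 2 * F S := by
    intro b F
    by_cases h0 : u b = 0
    · simp [h0]
    · have hv : (u b).Valid := ⟨hfin b, h0⟩
      rw [expect_born hv, mul_div_cancel₀ _ (tsum_sq_pos hv).ne']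
  rw [expect_bind _ _ hf.isBdd, measure, expect_map _ _ (isBdd_expect hf.isBdd),
    expect_map _ _ hf.isBdd, expect_born h, expect_born h]
  congr 1
  simp only [hu, expect_map _ _ hf.isBdd]
  rw [hsplit fun b S => f (g b S), hsplit fun b _ => expect (born (u b)) fun S => f (g b S)]
  simp only [tsum_mul_right, hE]

end QMem

/-! ### Quantum subroutines -/

namespace Feasible

theorem gate_val {m : ℕ} (U : Unitary m) : Feasible False fun x v => PMF.pure (x,
    QMem.gate (U : Matrix (Bits m) (Bits m) ℂ) (fun i : Fin m => (i : ℕ)) v) := by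
  have h := Feasible.seq (cl := False) (Feasible.weaken (Computable.const
    (Data.ofList (List.ofFn fun i : Fin m => Data.unary i)))) (Feasible.gate m U)
  refine ((Feasible.id.pair h).seq Feasible.fst).congr fun x v _ => ?_
  simp only [PMF.pure_bind, PMF.pure_map, Data.fst_node]
  congr 3
  funext i
  rw [Data.toList_ofList, List.getD_eq_getElem _ _ (by simp)]
  simp [Data.toNat_unary]

theorem clear_const (m : ℕ) : Feasible False fun x v => (QMem.clear m v).map fun w => (x, w) := by
  have h := Feasible.seq (cl := False) (Feasible.weaken (Computable.const (Data.unary m)))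
    Feasible.clear
  refine ((Feasible.id.pair h).seq Feasible.fst).congr fun x v _ => ?_
  simp [PMF.pure_bind, Data.toNat_unary, Function.comp_def,
    ← PMF.bind_pure_comp]

/-- Measuring the qubits in a list. -/
theorem measure_list (l : List ℕ) : ∃ F, Feasible False F ∧ ∀ x v, v.Valid →
    (F x v).map Prod.fst = (QMem.born v).map fun S =>
      Data.ofList (l.map fun i => Data.bit (decide (i ∈ S))) := by
  induction l with
  | nil =>
    refine ⟨_, Feasible.nil, fun x v _ => ?_⟩
    simp only [PMF.pure_map, List.map_nil, Data.ofList]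
    exact (PMF.map_const _ _).symm
  | cons i l ih =>
    obtain ⟨F, hF, h⟩ := ih
    have hm := Feasible.seq (cl := False) (Feasible.weaken (Computable.const (Data.unary i)))
      Feasible.meas
    refine ⟨_, hm.pair hF, fun x v hv => ?_⟩
    simp only [PMF.pure_bind, Data.toNat_unary, PMF.bind_map, PMF.map_bind, PMF.map_comp,
      Function.comp_def]
    simp only [List.map_cons, Data.ofList]
    rw [← QMem.measure_bind_born hv i fun b S =>
      Data.node (Data.bit b) (Data.ofList (l.map fun i => Data.bit (decide (i ∈ S))))]
    refine bind_congr_support fun r hr => ?_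
    have h1 := congrArg (PMF.map (Data.node (Data.bit r.1)))
      (h x r.2 (QMem.valid_of_mem_measure hv hr))
    simpa only [PMF.map_comp, Function.comp_def] using h1

/-- Measuring the first qubits. -/
theorem measure_first (m : ℕ) : ∃ F, Feasible False F ∧ ∀ x v, v.Valid →
    (F x v).map Prod.fst = (QMem.born v).map fun S =>
      ofBits (QMem.read (fun i : Fin m => (i : ℕ)) S) := by
  obtain ⟨F, hF, h⟩ := measure_list (List.ofFn fun i : Fin m => (i : ℕ))
  refine ⟨F, hF, fun x v hv => ?_⟩
  rw [h x v hv]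
  simp only [ofBits, QMem.read, List.map_ofFn, Function.comp_def]

end Feasible

/-- A unitary with a given first column. -/
theorem exists_unitary_column {m : ℕ} (φ : Ket m) (hφ : ∑ y, ‖φ y‖ ^ 2 = 1) (x : Bits m) :
    ∃ U : Unitary m, act (U : Matrix (Bits m) (Bits m) ℂ) (basisKet x) = φ := by
  have hn : ‖(WithLp.toLp 2 φ : QubitSpace m)‖ = 1 := by
    rw [EuclideanSpace.norm_eq, hφ, Real.sqrt_one]
  have ho : Orthonormal ℂ (({x} : Set (Bits m)).domRestrict
      fun _ => (WithLp.toLp 2 φ : QubitSpace m)) := by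
    refine ⟨fun _ => hn, fun i j hij => absurd (Subsingleton.elim i j) hij⟩
  obtain ⟨b, hb⟩ := ho.exists_orthonormalBasis_extension_of_card_eq (ι := Bits m) (by simp)
  refine ⟨⟨_, (EuclideanSpace.basisFun (Bits m) ℂ).toMatrix_orthonormalBasis_mem_unitary b⟩, ?_⟩
  funext y
  have := hb x rfl
  simp [act, basisKet, Module.Basis.toMatrix_apply, this]

theorem exists_unitary_load {m : ℕ} (φ : Ket m) (hφ : ∑ y, ‖φ y‖ ^ 2 = 1) :
    ∃ U : Unitary m, QMem.gate (U : Matrix (Bits m) (Bits m) ℂ) (fun i : Fin m => (i : ℕ)) QMem.vac =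
      QMem.load φ := by
  obtain ⟨U, hU⟩ := exists_unitary_column φ hφ fun _ => false
  exact ⟨U, by rw [QMem.vac_eq_load m, QMem.gate_load, hU]⟩

/-! ### The honest prover runs in quantum polynomial time -/

section Eigenbasis

variable {G : Game Q} {n : ℕ} (S : QStrat G (QubitSpace n))

/-- An observable has an orthonormal eigenbasis. -/
theorem QStrat.exists_eigenbasis (q : Q) :
    ∃ (b : OrthonormalBasis (Bits n) ℂ (QubitSpace n)) (α : Bits n → G.A),
      ∀ y, b y ∈ S.eigen {q} fun _ => α y := by
  have hT : ((S.O q : QubitSpace n →L[ℂ] QubitSpace n) : QubitSpace n →ₗ[ℂ] QubitSpace n).IsSymmetric :=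
    (S.selfAdjoint q).isSymmetric
  have hn : Module.finrank ℂ (QubitSpace n) = Fintype.card (Bits n) := by simp
  let e := (Fintype.equivFin (Bits n)).symm
  have h : ∀ i, ∃ a : G.A, S.O q (hT.eigenvectorBasis hn i) =
      ((a : ℝ) : ℂ) • hT.eigenvectorBasis hn i := by
    intro i
    have h1 : S.O q (hT.eigenvectorBasis hn i) =
        ((hT.eigenvalues hn i : ℝ) : ℂ) • hT.eigenvectorBasis hn i :=
      hT.apply_eigenvectorBasis hn i
    have h2 : ((hT.eigenvalues hn i : ℝ) : ℂ) ∈ spectrum ℂ (S.O q) := by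
      rw [spectrum.mem_iff]
      intro hu
      obtain ⟨w, hw⟩ := hu
      have h3 : (w : QubitSpace n →L[ℂ] QubitSpace n) (hT.eigenvectorBasis hn i) = 0 := by
        rw [hw, sub_apply, h1, Algebra.algebraMap_eq_smul_one]
        simp
      have h4 : ((w⁻¹ * w : (QubitSpace n →L[ℂ] QubitSpace n)ˣ) :
          QubitSpace n →L[ℂ] QubitSpace n) (hT.eigenvectorBasis hn i) = 0 := by
        rw [Units.val_mul, mul_apply_eq_comp, h3, map_zero]
      rw [inv_mul_cancel, Units.val_one, one_apply_eq_self] at h4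
      exact (hT.eigenvectorBasis hn).orthonormal.ne_zero i h4
    obtain ⟨a, ha, hae⟩ := S.spectrum_subset q h2
    exact ⟨⟨a, ha⟩, by rw [h1, ← hae]⟩
  choose a ha using h
  refine ⟨(hT.eigenvectorBasis hn).reindex e, fun y => a (e.symm y), fun y => ?_⟩
  rw [S.mem_eigen]
  rintro ⟨p, hp⟩
  rw [Finset.mem_singleton] at hp
  subst hp
  simpa using ha (e.symm y)

/-- An observable is measured by a change of basis. -/
theorem QStrat.exists_measurement (q : Q) : ∃ (V : Unitary n) (α : Bits n → G.A),
    ∀ φ : Ket n, φ ≠ 0 → ∀ f : (({q} : Finset Q) → G.A) → ℝ,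
      expect (S.outcome (WithLp.toLp 2 φ) {q}) f =
        (∑ y, ‖act (V : Matrix (Bits n) (Bits n) ℂ) φ y‖ ^ 2 * f fun _ => α y) /
          ∑ y, ‖act (V : Matrix (Bits n) (Bits n) ℂ) φ y‖ ^ 2 := by
  obtain ⟨b, α, hb⟩ := S.exists_eigenbasis q
  -- The columns of `W` are the eigenvectors, so `star W` computes the coordinates in the
  -- eigenbasis.
  let W : Unitary n := ⟨_, (EuclideanSpace.basisFun (Bits n) ℂ).toMatrix_orthonormalBasis_mem_unitary b⟩
  have hW : ∀ (φ : Ket n) y, act ((star W : Unitary n) : Matrix (Bits n) (Bits n) ℂ) φ y =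
      inner ℂ (b y) (WithLp.toLp 2 φ) := by
    intro φ y
    rw [act, Matrix.mulVec, dotProduct, EuclideanSpace.inner_eq_star_dotProduct, dotProduct]
    refine Finset.sum_congr rfl fun i _ => ?_
    simp [W, Matrix.star_apply, Module.Basis.toMatrix_apply, mul_comm]
  refine ⟨star W, α, fun φ hφ f => ?_⟩
  have hu : (WithLp.toLp 2 φ : QubitSpace n) ≠ 0 := fun h => hφ (congrArg WithLp.ofLp h)
  have hproj : ∀ a y, inner ℂ (b y) (S.proj {q} a (WithLp.toLp 2 φ)) =
      if a = (fun _ => α y) then inner ℂ (b y) (WithLp.toLp 2 φ) else 0 := by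
    intro a y
    rw [QStrat.proj, ← Submodule.inner_starProjection_left_eq_right]
    split_ifs with h
    · subst h
      rw [Submodule.starProjection_eq_self_iff.2 (hb y)]
    · have hq : a ⟨q, Finset.mem_singleton_self q⟩ ≠ α y := fun h' => h <| by
        funext ⟨p, hp⟩
        have := Finset.mem_singleton.1 hp
        subst this
        exact h'
      have := S.proj_eq_zero (a := a) (b := fun _ => α y) (Finset.mem_singleton_self q)
        (Finset.mem_singleton_self q) hq (hb y)
      rw [QStrat.proj] at this
      rw [this, inner_zero_left]
  have hnorm : ∀ a, ‖S.proj {q} a (WithLp.toLp 2 φ)‖ ^ 2 =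
      ∑ y, if a = (fun _ => α y) then ‖inner ℂ (b y) (WithLp.toLp 2 φ : QubitSpace n)‖ ^ 2 else 0 := by
    intro a
    rw [← b.sum_sq_norm_inner_right]
    refine Finset.sum_congr rfl fun y _ => ?_
    rw [hproj]
    split_ifs <;> simp
  rw [S.expect_outcome (S.compatible_singleton q) hu, ← b.sum_sq_norm_inner_right]
  simp only [hW, hnorm, Finset.sum_mul]
  rw [Finset.sum_comm]
  congr 1
  refine Finset.sum_congr rfl fun y _ => ?_
  rw [Finset.sum_eq_single fun _ => α y]
  · simp
  · intro a _ ha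
    simp [ha]
  · simp

variable (cd : Coding G)

/-- The last step of the honest prover. -/
theorem feasible_answer (q : Q) (U : Unitary n) : ∃ F, Feasible False F ∧
    ∀ x v, v.Valid → v.Below n → (F x v).map Prod.fst =
      (S.outcome (WithLp.toLp 2 (act (U : Matrix (Bits n) (Bits n) ℂ).conjTranspose (v.ket n)))
        {q}).map fun a => Data.node (cd.ans (a ⟨q, Finset.mem_singleton_self q⟩)) Data.nil := by
  obtain ⟨V, α, hV⟩ := S.exists_measurement q
  obtain ⟨F, hF, hFm⟩ := Feasible.measure_first n
  have htab := Computable.table (ofBits_injective (n := n))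
    (fun y => Data.node (cd.ans (α y)) Data.nil) Data.nil
  -- Undoing the pad and changing to the eigenbasis form one fixed unitary. Then `n` qubits are
  -- measured, and a table translates the string into the answer.
  refine ⟨_, ((Feasible.gate_val (V * star U)).seq hF).seq (Feasible.weaken htab),
    fun x v hv hb => ?_⟩
  have hφ := QMem.ket_ne_zero hb hv
  set φ := v.ket n with hφd
  have hvl : v = QMem.load φ := (QMem.load_ket hb).symm
  have hact : act ((V * star U : Unitary n) : Matrix (Bits n) (Bits n) ℂ) φ =
      act (V : Matrix (Bits n) (Bits n) ℂ) (act (U : Matrix (Bits n) (Bits n) ℂ).conjTranspose φ) := by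
    rw [act, act, act, Matrix.mulVec_mulVec]
    rfl
  have hU : (U : Matrix (Bits n) (Bits n) ℂ).conjTranspose.conjTranspose *
      (U : Matrix (Bits n) (Bits n) ℂ).conjTranspose = 1 := by
    rw [Matrix.conjTranspose_conjTranspose]
    exact Matrix.mem_unitaryGroup_iff.1 U.2
  have hφ' := act_ne_zero hU hφ
  have hφ'' : act (V : Matrix (Bits n) (Bits n) ℂ)
      (act (U : Matrix (Bits n) (Bits n) ℂ).conjTranspose φ) ≠ 0 :=
    act_ne_zero (Matrix.mem_unitaryGroup_iff'.1 V.2) hφ'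
  have htv : ∀ y : Bits n, (Function.partialInv ofBits (ofBits y)).elim Data.nil
      (fun y => Data.node (cd.ans (α y)) Data.nil) = Data.node (cd.ans (α y)) Data.nil := by
    intro y
    rw [(partialInv_eq_some ofBits_injective).2 rfl]
    rfl
  simp only [PMF.pure_bind]
  rw [hvl, QMem.gate_load, hact]
  have h1 := congrArg (PMF.map fun d => (Function.partialInv ofBits d).elim Data.nil
      (fun y : Bits n => Data.node (cd.ans (α y)) Data.nil))
    (hFm x _ (QMem.valid_load hφ''))
  rw [PMF.map_comp, PMF.map_comp] at h1
  simp only [PMF.map_bind, PMF.pure_map]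
  refine Eq.trans ?_ (h1.trans ?_)
  · rw [← PMF.bind_pure_comp]
    rfl
  · refine ext_of_expect fun f hf => ?_
    rw [expect_map _ _ hf.isBdd, expect_map _ _ hf.isBdd, QMem.born_load hφ'', hV _ hφ']
    simp only [Function.comp_apply, QMem.read_write Fin.val_injective, htv]

end Eigenbasis

/-- The output state of a quantum algorithm. -/
theorem QPT.valid_of_mem_clear_run (A : QPT) {m : ℕ} {x : Data} {v : QMem} (hv : v.Valid)
    {r : Data × QMem} (hr : r ∈ (A.run x v).support) {w : QMem}
    (hw : w ∈ (QMem.clear m r.2).support) : w.Valid ∧ w.Below m :=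
  QMem.below_of_mem_clear (A.valid_of_mem_run hv hr) hw

theorem QPT.ne_zero_of_mem_out (A : QPT) {m : ℕ} {x : Data} {v : QMem} (hv : v.Valid)
    {r : Data × Ket m} (hr : r ∈ (A.out m x v).support) : r.2 ≠ 0 := by
  rw [QPT.out, PMF.mem_support_bind_iff] at hr
  obtain ⟨s, hs, hr⟩ := hr
  rw [PMF.mem_support_map_iff] at hr
  obtain ⟨w, hw, rfl⟩ := hr
  obtain ⟨h1, h2⟩ := A.valid_of_mem_clear_run hv hs hw
  exact QMem.ket_ne_zero h2 h1

/-- The honest prover must cope with arbitrary messages. Replacing a message by the code of the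
string read from it makes the finite case distinction over strings total. -/
theorem computable_normalise (m : ℕ) : Computable fun d => ofBits (toBits m d) := by
  classical
  induction m with
  | zero => exact (Computable.const Data.nil).congr fun x v _ => by simp [ofBits, Data.ofList]
  | succ m ih =>
    have h := (Checkable.ne_nil Computable.id.fst).node (ih.comp Computable.id.snd)
    refine h.congr fun x v _ => ?_
    have h0 : toBits (m + 1) x 0 = decide (x.fst ≠ Data.nil) := by
      rw [toBits, decide_eq_decide]
      cases x <;> simp [Data.toList, Data.fst]
    have hs : ∀ i : Fin m, toBits (m + 1) x i.succ = toBits m x.snd i := by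
      intro i
      rw [toBits, toBits, decide_eq_decide]
      cases x <;> simp [Data.toList, Data.snd]
    simp only [ofBits, List.ofFn_succ, Data.ofList, h0, hs]
    congr

theorem sum_sq_load₂ {a n : ℕ} (ξ : Ket a) (φ : Ket n) :
    ∑ y : Bits (a + n), ‖ξ (fun i => y (Fin.castAdd n i)) * φ (fun i => y (Fin.natAdd a i))‖ ^ 2 =
      (∑ x, ‖ξ x‖ ^ 2) * ∑ y, ‖φ y‖ ^ 2 := by
  rw [← (Fin.appendEquiv a n).sum_comp, Fintype.sum_prod_type, Finset.sum_mul_sum]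
  refine Finset.sum_congr rfl fun x _ => Finset.sum_congr rfl fun y _ => ?_
  simp [Fin.appendEquiv, mul_pow]

theorem sum_sq_basisKet {n : ℕ} (x : Bits n) : ∑ y, ‖basisKet x y‖ ^ 2 = 1 := by
  rw [Finset.sum_eq_single x]
  · simp [basisKet]
  · intro y _ hy
    simp [basisKet, hy]
  · simp

/-- Preparing a state which depends on a classical string. -/
theorem feasible_prepare {m a : ℕ} {ξ : Ket m} (hξ : ∑ y, ‖ξ y‖ ^ 2 = 1) {h : Data → Data}
    (hh : Computable h) : ∃ F, Feasible False F ∧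
      ∀ x, F x QMem.vac = PMF.pure (x, QMem.load₂ ξ (basisKet (toBits a (h x)))) := by
  have hU : ∀ x : Bits a, ∃ U : Unitary (m + a),
      QMem.gate (U : Matrix (Bits (m + a)) (Bits (m + a)) ℂ) (fun i : Fin (m + a) => (i : ℕ))
        QMem.vac = QMem.load₂ ξ (basisKet x) := fun x => by
    rw [QMem.load₂_eq_load]
    exact exists_unitary_load _ (by rw [sum_sq_load₂, hξ, sum_sq_basisKet, one_mul])
  choose U hU using hU
  -- There is one hard-wired preparation unitary for each string of the fixed length `a`. The
  -- default case never occurs, because the string has been normalised.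
  refine ⟨_, Feasible.cases (ofBits_injective (n := a)) ((computable_normalise a).comp hh)
    (fun x => Feasible.gate_val (U x)) Feasible.id, fun x => ?_⟩
  rw [(partialInv_eq_some ofBits_injective).2 rfl]
  simp only [Option.elim_some, hU]

variable {G : Game Q} {E : QFHE} {n : ℕ} {P : OPad n (E.K n) (E.keyCode n)} {cd : Coding G}

theorem QStrat.sum_sq_ψ (S : QStrat G (QubitSpace n)) :
    ∑ y, ‖(S.ψ : QubitSpace n).ofLp y‖ ^ 2 = 1 := by
  rw [← EuclideanSpace.norm_sq_eq, S.norm_ψ, one_pow]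

/-- `QPT.out` discards the qubits from `n` on; here this is made part of the algorithm, by clearing
the memory after the evaluation and again after the pad. Nothing classical has to be kept for the
second stage, hence the final `nil`. -/
theorem honest_first_feasible (S : QStrat G (QubitSpace n)) : ∃ A : QPT, ∀ l t₁ t₂,
    A.run (Data.node (Data.unary l) (Data.node t₁ t₂)) QMem.vac =
      ((E.eval (measureCircuit cd S)).run (Data.node (Data.unary l) t₁.snd)
        (QMem.load₂ (S.ψ : QubitSpace n).ofLp (basisKet (toBits cd.ctxLen t₁.fst)))).bind fun r =>
          (QMem.clear n r.2).bind fun w => (P.enc.run t₂ w).bind fun s =>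
            (QMem.clear n s.2).map fun w' =>
              (Data.node r.1.fst (Data.node (Data.node r.1.snd s.1) Data.nil), w') := by
  obtain ⟨F, hF, hFv⟩ := feasible_prepare (a := cd.ctxLen) S.sum_sq_ψ Computable.id.snd.fst.fst
  have h1 := Feasible.seq (Feasible.weaken (Computable.id.fst.node Computable.id.snd.fst.snd))
    ((E.eval (measureCircuit cd S)).feasible.seq (Feasible.clear_const n))
  have h2 := Feasible.seq (Feasible.weaken Computable.id.fst.snd.snd)
    (P.enc.feasible.seq (Feasible.clear_const n))
  have h3 : Computable fun x => Data.node x.fst.snd.fst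
      (Data.node (Data.node x.fst.snd.snd x.snd) Data.nil) :=
    Computable.id.fst.snd.fst.node
      ((Computable.id.fst.snd.snd.node Computable.id.snd).node (Computable.const Data.nil))
  obtain ⟨A, hA⟩ := (hF.seq (h1.bind (h2.bind (Feasible.weaken h3)))).exists_qpt
  refine ⟨A, fun l t₁ t₂ => ?_⟩
  rw [hA _ _ QMem.valid_vac, hFv]
  simp only [PMF.pure_bind, PMF.bind_bind, PMF.bind_map, Function.comp_def, Data.fst_node,
    Data.snd_node]
  rfl

/-- There are finitely many questions and pads, so the measurement for each pair is hard-wired. The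
defaults copy those of `honest`: an unreadable key counts as 1, an unreadable question gets the
empty answer. -/
theorem honest_second_feasible (S : QStrat G (QubitSpace n)) : ∃ A : QPT, ∀ s t₅ t₆ w,
    w.Valid → w.Below n →
    (A.run (Data.node s (Data.node t₅ t₆)) w).map (fun r => (r.1.fst, r.1.snd)) =
      (honest G E P cd S).second (w.ket n) () t₅ t₆ := by
  choose F hF hFv using fun q k => feasible_answer S cd q (E.U n k)
  obtain ⟨A, hA⟩ := (Feasible.cases cd.que_inj Computable.id.snd.fst (fun q =>
    Feasible.cases (E.keyCode_inj n) Computable.id.snd.snd (fun k => hF q k) (hF q 1))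
    (Feasible.weaken (Computable.const (Data.node Data.nil Data.nil)))).exists_qpt
  refine ⟨A, fun s t₅ t₆ w hw hb => ?_⟩
  rw [hA _ _ hw]
  have key : ∀ q k, (F q k (Data.node s (Data.node t₅ t₆)) w).map (fun r => (r.1.fst, r.1.snd)) =
      (S.outcome (WithLp.toLp 2 (act (E.padMatrix n k).conjTranspose (w.ket n))) {q}).map
        fun a => (cd.ans (a ⟨q, Finset.mem_singleton_self q⟩), Data.nil) := by
    intro q k
    have h1 := congrArg (PMF.map fun d : Data => (d.fst, d.snd))
      (hFv q k (Data.node s (Data.node t₅ t₆)) w hw hb)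
    rw [PMF.map_comp, PMF.map_comp] at h1
    exact h1
  simp only [Data.snd_node, Data.fst_node, honest]
  cases hq : Function.partialInv cd.que t₅ with
  | none => simp [PMF.pure_map]
  | some q =>
    cases hk : Function.partialInv (E.keyCode n) t₆ with
    | none => exact key q 1
    | some k => exact key q k

theorem honest_first (S : QStrat G (QubitSpace n)) (l : ℕ) (u : Unit) (t₁ t₂ : Data) :
    (honest G E P cd S).first l u t₁ t₂ =
      ((E.eval (measureCircuit cd S)).out n (Data.node (Data.unary l) t₁.snd)
        (QMem.load₂ (S.ψ : QubitSpace n).ofLp (basisKet (toBits cd.ctxLen t₁.fst)))).bind fun r =>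
          (P.enc.out n t₂ (QMem.load r.2)).map fun s =>
            (r.1.fst, Data.node r.1.snd s.1, s.2) := rfl

theorem honest_behaviour (S : QStrat G (QubitSpace n)) (l : ℕ) (t₁ t₂ t₅ t₆ : Data) :
    (honest G E P cd S).behaviour l t₁ t₂ t₅ t₆ =
      ((E.eval (measureCircuit cd S)).out n (Data.node (Data.unary l) t₁.snd)
        (QMem.load₂ (S.ψ : QubitSpace n).ofLp (basisKet (toBits cd.ctxLen t₁.fst)))).bind fun r =>
          (P.enc.out n t₂ (QMem.load r.2)).bind fun s =>
            ((honest G E P cd S).second s.2 () t₅ t₆).map fun u =>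
              ((r.1.fst, Data.node r.1.snd s.1), u) := by
  rw [Prover.behaviour, honest_first]
  refine (PMF.bind_bind _ _ _).trans (congrArg _ (funext fun r => ?_))
  exact PMF.bind_map _ _ _

/-- `honest` stores an `n`-qubit vector and the algorithms act on the memory. A cleared memory is
determined by its first `n` qubits (`QMem.load_ket`), so both have the same behaviour. -/
theorem honest_isQPT (S : QStrat G (QubitSpace n)) : (honest G E P cd S).IsQPT := by
  obtain ⟨A₁, h₁⟩ := honest_first_feasible (E := E) (P := P) (cd := cd) S
  obtain ⟨A₂, h₂⟩ := honest_second_feasible (E := E) (P := P) (cd := cd) S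
  refine ⟨A₁, A₂, fun l t₁ t₂ t₅ t₆ => ?_⟩
  rw [honest_behaviour]
  simp only [Prover.behaviour, qptProver, h₁, PMF.bind_map, PMF.bind_bind, Function.comp_def,
    Data.fst_node, Data.snd_node]
  simp only [QPT.out, PMF.bind_map, PMF.bind_bind, Function.comp_def]
  refine bind_congr_support fun r hr => bind_congr_support fun w hw => ?_
  have hv : (QMem.load₂ (S.ψ : QubitSpace n).ofLp
      (basisKet (toBits cd.ctxLen t₁.fst))).Valid :=
    QMem.valid_load₂ (ofLp_ψ_ne_zero S) (basisKet_ne_zero _)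
  obtain ⟨h3, h4⟩ := QPT.valid_of_mem_clear_run _ hv hr hw
  rw [QMem.load_ket h4]
  refine bind_congr_support fun s hs => bind_congr_support fun w' hw' => ?_
  obtain ⟨h5, h6⟩ := QPT.valid_of_mem_clear_run _ h3 hs hw'
  rw [← h₂ Data.nil t₅ t₆ w' h5 h6, PMF.map_comp]

theorem expect_unit {α : Type*} (p : PMF α) {f : α → ℝ} (hf : IsUnit01 f) :
    0 ≤ expect p f ∧ expect p f ≤ 1 :=
  ⟨le_expect hf.isBdd fun a _ => (hf a).1, expect_le hf.isBdd fun a _ => (hf a).2⟩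

theorem Close.trans_eq {α : Type*} {ε : ℝ} {p p' q : PMF α} (h : Close ε p q) (e : p' = p) :
    Close ε p' q := e ▸ h

/-- Closeness of the joint distribution of `π a` and `s` extends to `a` and `s`, if `s` depends
only on `π a`. -/
theorem Close.refine {α β γ : Type*} {ε : ℝ} {p : PMF α} {π : α → β} {κ κ' : β → PMF γ}
    (h : Close ε (p.bind fun a => (κ (π a)).map fun s => (π a, s))
      (p.bind fun a => (κ' (π a)).map fun s => (π a, s)))
    {f : α → γ → ℝ} (hf : ∀ a, IsUnit01 (f a)) :
    |expect p (fun a => expect (κ (π a)) (f a)) - expect p fun a => expect (κ' (π a)) (f a)| ≤ ε := by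
  -- `g b` is an optimal test between `κ b` and `κ' b`. As the kernels see `a` only through `π a`,
  -- it does at least as well as each `f a`.
  choose g hg hgt using fun b => exists_tv_eq (κ b) (κ' b)
  have hu : IsUnit01 fun x : β × γ => g x.1 x.2 := fun x => hg _ _
  have h1 := (le_abs_self _).trans (h _ hu)
  simp only [expect_bind _ _ hu.isBdd, expect_map _ _ hu.isBdd] at h1
  have hk : ∀ κ : β → PMF γ, IsUnit01 fun a => expect (κ (π a)) (g (π a)) := fun κ =>
    isUnit01_expect fun a => hg (π a)
  have hk' : ∀ κ : β → PMF γ, IsUnit01 fun a => expect (κ (π a)) (f a) := fun κ =>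
    isUnit01_expect hf
  rw [← expect_sub _ (hk κ).isBdd (hk κ').isBdd] at h1
  rw [← expect_sub _ (hk' κ).isBdd (hk' κ').isBdd]
  refine le_trans ?_ h1
  have h2 : ∀ a, |expect (κ (π a)) (f a) - expect (κ' (π a)) (f a)| ≤
      expect (κ (π a)) (g (π a)) - expect (κ' (π a)) (g (π a)) := fun a => by
    rw [← hgt]
    exact close_of_abs_tsum_le le_rfl _ (hf a)
  rw [abs_le]
  constructor
  · rw [neg_le, ← expect_const_mul _ _ (-1) |>.trans (neg_one_mul _)]
    refine expect_mono (((hk' κ).isBdd.sub (hk' κ').isBdd).const_mul _)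
      ((hk κ).isBdd.sub (hk κ').isBdd) fun a _ => ?_
    rw [neg_one_mul]
    exact (neg_le_abs _).trans (h2 a)
  · exact expect_mono ((hk' κ).isBdd.sub (hk' κ').isBdd)
      ((hk κ).isBdd.sub (hk κ').isBdd) fun a _ => (le_abs_self _).trans (h2 a)

/-! ### The honest prover: removing the oblivious pad -/

section Honest

variable {G : Game Q} (E : QFHE) {n : ℕ} (P : OPad n (E.K n) (E.keyCode n)) (cd : Coding G)
  (S : QStrat G (QubitSpace n))

/-- The key which the verifier sends. -/
def sentKey (sk keys t₄ : Data) : E.K n := P.decFun keys.snd t₄.snd * E.decKeyFun sk n t₄.fst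

/-- The outcome of an execution. -/
def record (sk keys : Data) (C : G.contexts) (c t₃ t₄ : Data) (q : Q) (r : Data × Data) :
    CompiledState G × Transcript :=
  (⟨sk, keys.snd, C⟩, ⟨c, keys.fst, t₃, t₄, cd.que q, E.keyCode n (sentKey E P sk keys t₄),
    r.1, r.2, (compiled G E P cd).verdict (⟨sk, keys.snd, C⟩ : CompiledState G) (t₃, q) r.1 r.2⟩)

theorem record_accept (sk keys : Data) (C : G.contexts) (c t₃ t₄ : Data) (q : Q) (r : Data × Data) :
    (record E P cd sk keys C c t₃ t₄ q r).2.accept = true ↔ Accepts G E cd C q sk t₃ r.1 := by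
  simp only [record, compiled, decide_eq_true_iff]
  rfl

/-- A uniformly random question of a context. -/
def Game.ask (C : G.contexts) : PMF Q := PMF.uniformOfFinset C.1 (G.context_nonempty _ C.2)

theorem Game.mem_of_mem_ask {C : G.contexts} {q : Q} (h : q ∈ (Game.ask C).support) : q ∈ C.1 :=
  (PMF.mem_support_uniformOfFinset_iff _ _).1 h

/-- The answer to a question on the state `u`. -/
def answer (u : QubitSpace n) (q : Q) : PMF Data :=
  (S.outcome u {q}).map fun a => cd.ans (a ⟨q, Finset.mem_singleton_self q⟩)

/-- The result of the homomorphic measurement. -/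
def evalOut (l : ℕ) (c : Data) : PMF (Data × Ket n) :=
  (E.eval (measureCircuit cd S)).out n (Data.node (Data.unary l) c.snd)
    (QMem.load₂ (S.ψ : QubitSpace n).ofLp (basisKet (toBits cd.ctxLen c.fst)))

theorem honest_second (w : Ket n) (u : Unit) (q : Q) (k : E.K n) :
    (honest G E P cd S).second w u (cd.que q) (E.keyCode n k) =
      (answer cd S (WithLp.toLp 2 (act (E.padMatrix n k).conjTranspose w)) q).map
        fun a => (a, Data.nil) := by
  simp only [honest, (partialInv_eq_some cd.que_inj).2 rfl, answer, PMF.map_comp,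
    (partialInv_eq_some (E.keyCode_inj n)).2 rfl, Option.getD_some]
  rfl

/-- A normal form of executions against any party; the comparisons of executions start from it. -/
theorem exec_compiled (A : Party (CompiledState G)) (l : ℕ) :
    (compiled G E P cd).exec A l =
      (E.gen.run (Data.unary l)).bind fun sk => G.D.bind fun C =>
        (E.encBits sk (cd.ctx C.1)).bind fun c => (P.gen.run (Data.unary l)).bind fun keys =>
          (A.first l ⟨sk, keys.snd, C⟩ c keys.fst).bind fun m => (Game.ask C).bind fun q =>
            (A.second m.2.2 ⟨sk, keys.snd, C⟩ (cd.que q)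
              (E.keyCode n (sentKey E P sk keys m.2.1))).map fun r =>
                record E P cd sk keys C c m.1 m.2.1 q r := by
  simp only [Verifier.exec, compiled, PMF.bind_bind, PMF.bind_map, Function.comp_def]
  rfl

theorem exec_honest (l : ℕ) :
    (compiled G E P cd).exec ((honest G E P cd S).withInfo _) l =
      (E.gen.run (Data.unary l)).bind fun sk => G.D.bind fun C =>
        (E.encBits sk (cd.ctx C.1)).bind fun c => (P.gen.run (Data.unary l)).bind fun keys =>
          (evalOut E cd S l c).bind fun r => (P.enc.out n keys.fst (QMem.load r.2)).bind fun s =>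
            (Game.ask C).bind fun q =>
              (answer cd S (WithLp.toLp 2 (act (E.padMatrix n (sentKey E P sk keys
                (Data.node r.1.snd s.1))).conjTranspose s.2)) q).map fun a =>
                  record E P cd sk keys C c r.1.fst (Data.node r.1.snd s.1) q (a, Data.nil) := by
  have h : ∀ (sk keys c : Data) (C : G.contexts), ((honest G E P cd S).first l () c keys.fst).bind
      (fun m => (Game.ask C).bind fun q => ((honest G E P cd S).second m.2.2 () (cd.que q)
        (E.keyCode n (sentKey E P sk keys m.2.1))).map fun r =>
          record E P cd sk keys C c m.1 m.2.1 q r) =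
      (evalOut E cd S l c).bind fun r => (P.enc.out n keys.fst (QMem.load r.2)).bind fun s =>
        (Game.ask C).bind fun q =>
          (answer cd S (WithLp.toLp 2 (act (E.padMatrix n (sentKey E P sk keys
            (Data.node r.1.snd s.1))).conjTranspose s.2)) q).map fun a =>
              record E P cd sk keys C c r.1.fst (Data.node r.1.snd s.1) q (a, Data.nil) := by
    intro sk keys c C
    refine (PMF.bind_bind _ _ _).trans (congrArg _ (funext fun r => ?_))
    refine (PMF.bind_map _ _ _).trans (congrArg _ (funext fun s => congrArg _ (funext fun q => ?_)))
    refine (congrArg (fun p => PMF.map _ p) (honest_second E P cd S s.2 () q _)).trans ?_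
    rw [PMF.map_comp]
    rfl
  simp only [← h]
  exact exec_compiled E P cd ((honest G E P cd S).withInfo _) l

/-- The last steps of an execution in which the answer is obtained by measuring the state `u`. -/
def finish (l : ℕ) (sk : Data) (C : G.contexts) (c t₃ kh : Data) (u : QubitSpace n) :
    PMF (CompiledState G × Transcript) :=
  (Game.ask C).bind fun q => (answer cd S u q).bind fun a =>
    (P.gen.run (Data.unary l)).bind fun keys => (P.samp.run keys.fst).map fun s' =>
      record E P cd sk keys C c t₃ (Data.node kh s') q (a, Data.nil)

theorem conjTranspose_mul_self_unitary (U : Unitary n) :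
    (U : Matrix (Bits n) (Bits n) ℂ).conjTranspose * (U : Matrix (Bits n) (Bits n) ℂ) = 1 :=
  Matrix.mem_unitaryGroup_iff'.1 U.2

theorem mul_conjTranspose_self_unitary (U : Unitary n) :
    (U : Matrix (Bits n) (Bits n) ℂ).conjTranspose.conjTranspose *
      (U : Matrix (Bits n) (Bits n) ℂ).conjTranspose = 1 := by
  rw [Matrix.conjTranspose_conjTranspose]
  exact Matrix.mem_unitaryGroup_iff.1 U.2

/-- Removing the second pad. -/
theorem exists_act_padMatrix (k' k'' : E.K n) : ∃ z : ℂ, z ≠ 0 ∧ ∀ φ : Ket n,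
    act (E.padMatrix n (k' * k'')).conjTranspose (act (E.padMatrix n k') φ) =
      z • act (E.padMatrix n k'').conjTranspose φ := by
  obtain ⟨z, hz⟩ := E.U_mul n k' k''
  have h : ∀ φ : Ket n, act (E.padMatrix n (k' * k'')).conjTranspose (act (E.padMatrix n k') φ) =
      star z • act (E.padMatrix n k'').conjTranspose φ := by
    intro φ
    rw [QFHE.padMatrix, hz, act, act, act, Matrix.mulVec_mulVec, Matrix.conjTranspose_smul,
      Matrix.smul_mul, Matrix.smul_mulVec]
    congr 2
    rw [Submonoid.coe_mul, Matrix.conjTranspose_mul, Matrix.mul_assoc]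
    refine (congrArg _ (conjTranspose_mul_self_unitary (E.U n k'))).trans ?_
    rw [Matrix.mul_one]
    rfl
  -- Applied to a basis state, the left-hand side is a unitary image of a nonzero vector, so the
  -- factor cannot vanish.
  refine ⟨star z, fun h0 => ?_, h⟩
  have h1 := act_ne_zero (mul_conjTranspose_self_unitary (E.U n (k' * k'')))
    (act_ne_zero (conjTranspose_mul_self_unitary (E.U n k')) (basisKet_ne_zero fun _ => false))
  refine h1 ((h _).trans ?_)
  rw [h0, zero_smul]

theorem isEffect_answer {f : Q → Data → ℝ} (hf : ∀ q, IsUnit01 (f q)) (C : G.contexts) :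
    IsEffect fun φ : Ket n => expect (Game.ask C) fun q =>
      expect (answer cd S (WithLp.toLp 2 φ) q) (f q) := by
  refine IsEffect.uniform _ _ fun q _ => ?_
  simp only [answer, expect_map _ _ (hf q).isBdd]
  exact isEffect_outcome S (S.compatible_singleton q) (IsUnit01.comp (hf q) _)

/-- The honest prover after the homomorphic evaluation: the oblivious pad may be removed. -/
theorem hybrid (hP : P.Correct (E.U n)) (hPr : P.RangeSampling) : ∃ ε, Negligible ε ∧
    ∀ (l : ℕ) (sk : Data) (C : G.contexts) (c t₃ kh : Data) (φ : Ket n), φ ≠ 0 → Close (ε l)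
      ((P.gen.run (Data.unary l)).bind fun keys => (P.enc.out n keys.fst (QMem.load φ)).bind fun s =>
        (Game.ask C).bind fun q =>
          (answer cd S (WithLp.toLp 2 (act (E.padMatrix n (sentKey E P sk keys
            (Data.node kh s.1))).conjTranspose s.2)) q).map fun a =>
              record E P cd sk keys C c t₃ (Data.node kh s.1) q (a, Data.nil))
      (finish E P cd S l sk C c t₃ kh
        (WithLp.toLp 2 (act (E.padMatrix n (E.decKeyFun sk n kh)).conjTranspose φ))) := by
  obtain ⟨ε, hε, h1⟩ := hP
  obtain ⟨δ, hδ, h2⟩ := hPr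
  refine ⟨_, hε.add hδ, fun l sk C c t₃ kh φ hφ f hf => ?_⟩
  have h1 := h1 l φ hφ
  have h2 := h2 l φ hφ
  set real : PMF ((Data × Data) × Ket n) := (P.gen.run (Data.unary l)).bind fun keys =>
    (P.enc.out n keys.fst (QMem.load φ)).map fun r => ((keys, r.1), r.2) with hreal
  let F : Data × Data → Q → Data → ℝ := fun x q a =>
    f (record E P cd sk x.1 C c t₃ (Data.node kh x.2) q (a, Data.nil))
  have hF : ∀ x q, IsUnit01 (F x q) := fun x q a => hf _
  -- All that follows the pad is a family of effects on the padded state, indexed by the keys and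
  -- `s'`; trace closeness applies to such families.
  let g : Data × Data → Ket n → ℝ := fun x w => expect (Game.ask C) fun q =>
    expect (answer cd S (WithLp.toLp 2 (act (E.padMatrix n (sentKey E P sk x.1
      (Data.node kh x.2))).conjTranspose w)) q) (F x q)
  have hg : ∀ x, IsEffect (g x) := fun x =>
    (isEffect_answer cd S (hF x) C).act (mul_conjTranspose_self_unitary _)
  have hgu : ∀ x w, 0 ≤ g x w ∧ g x w ≤ 1 := fun x w =>
    expect_unit _ fun q => expect_unit _ (hF x q)
  have hgb : IsBdd fun r : (Data × Data) × Ket n => g r.1 r.2 := IsUnit01.isBdd fun r => hgu _ _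
  have hne : ∀ r ∈ real.support, r.2 ≠ 0 := by
    intro r hr
    rw [hreal, PMF.mem_support_bind_iff] at hr
    obtain ⟨keys, _, hr⟩ := hr
    rw [PMF.mem_support_map_iff] at hr
    obtain ⟨s, hs, rfl⟩ := hr
    exact P.enc.ne_zero_of_mem_out (QMem.valid_load hφ) hs
  have e1 : expect ((P.gen.run (Data.unary l)).bind fun keys =>
      (P.enc.out n keys.fst (QMem.load φ)).bind fun s => (Game.ask C).bind fun q =>
          (answer cd S (WithLp.toLp 2 (act (E.padMatrix n (sentKey E P sk keys
            (Data.node kh s.1))).conjTranspose s.2)) q).map fun a =>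
              record E P cd sk keys C c t₃ (Data.node kh s.1) q (a, Data.nil)) f =
      expect real fun r => g r.1 r.2 := by
    simp only [hreal, expect_bind _ _ hf.isBdd, expect_map _ _ hf.isBdd, expect_bind _ _ hgb,
      expect_map _ _ hgb]
    rfl
  let g' : Data × Data → ℝ := fun x => expect (Game.ask C) fun q =>
    expect (answer cd S (WithLp.toLp 2 (act (E.padMatrix n (E.decKeyFun sk n kh)).conjTranspose φ))
      q) (F x q)
  have hg' : IsUnit01 g' := fun x => expect_unit _ fun q => expect_unit _ (hF x q)
  -- For the exactly padded state `U k' φ` the key `k'k''` cancels `k'` up to a scalar, and the test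
  -- no longer depends on the output state of the pad.
  have e2 : expect (real.map fun r => (r.1, act (E.U n (P.decFun r.1.1.snd r.1.2) : Matrix _ _ ℂ) φ))
      (fun r => g r.1 r.2) = expect real fun r => g' r.1 := by
    rw [expect_map _ _ hgb]
    refine expect_congr fun r _ => ?_
    obtain ⟨z, hz, h⟩ := exists_act_padMatrix E (P.decFun r.1.1.snd r.1.2) (E.decKeyFun sk n kh)
    have h4 := (isEffect_answer cd S (hF r.1) C).smul hz
      (act_ne_zero (mul_conjTranspose_self_unitary (E.U n (E.decKeyFun sk n kh))) hφ)
    have hk : sentKey E P sk r.1.1 (Data.node kh r.1.2) =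
      P.decFun r.1.1.snd r.1.2 * E.decKeyFun sk n kh := rfl
    have hp : act (E.U n (P.decFun r.1.1.snd r.1.2) : Matrix _ _ ℂ) φ =
      act (E.padMatrix n (P.decFun r.1.1.snd r.1.2)) φ := rfl
    simp only [g, hk, hp, h φ]
    exact h4
  have e3 : expect real (fun r => g' r.1) = expect (P.gen.run (Data.unary l)) fun keys =>
      expect ((P.enc.out n keys.fst (QMem.load φ)).map Prod.fst) fun s => g' (keys, s) := by
    have hb : IsBdd fun r : (Data × Data) × Ket n => g' r.1 := (hg'.comp _).isBdd
    simp only [hreal, expect_bind _ _ hb, expect_map _ _ hb]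
    refine expect_congr fun keys _ => ?_
    rw [expect_map _ _ (hg'.comp _).isBdd]
  have e4 : expect (finish E P cd S l sk C c t₃ kh (WithLp.toLp 2
      (act (E.padMatrix n (E.decKeyFun sk n kh)).conjTranspose φ))) f =
      expect (P.gen.run (Data.unary l)) fun keys => expect (P.samp.run keys.fst) fun s =>
        g' (keys, s) := by
    have hK : ∀ f : Data × Data → ℝ, IsUnit01 f → expect ((P.gen.run (Data.unary l)).bind fun keys =>
        (P.samp.run keys.fst).map fun s => (keys, s)) f = expect (P.gen.run (Data.unary l)) fun keys =>
          expect (P.samp.run keys.fst) fun s => f (keys, s) := fun f hf => by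
      simp only [expect_bind _ _ hf.isBdd, expect_map _ _ hf.isBdd]
    rw [← hK g' hg', expect_comm_unit]
    · simp only [finish, expect_bind _ _ hf.isBdd, expect_map _ _ hf.isBdd]
      refine expect_congr fun q _ => ?_
      exact (expect_congr fun a _ => (hK _ fun x => hF x q a).symm).trans
        (expect_comm_unit _ _ fun a x => hF x q a)
    · exact fun x q => expect_unit _ (hF x q)
  have h3 := h1.abs_sub_le hne (fun r hr => by
    rw [PMF.mem_support_map_iff] at hr
    obtain ⟨s, _, rfl⟩ := hr
    exact act_ne_zero (conjTranspose_mul_self_unitary _) hφ) hg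
  -- Range sampling controls `s'` only jointly with `pk`, while the verdict and the key also involve
  -- the secret pad key. This is harmless because `s'` is produced from `pk` alone.
  have h4 := Close.refine (p := P.gen.run (Data.unary l)) (π := Data.fst)
    (κ := fun pk => P.samp.run pk) (κ' := fun pk => (P.enc.out n pk (QMem.load φ)).map Prod.fst)
    (ε := δ l) (by
      simp only [PMF.map_comp]
      exact close_of_abs_tsum_le h2) (f := fun keys s => g' (keys, s)) fun keys => hg'.comp _
  rw [e1, e4]
  rw [e2, e3] at h3
  rw [abs_sub_comm] at h4
  exact (abs_sub_le _ _ _).trans (add_le_add h3 h4)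

end Honest

/-! ### Global phases and classical ciphertexts -/

theorem sum_sq_act {n : ℕ} {V : Matrix (Bits n) (Bits n) ℂ} (hV : V.conjTranspose * V = 1)
    (φ : Ket n) : ∑ x, ‖act V φ x‖ ^ 2 = ∑ x, ‖φ x‖ ^ 2 := by
  have : ((∑ x, ‖act V φ x‖ ^ 2 : ℝ) : ℂ) = ((∑ x, ‖φ x‖ ^ 2 : ℝ) : ℂ) := by
    rw [← dotProduct_star_self, ← dotProduct_star_self, act, Matrix.star_mulVec,
      Matrix.dotProduct_mulVec, Matrix.vecMul_vecMul, hV, Matrix.vecMul_one]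
  exact_mod_cast this

theorem QPT.out_smul (A : QPT) (m : ℕ) (x : Data) {z : ℂ} (hz : ‖z‖ = 1) (v : QMem) :
    A.out m x (z • v) = (A.out m x v).map fun r => (r.1, z • r.2) := by
  have h := A.run_map (h := (z • ·)) (Or.inr ⟨z, hz, rfl⟩) x v
  beta_reduce at h
  simp only [QPT.out, h, PMF.bind_map, PMF.map_bind, Function.comp_def, QMem.clear_smul hz,
    PMF.map_comp]
  rfl

theorem QMem.load₂_smul {a n : ℕ} (ξ : Ket a) (z : ℂ) (φ : Ket n) :
    load₂ ξ (z • φ) = z • load₂ ξ φ := by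
  funext S
  simp only [load₂, Pi.smul_apply, smul_eq_mul]
  split_ifs <;> ring

namespace QFHE

variable (E : QFHE)

/-- Pads act on basis states up to a phase. -/
theorem exists_phase (m : ℕ) (k : E.K m) (x : Bits m) : ∃ z : ℂ, ‖z‖ = 1 ∧
    act (E.padMatrix m k) (basisKet x) = z • basisKet (E.perm m k x) := by
  obtain ⟨z, hz⟩ := E.U_basis m k x
  refine ⟨z, ?_, hz⟩
  have h := sum_sq_act (conjTranspose_mul_self_unitary (E.U m k)) (basisKet x)
  rw [hz, sum_sq_basisKet] at h
  simp only [Pi.smul_apply, norm_smul, mul_pow, ← Finset.mul_sum, sum_sq_basisKet, mul_one] at h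
  nlinarith [norm_nonneg z]

/-- A phase of the input does not matter for the homomorphic evaluation. -/
theorem out_eval_basis {a m : ℕ} (C : Circuit a m) (l : ℕ) (k : E.K m) (kh : Data) (ξ : Ket a)
    (x : Bits m) : ∃ z : ℂ, ‖z‖ = 1 ∧ E.evalState C l k kh ξ (basisKet x) =
      ((E.eval C).out C.qbits (Data.node (Data.unary l) kh)
        (QMem.load₂ ξ (basisKet (E.perm m k x)))).map fun r => ((r.1.fst, r.1.snd), z • r.2) := by
  obtain ⟨z, hz, h⟩ := E.exists_phase m k x
  refine ⟨z, hz, ?_⟩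
  rw [evalState, h, QMem.load₂_smul, QPT.out_smul _ _ _ hz, PMF.map_comp]
  rfl

end QFHE

section Honest

variable {G : Game Q} (E : QFHE) {n : ℕ} (P : OPad n (E.K n) (E.keyCode n)) (cd : Coding G)
  (S : QStrat G (QubitSpace n))

/-- The homomorphic measurement of an encrypted context. -/
def evalMeasure (l : ℕ) (k : E.K cd.ctxLen × Data) (C : Finset Q) :
    PMF ((Data × Data) × Ket n) :=
  E.evalState (measureCircuit cd S) l k.1 k.2 (S.ψ : QubitSpace n).ofLp (basisKet (cd.ctx C))

/-- An encrypted context. -/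
def ctxCipher (k : E.K cd.ctxLen × Data) (C : Finset Q) : Data :=
  Data.node (ofBits (E.perm cd.ctxLen k.1 (cd.ctx C))) k.2

/-- The prover evaluates on the classical string `perm k x`, while the assumptions on the scheme
concern `U k |x⟩`. The two inputs differ by a phase, which passes through the algorithm to its
output state, so a continuation that ignores phases cannot tell them apart. -/
theorem evalOut_bind {α : Type*} (l : ℕ) (k : E.K cd.ctxLen × Data) (C : Finset Q)
    {R : Data → Data → Ket n → PMF α}
    (hR : ∀ c kh φ (z : ℂ), ‖z‖ = 1 → R c kh (z • φ) = R c kh φ) :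
    ((evalOut E cd S l (ctxCipher E cd k C)).bind fun r => R r.1.fst r.1.snd r.2) =
      (evalMeasure E cd S l k C).bind fun r => R r.1.1 r.1.2 r.2 := by
  obtain ⟨z, hz, h⟩ := E.out_eval_basis (measureCircuit cd S) l k.1 k.2
    (S.ψ : QubitSpace n).ofLp (cd.ctx C)
  have h' : evalMeasure E cd S l k C = (evalOut E cd S l (ctxCipher E cd k C)).map fun r =>
      ((r.1.fst, r.1.snd), z • r.2) := by
    rw [evalOut, ctxCipher, Data.fst_node, toBits_ofBits, Data.snd_node]
    exact h
  rw [h', PMF.bind_map]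
  simp only [Function.comp_def, hR _ _ _ z hz]

/-- The encrypted post-measurement state, decrypted. -/
def decrypted (sk kh : Data) (φ : Ket n) : QubitSpace n :=
  WithLp.toLp 2 (act (E.padMatrix n (E.decKeyFun sk n kh)).conjTranspose φ)

theorem decrypted_smul (sk kh : Data) (z : ℂ) (φ : Ket n) :
    decrypted E sk kh (z • φ) = z • decrypted E sk kh φ := by
  rw [decrypted, act, Matrix.mulVec_smul]
  rfl

theorem answer_smul {z : ℂ} (hz : ‖z‖ = 1) (u : QubitSpace n) (q : Q) :
    answer cd S (z • u) q = answer cd S u q := by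
  rw [answer, answer, S.outcome_smul hz]

theorem finish_smul (l : ℕ) (sk : Data) (C : G.contexts) (c t₃ kh : Data) {z : ℂ} (hz : ‖z‖ = 1)
    (u : QubitSpace n) : finish E P cd S l sk C c t₃ kh (z • u) =
      finish E P cd S l sk C c t₃ kh u := by
  simp only [finish, answer_smul cd S hz]

/-- The execution with the honest prover, without the oblivious pad. -/
def hybridExec (l : ℕ) : PMF (CompiledState G × Transcript) :=
  (E.gen.run (Data.unary l)).bind fun sk => G.D.bind fun C => (E.pad sk cd.ctxLen).bind fun k =>
    (evalMeasure E cd S l k C.1).bind fun r =>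
      finish E P cd S l sk C (ctxCipher E cd k C.1) r.1.1 r.1.2 (decrypted E sk r.1.2 r.2)

theorem ne_zero_of_mem_evalOut {l : ℕ} {c : Data} {r : Data × Ket n}
    (hr : r ∈ (evalOut E cd S l c).support) : r.2 ≠ 0 :=
  QPT.ne_zero_of_mem_out _ (QMem.valid_load₂ (ofLp_ψ_ne_zero S) (basisKet_ne_zero _)) hr

/-- Drawing the pad keys after the evaluation brings the execution into the form treated by
`hybrid`. The error there is uniform in the nonzero state, so it survives averaging over the results
of the evaluation. -/
theorem exec_honest_close (hE : E.WellFormed) (hP : P.Correct (E.U n)) (hPr : P.RangeSampling) :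
    ∃ ε, Negligible ε ∧ ∀ l, Close (ε l) ((compiled G E P cd).exec ((honest G E P cd S).withInfo _) l)
      (hybridExec E P cd S l) := by
  obtain ⟨ε, hε, h⟩ := hybrid E P cd S hP hPr
  refine ⟨ε, hε, fun l => ?_⟩
  have e : hybridExec E P cd S l = (E.gen.run (Data.unary l)).bind fun sk => G.D.bind fun C =>
      (E.encBits sk (cd.ctx C.1)).bind fun c => (evalOut E cd S l c).bind fun r =>
        finish E P cd S l sk C c r.1.fst r.1.snd (decrypted E sk r.1.snd r.2) := by
    refine bind_congr_support fun sk hsk => congrArg _ (funext fun C => ?_)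
    rw [hE.encBits_eq l sk hsk, PMF.bind_map]
    refine congrArg _ (funext fun k => ?_)
    refine (evalOut_bind E cd S l k C.1 (R := fun c kh φ =>
      finish E P cd S l sk C (ctxCipher E cd k C.1) c kh (decrypted E sk kh φ)) ?_).symm
    intro c kh φ z hz
    rw [decrypted_smul, finish_smul E P cd S _ _ _ _ _ _ hz]
  rw [e]
  refine Close.trans_eq ?_ (exec_honest E P cd S l)
  refine Close.bind_left fun sk _ => Close.bind_left fun C _ => Close.bind_left fun c _ => ?_
  rw [PMF.bind_comm]
  exact Close.bind_left fun r hr => h l sk C c r.1.fst r.1.snd r.2 (ne_zero_of_mem_evalOut E cd S hr)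

end Honest

/-! ### Completeness -/

section Honest

variable {G : Game Q} (E : QFHE) {n : ℕ} (P : OPad n (E.K n) (E.keyCode n)) (cd : Coding G)
  (S : QStrat G (QubitSpace n))

theorem answer_eigen {R : Finset Q} {a : R → G.A} {u : QubitSpace n} (hu : u ≠ 0)
    (hua : u ∈ S.eigen R a) {q : Q} (hq : q ∈ R) :
    answer cd S u q = PMF.pure (cd.ans (a ⟨q, hq⟩)) := by
  rw [answer, S.outcome_eigen hu hua hq, PMF.pure_map]

/-- Decryption of the result of the homomorphic measurement. -/
def decMeasured (sk : Data) (r : (Data × Data) × Ket n) : Data × Ket n :=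
  (E.decFun sk r.1.1, act (E.padMatrix n (E.decKeyFun sk n r.1.2)).conjTranspose r.2)

theorem QFHE.ne_zero_of_mem_evalState {a m : ℕ} {C : Circuit a m} {l : ℕ} {k : E.K m} {kh : Data}
    {ξ : Ket a} {φ : Ket m} (hξ : ξ ≠ 0) (hφ : φ ≠ 0) {r : (Data × Data) × Ket C.qbits}
    (hr : r ∈ (E.evalState C l k kh ξ φ).support) : r.2 ≠ 0 := by
  obtain ⟨s, hs, rfl⟩ := (PMF.mem_support_map_iff _ _ _).1 hr
  exact QPT.ne_zero_of_mem_out _ (QMem.valid_load₂ hξ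
    (act_ne_zero (conjTranspose_mul_self_unitary _) hφ)) hs

theorem ne_zero_of_mem_evalMeasure {l : ℕ} {k : E.K cd.ctxLen × Data} {C : Finset Q}
    {r : (Data × Data) × Ket n} (hr : r ∈ (evalMeasure E cd S l k C).support) : r.2 ≠ 0 :=
  E.ne_zero_of_mem_evalState (ofLp_ψ_ne_zero S) (basisKet_ne_zero _) hr

theorem act_conjTranspose_ne_zero (k : E.K n) {φ : Ket n} (h : φ ≠ 0) :
    act (E.padMatrix n k).conjTranspose φ ≠ 0 :=
  act_ne_zero (mul_conjTranspose_self_unitary _) h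

theorem ofLp_proj_ne_zero {C : Finset Q} (hC : C ∈ G.contexts) {a : C → G.A}
    (ha : a ∈ (S.outcome S.ψ C).support) : (S.proj C a S.ψ).ofLp ≠ 0 := fun h =>
  (S.mem_support_outcome (S.compatible_context hC) S.ψ_ne_zero).1 ha
    ((WithLp.ofLp_injective 2) h)

/-- The homomorphic measurement is correct. -/
theorem evalMeasure_correct (hEc : E.Correct) : ∃ ε, Negligible ε ∧
    ∀ l sk, E.IsKey l sk → ∀ k ∈ (E.pad sk cd.ctxLen).support, ∀ C ∈ G.contexts,
      ∀ g : Data → Ket n → ℝ, (∀ d, IsEffect (g d)) → (∀ d φ, 0 ≤ g d φ ∧ g d φ ≤ 1) →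
        |expect (evalMeasure E cd S l k C) (fun r =>
            g (decMeasured E sk r).1 (decMeasured E sk r).2) -
          expect (S.outcome S.ψ C) fun a =>
            g (ofBits (cd.vec C a)) (S.proj C a S.ψ).ofLp| ≤ ε l := by
  obtain ⟨ε, hε, h⟩ := hEc (measureCircuit cd S) (isCircuit_measureCircuit cd S)
  refine ⟨ε, hε, fun l sk hsk k hk C hC g hg hgu => ?_⟩
  have h1 : TraceClose (ε l) ((evalMeasure E cd S l k C).map (decMeasured E sk))
      ((S.outcome S.ψ C).map fun a => (ofBits (cd.vec C a), (S.proj C a S.ψ).ofLp)) := by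
    have h2 := h l sk hsk k hk _ (basisKet (cd.ctx C)) (ofLp_ψ_ne_zero S) (basisKet_ne_zero _)
    have h3 : ((S.outcome S.ψ C).map fun a => (ofBits (cd.vec C a), (S.proj C a S.ψ).ofLp)) =
        ((S.outcome S.ψ C).map fun a => (cd.vec C a, (S.proj C a S.ψ).ofLp)).map
          fun s => (ofBits s.1, s.2) := by
      rw [PMF.map_comp]
      rfl
    rw [h3, ← measureCircuit_apply cd S hC]
    exact h2
  have hb : IsBdd fun r : Data × Ket n => g r.1 r.2 := IsUnit01.isBdd fun r => hgu _ _
  have h4 := h1.abs_sub_le (fun r hr => ?_) (fun r hr => ?_) hg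
  · rw [expect_map _ _ hb, expect_map _ _ hb] at h4
    exact h4
  · obtain ⟨s, hs, rfl⟩ := (PMF.mem_support_map_iff _ _ _).1 hr
    exact act_conjTranspose_ne_zero E _ (ne_zero_of_mem_evalMeasure E cd S hs)
  · obtain ⟨s, hs, rfl⟩ := (PMF.mem_support_map_iff _ _ _).1 hr
    exact ofLp_proj_ne_zero S hC hs

/-- The probability that an answer measured on `φ` is accepted along with the vector of answers
encoded by `d`. -/
def accProb (C : G.contexts) (d : Data) (φ : Ket n) : ℝ :=
  expect (Game.ask C) fun q => Pr (answer cd S (WithLp.toLp 2 φ) q) fun x =>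
    ∃ a : C.1 → G.A, ofBits (cd.vec C.1 a) = d ∧ G.pred C.1 a = true ∧
      ∃ h : q ∈ C.1, cd.ans (a ⟨q, h⟩) = x

/-- The post-measurement state is a joint eigenvector, so measuring any `q ∈ C` again returns `a[q]`
with certainty. The consistency check never fails, and the verdict is the predicate. -/
theorem accProb_proj (C : G.contexts) {a : C.1 → G.A} (ha : a ∈ (S.outcome S.ψ C.1).support) :
    accProb cd S C (ofBits (cd.vec C.1 a)) (S.proj C.1 a S.ψ).ofLp =
      if G.pred C.1 a then 1 else 0 := by
  classical
  have h0 : S.proj C.1 a S.ψ ≠ 0 :=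
    (S.mem_support_outcome (S.compatible_context C.2) S.ψ_ne_zero).1 ha
  refine Eq.trans (expect_congr (g := fun _ => if G.pred C.1 a then (1 : ℝ) else 0) ?_)
    (expect_const _ _)
  intro q hq
  have hq := Game.mem_of_mem_ask hq
  rw [WithLp.toLp_ofLp, answer_eigen cd S h0 (S.proj_mem _ _ _) hq, Pr_pure]
  refine if_congr ⟨?_, fun h => ⟨a, rfl, h, hq, rfl⟩⟩ rfl rfl
  rintro ⟨b, hb, hp, _⟩
  rwa [← cd.vec_inj C.1 C.2 (ofBits_injective hb)]

theorem accProb_unit (C : G.contexts) (d : Data) (φ : Ket n) :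
    0 ≤ accProb cd S C d φ ∧ accProb cd S C d φ ≤ 1 :=
  expect_unit _ fun _ => ⟨Pr_nonneg _ _, Pr_le_one _ _⟩

theorem isEffect_accProb (C : G.contexts) (d : Data) : IsEffect (accProb cd S C d) := by
  classical
  let e : Q → Data → Prop := fun q x => ∃ a : C.1 → G.A, ofBits (cd.vec C.1 a) = d ∧
    G.pred C.1 a = true ∧ ∃ h : q ∈ C.1, cd.ans (a ⟨q, h⟩) = x
  have h := isEffect_answer cd S (fun q => isUnit01_ite (e q)) C
  simp only [← Pr_eq_expect] at h
  exact h

theorem expect_outcome_pred : (expect G.D fun C => expect (S.outcome S.ψ C.1) fun a =>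
    if G.pred C.1 a then (1 : ℝ) else 0) = S.val := by
  rw [expect_fintype, QStrat.val, Game.val]
  refine Finset.sum_congr rfl fun C _ => ?_
  rw [S.expect_outcome (S.compatible_context C.2) S.ψ_ne_zero, S.norm_ψ, one_pow, div_one,
    Finset.mul_sum]
  refine Finset.sum_congr rfl fun a _ => ?_
  rw [QStrat.strat]
  split_ifs <;> ring

/-- The verdict involves neither the pad keys nor `s'`, so these average out. -/
theorem Pr_finish_accept (l : ℕ) (sk : Data) (C : G.contexts) (c t₃ kh : Data) (φ : Ket n) :
    Pr (finish E P cd S l sk C c t₃ kh (WithLp.toLp 2 φ)) (fun r => r.2.accept = true) =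
      accProb cd S C (E.decFun sk t₃) φ := by
  classical
  rw [finish, Pr_bind, accProb]
  refine expect_congr fun q _ => ?_
  rw [Pr_bind, Pr_eq_expect]
  refine expect_congr fun a _ => ?_
  simp only [Pr_bind, Pr_map, record_accept, Accepts]
  have h : ∀ (e : Prop) (keys : Data), Pr (P.samp.run keys.fst) (fun _ => e) =
      if e then 1 else 0 := fun e keys => by rw [Pr_eq_expect, expect_const]
  simp only [h, expect_const]

/-- The honest prover reaches the value of the strategy. -/
theorem winProb_honest_close (hE : E.WellFormed) (hEc : E.Correct) (hP : P.Correct (E.U n))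
    (hPr : P.RangeSampling) : ∃ ε, Negligible ε ∧ ∀ l,
      |(compiled G E P cd).winProb ((honest G E P cd S).withInfo _) l - S.val| ≤ ε l := by
  classical
  obtain ⟨ε, hε, h1⟩ := exec_honest_close E P cd S hE hP hPr
  obtain ⟨δ, hδ, h2⟩ := evalMeasure_correct E cd S hEc
  refine ⟨_, hε.add hδ, fun l => ?_⟩
  have h3 := (h1 l).abs_Pr_sub_le fun r => r.2.accept = true
  have e1 : (compiled G E P cd).winProb ((honest G E P cd S).withInfo _) l =
      Pr ((compiled G E P cd).exec ((honest G E P cd S).withInfo _) l)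
        fun r => r.2.accept = true := by
    rw [Verifier.winProb, Verifier.transcript, Pr_map]
  rw [e1]
  refine (abs_sub_le _ _ _).trans (add_le_add h3 ?_)
  have e2 : Pr (hybridExec E P cd S l) (fun r => r.2.accept = true) =
      expect (E.gen.run (Data.unary l)) fun sk => expect G.D fun C =>
        expect (E.pad sk cd.ctxLen) fun k => expect (evalMeasure E cd S l k C.1) fun r =>
          accProb cd S C (decMeasured E sk r).1 (decMeasured E sk r).2 := by
    simp only [hybridExec, Pr_bind, decrypted, Pr_finish_accept]
    rfl
  let F : Data → G.contexts → E.K cd.ctxLen × Data → ℝ := fun sk C k =>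
    expect (evalMeasure E cd S l k C.1) fun r =>
      accProb cd S C (decMeasured E sk r).1 (decMeasured E sk r).2
  have hF : ∀ sk C, IsUnit01 (F sk C) := fun sk C k =>
    expect_unit _ fun r => accProb_unit cd S _ _ _
  have hF' : ∀ sk, IsUnit01 fun C => expect (E.pad sk cd.ctxLen) (F sk C) := fun sk C =>
    expect_unit _ (hF sk C)
  have hF'' : IsUnit01 fun sk => expect G.D fun C => expect (E.pad sk cd.ctxLen) (F sk C) :=
    fun sk => expect_unit _ (hF' sk)
  have hI : IsUnit01 fun C : G.contexts => expect (S.outcome S.ψ C.1) fun a =>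
      if G.pred C.1 a then (1 : ℝ) else 0 := fun C => expect_unit _ fun a => by
    split_ifs <;> simp
  refine le_of_eq_of_le (congrArg (fun x => |x - S.val|) e2) ?_
  rw [← expect_const (E.gen.run (Data.unary l)) S.val]
  refine abs_expect_sub_le hF''.isBdd (isBdd_const _) fun sk hsk => ?_
  rw [← expect_outcome_pred S]
  refine abs_expect_sub_le (hF' sk).isBdd hI.isBdd fun C _ => ?_
  rw [← expect_const (E.pad sk cd.ctxLen) (expect (S.outcome S.ψ C.1) _)]
  refine abs_expect_sub_le (hF sk C).isBdd (isBdd_const _) fun k hk => ?_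
  have h4 := h2 l sk hsk k hk C.1 C.2 (accProb cd S C) (isEffect_accProb cd S C)
    (accProb_unit cd S C)
  rwa [expect_congr fun a ha => accProb_proj cd S C ha] at h4

end Honest

/-- The test whether a state is `φ`. -/
theorem exists_stateTest {n : ℕ} {φ : Ket n} (hφ : φ ≠ 0) : ∃ g : Ket n → ℝ, IsEffect g ∧
    (∀ χ, 0 ≤ g χ ∧ g χ ≤ 1) ∧ (∀ z : ℂ, z ≠ 0 → g (z • φ) = 1) ∧
    ∀ χ, χ ≠ 0 → g χ = 1 → ∃ z : ℂ, χ = z • φ := by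
  let c : ℝ := (∑ x, ‖φ x‖ ^ 2)⁻¹
  have hs := sum_sq_pos hφ
  let N : Matrix (Bits n) (Bits n) ℂ := Matrix.vecMulVec φ (star φ)
  let M : Matrix (Bits n) (Bits n) ℂ := (c : ℂ) • N
  have hN : N.PosSemidef := Matrix.posSemidef_vecMulVec_self_star φ
  have hM : M.PosSemidef := posSemidef_ofReal_smul hN (by positivity)
  have hNN : N * N = ((∑ x, ‖φ x‖ ^ 2 : ℝ) : ℂ) • N := by
    simp only [N]
    rw [Matrix.vecMulVec_mul_vecMulVec, dotProduct_star_self]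
    ext i j
    simp only [Matrix.vecMulVec_apply, Matrix.smul_apply, Pi.smul_apply, smul_eq_mul]
    ring
  have hMM : M * M = M := by
    have : (c : ℂ) * ((∑ x, ‖φ x‖ ^ 2 : ℝ) : ℂ) = 1 := by
      rw [← Complex.ofReal_mul, inv_mul_cancel₀ hs.ne', Complex.ofReal_one]
    simp only [M]
    rw [Matrix.smul_mul, Matrix.mul_smul, hNN, smul_smul, smul_smul, mul_assoc, this, mul_one]
  -- `1 - M` is an orthogonal projection. This makes `M` an effect, and it turns `⟨χ, (1 - M) χ⟩ =
  -- 0` into `(1 - M) χ = 0` when the test passes with certainty.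
  have hP : (1 - M).conjTranspose * (1 - M) = 1 - M := by
    rw [Matrix.conjTranspose_sub, Matrix.conjTranspose_one, hM.1, mul_sub, sub_mul, sub_mul, hMM]
    simp
  have hE : Effect M := ⟨hM, hP ▸ Matrix.posSemidef_conjTranspose_mul_self (1 - M)⟩
  have hMv : ∀ χ, M.mulVec χ = ((c : ℂ) * dotProduct (star φ) χ) • φ := by
    intro χ
    simp only [M, N]
    rw [Matrix.smul_mulVec, Matrix.vecMulVec_mulVec, mul_smul]
    congr 1
    ext i
    simp [mul_comm]
  have hMφ : M.mulVec φ = φ := by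
    rw [hMv, dotProduct_star_self, ← Complex.ofReal_mul, inv_mul_cancel₀ hs.ne',
      Complex.ofReal_one, one_smul]
  refine ⟨effectProb M, ⟨M, hE, fun _ _ => rfl⟩, fun χ => ?_, fun z hz => ?_, fun χ hχ h => ?_⟩
  · by_cases h : χ = 0
    · simp [effectProb, h]
    · exact hE.unit h
  · rw [effectProb_smul _ hz, effectProb, hMφ, dotProduct_star_self, Complex.ofReal_re,
      div_self hs.ne']
  · have h1 : dotProduct (star χ) ((1 - M).mulVec χ) =
        ((∑ x, ‖(1 - M).mulVec χ x‖ ^ 2 : ℝ) : ℂ) := by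
      rw [← dotProduct_star_self, Matrix.star_mulVec, ← Matrix.dotProduct_mulVec,
        Matrix.mulVec_mulVec, hP]
    have h2 : (dotProduct (star χ) ((1 - M).mulVec χ)).re = 0 := by
      rw [effectProb, div_eq_one_iff_eq (sum_sq_pos hχ).ne'] at h
      rw [Matrix.sub_mulVec, Matrix.one_mulVec, dotProduct_sub, dotProduct_star_self,
        Complex.sub_re, h, Complex.ofReal_re, sub_self]
    have h3 : (1 - M).mulVec χ = 0 := by
      by_contra h0
      have := sum_sq_pos h0
      rw [h1, Complex.ofReal_re] at h2
      exact this.ne' h2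
    rw [Matrix.sub_mulVec, Matrix.one_mulVec, sub_eq_zero, hMv] at h3
    exact ⟨_, h3⟩

/-! ### Fresh encryptions decrypt correctly -/

namespace QFHE

variable (E : QFHE)

theorem ne_zero_of_mem_encBoth {c m : ℕ} {sk : Data} {p : PMF (Bits c × Ket m)}
    (hp : ∀ r ∈ p.support, r.2 ≠ 0) {s : (Data × Data) × Ket m}
    (hs : s ∈ (p.bind (E.encBoth sk)).support) : s.2 ≠ 0 := by
  obtain ⟨r, hr, hs⟩ := (PMF.mem_support_bind_iff _ _ _).1 hs
  obtain ⟨x, _, hs⟩ := (PMF.mem_support_bind_iff _ _ _).1 hs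
  obtain ⟨y, hy, rfl⟩ := (PMF.mem_support_map_iff _ _ _).1 hs
  obtain ⟨k, _, rfl⟩ := (PMF.mem_support_map_iff _ _ _).1 hy
  exact act_ne_zero (conjTranspose_mul_self_unitary _) (hp r hr)

variable {E}

/-- The decrypted result of an evaluation, tested by a family of effects. -/
theorem Correct.abs_sub_le (hEc : E.Correct) {a m : ℕ} {C : Circuit a m} (hC : C.IsCircuit) :
    ∃ ε, Negligible ε ∧ ∀ l sk, E.IsKey l sk → ∀ k ∈ (E.pad sk m).support, ∀ (ξ : Ket a) (φ : Ket m),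
      ξ ≠ 0 → φ ≠ 0 → ∀ g : Data → Ket C.qbits → ℝ, (∀ x, IsEffect (g x)) →
        (∀ x ψ, 0 ≤ g x ψ ∧ g x ψ ≤ 1) →
        |expect (E.evalState C l k.1 k.2 ξ φ) (fun r => g (E.decFun sk r.1.1)
            (act (E.padMatrix _ (E.decKeyFun sk _ r.1.2)).conjTranspose r.2)) -
          expect (C.apply ξ φ) fun o => g (ofBits o.1) o.2| ≤ ε l := by
  obtain ⟨ε, hε, h⟩ := hEc C hC
  refine ⟨ε, hε, fun l sk hsk k hk ξ φ hξ hφ g hg hgu => ?_⟩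
  have hb : IsBdd fun r : Data × Ket C.qbits => g r.1 r.2 := IsUnit01.isBdd fun r => hgu _ _
  have h1 := (h l sk hsk k hk ξ φ hξ hφ).abs_sub_le (fun r hr => by
      obtain ⟨s, hs, rfl⟩ := (PMF.mem_support_map_iff _ _ _).1 hr
      exact act_ne_zero (mul_conjTranspose_self_unitary _)
        (E.ne_zero_of_mem_evalState hξ hφ hs))
    (fun r hr => by
      obtain ⟨s, hs, rfl⟩ := (PMF.mem_support_map_iff _ _ _).1 hr
      exact Circuit.ne_zero_of_mem_apply hC hξ hφ hs) hg
  simpa only [decState, expect_map _ _ hb] using h1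

/-- The result of an evaluation, tested by a family of effects. -/
theorem EvalForm.abs_sub_le (hF : E.EvalForm) {a m : ℕ} {C : Circuit a m} (hC : C.IsCircuit) :
    ∃ ε, Negligible ε ∧ ∀ l sk, E.IsKey l sk → ∀ k ∈ (E.pad sk m).support, ∀ (ξ : Ket a) (φ : Ket m),
      ξ ≠ 0 → φ ≠ 0 → ∀ g : Data × Data → Ket C.qbits → ℝ, (∀ x, IsEffect (g x)) →
        (∀ x ψ, 0 ≤ g x ψ ∧ g x ψ ≤ 1) →
        |expect (E.evalState C l k.1 k.2 ξ φ) (fun r => g r.1 r.2) -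
          expect (C.apply ξ φ) fun o => expect (E.encBits sk o.1) fun c =>
            expect (E.pad sk C.qbits) fun k' => g (c, k'.2) (act (E.padMatrix _ k'.1) o.2)| ≤ ε l := by
  obtain ⟨ε, hε, h⟩ := hF C hC
  refine ⟨ε, hε, fun l sk hsk k hk ξ φ hξ hφ g hg hgu => ?_⟩
  have hb : IsBdd fun r : (Data × Data) × Ket C.qbits => g r.1 r.2 := IsUnit01.isBdd fun r => hgu _ _
  have hb' : ∀ c, IsBdd fun r : Data × Ket C.qbits => g (c, r.1) r.2 :=
    fun c => IsUnit01.isBdd fun r => hgu _ _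
  have h1 := (h l sk hsk k hk ξ φ hξ hφ).abs_sub_le
    (fun r hr => E.ne_zero_of_mem_evalState hξ hφ hr)
    (fun r hr => E.ne_zero_of_mem_encBoth (fun s hs => Circuit.ne_zero_of_mem_apply hC hξ hφ hs) hr)
    hg
  simpa only [encBoth, encState, expect_bind _ _ hb, expect_map _ _ hb, expect_map _ _ (hb' _)]
    using h1

/-- Evaluating a classical circuit yields an encryption of the output. -/
theorem EvalForm.close_ofFun (hF : E.EvalForm) {m m' : ℕ} (f : Bits m → Bits m') :
    ∃ ε, Negligible ε ∧ ∀ l sk, E.IsKey l sk → ∀ k ∈ (E.pad sk m).support, ∀ x : Bits m,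
      Close (ε l) ((E.evalState (Circuit.ofFun f) l k.1 k.2 (basisKet Fin.elim0) (basisKet x)).map
        fun r => r.1.1) (E.encBits sk (f x)) := by
  obtain ⟨ε, hε, h⟩ := hF.abs_sub_le (Circuit.isCircuit_ofFun f)
  refine ⟨ε, hε, fun l sk hsk k hk x g hg => ?_⟩
  have h1 := h l sk hsk k hk (basisKet Fin.elim0) (basisKet x) (basisKet_ne_zero _)
    (basisKet_ne_zero _) (fun r _ => g r.1) (fun r => isEffect_const (hg _).1 (hg _).2)
    fun r _ => hg _
  rw [expect_map _ _ hg.isBdd]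
  refine le_of_eq_of_le ?_ h1
  congr 2
  simp only [expect_const]
  refine (expect_const _ _).symm.trans (expect_congr fun r hr => ?_)
  rw [show r.1 = f x from Circuit.fst_of_mem_apply_ofFun f hr]
  rfl

/-- Encrypted bits are decrypted correctly. -/
theorem EvalForm.decBits (hF : E.EvalForm) (hEc : E.Correct) (m : ℕ) :
    ∃ ε, Negligible ε ∧ ∀ l sk, E.IsKey l sk → ∀ x : Bits m,
      Pr (E.encBits sk x) (fun c => E.decFun sk c ≠ ofBits x) ≤ ε l := by
  classical
  obtain ⟨ε, hε, h⟩ := hF.close_ofFun (id : Bits m → Bits m)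
  obtain ⟨δ, hδ, h'⟩ := hEc.abs_sub_le (Circuit.isCircuit_ofFun (id : Bits m → Bits m))
  refine ⟨_, hε.add hδ, fun l sk hsk x => ?_⟩
  -- Take one ciphertext of `x` and evaluate the identity circuit on it: the result resembles a
  -- fresh encryption of `x`, and by correctness it decrypts to `x`.
  obtain ⟨k, hk⟩ := (E.pad sk m).support_nonempty
  have h1 := (abs_le.1 ((h l sk hsk k hk x).abs_Pr_sub_le fun c => E.decFun sk c ≠ ofBits x)).1
  obtain ⟨f, hu, hf⟩ : ∃ f : Data → ℝ, IsUnit01 f ∧ ∀ (α : Type) (p : PMF α) (h : α → Data),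
      (expect p fun a => f (h a)) = Pr p fun a => h a ≠ ofBits x :=
    ⟨_, isUnit01_ite fun d => d ≠ ofBits x, fun α p h => (Pr_eq_expect _ _).symm⟩
  have h2 := h' l sk hsk k hk (basisKet Fin.elim0) (basisKet x) (basisKet_ne_zero _)
    (basisKet_ne_zero _) (fun d _ => f d)
    (fun d => isEffect_const (hu d).1 (hu d).2) fun d _ => hu d
  rw [hf, hf, Pr_false (Circuit.apply _ _ _), sub_zero] at h2
  · rw [Pr_map] at h1
    have h3 := (abs_le.1 h2).2
    rw [id_eq] at h1
    linarith
  · intro r hr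
    rw [show r.1 = x from Circuit.fst_of_mem_apply_ofFun _ hr]
    exact not_not.2 rfl

/-- The state recovered from an encryption of `φ`. -/
def recovered {n : ℕ} (E : QFHE) (sk : Data) (k : E.K n × Data) (φ : Ket n) : Ket n :=
  act (E.padMatrix n (E.decKeyFun sk n k.2)).conjTranspose (act (E.padMatrix n k.1) φ)

/-- Encrypted states are decrypted correctly. -/
theorem EvalForm.decKey (hF : E.EvalForm) (hEc : E.Correct) {n : ℕ} {φ : Ket n} (hφ : φ ≠ 0) :
    ∃ ε, Negligible ε ∧ ∀ l sk, E.IsKey l sk →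
      Pr (E.pad sk n) (fun k => ¬ ∃ z : ℂ, z ≠ 0 ∧ E.recovered sk k φ = z • φ) ≤ ε l := by
  classical
  obtain ⟨g, hg, hgu, hg1, hgφ⟩ := exists_stateTest hφ
  obtain ⟨ε, hε, h⟩ := hF.abs_sub_le (Circuit.isCircuit_idle n)
  obtain ⟨δ, hδ, h'⟩ := hEc.abs_sub_le (Circuit.isCircuit_idle n)
  -- For the decrypted pad `i.1` and the actual pad `i.2`, `t i` is the probability that the
  -- recovered state fails the test for `φ`. It vanishes only if that state is a multiple of `φ`.
  let t : E.K n × E.K n → ℝ := fun i =>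
    1 - g (act (E.padMatrix n i.1).conjTranspose (act (E.padMatrix n i.2) φ))
  have ht : ∀ i, 0 ≤ t i := fun i => sub_nonneg.2 (hgu _).2
  -- Since `K n` is finite, a nonzero failure probability `t i` is bounded below independently of
  -- the security parameter: `B ≥ 1 / t i`, where zero terms contribute `0⁻¹ = 0`. So a small
  -- average failure forces exact recovery, up to a scalar, with high probability.
  let B : ℝ := ∑ i, (t i)⁻¹
  refine ⟨_, (hε.add hδ).const_mul B, fun l sk hsk => ?_⟩
  obtain ⟨k, hk⟩ := (E.pad sk n).support_nonempty
  have hne : ∀ k : E.K n × Data, E.recovered sk k φ ≠ 0 := fun k =>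
    act_conjTranspose_ne_zero E _ (act_ne_zero (conjTranspose_mul_self_unitary _) hφ)
  have h1 := h l sk hsk k hk (basisKet Fin.elim0) φ (basisKet_ne_zero _) hφ
    (fun x ψ => g (act (E.padMatrix n (E.decKeyFun sk n x.2)).conjTranspose ψ))
    (fun x => hg.act (mul_conjTranspose_self_unitary _)) fun x ψ => hgu _
  have h2 := h' l sk hsk k hk (basisKet Fin.elim0) φ (basisKet_ne_zero _) hφ (fun _ => g)
    (fun _ => hg) fun _ => hgu
  have e1 : expect ((Circuit.idle n).apply (basisKet Fin.elim0) φ) (fun r => g r.2) = 1 := by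
    refine Eq.trans (expect_congr fun r hr => ?_) (expect_const _ 1)
    rw [show r.2 = φ from Circuit.snd_of_mem_apply_idle hφ hr]
    simpa using hg1 1 one_ne_zero
  have e2 : (expect ((Circuit.idle n).apply (basisKet Fin.elim0) φ) fun o =>
      expect (E.encBits sk o.1) fun _ => expect (E.pad sk n) fun k' =>
        g (act (E.padMatrix n (E.decKeyFun sk n k'.2)).conjTranspose
          (act (E.padMatrix n k'.1) o.2))) = expect (E.pad sk n) fun k' =>
            g (E.recovered sk k' φ) := by
    refine Eq.trans (expect_congr fun r hr => ?_) (expect_const _ _)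
    rw [show r.2 = φ from Circuit.snd_of_mem_apply_idle hφ hr, expect_const]
    rfl
  have h3 : |expect (E.evalState (Circuit.idle n) l k.1 k.2 (basisKet Fin.elim0) φ) (fun r =>
      g (act (E.padMatrix n (E.decKeyFun sk n r.1.2)).conjTranspose r.2)) -
        expect (E.pad sk n) fun k' => g (E.recovered sk k' φ)| ≤ ε l :=
    le_of_eq_of_le (congrArg (fun x => |_ - x|) e2.symm) h1
  have h4 : |expect (E.evalState (Circuit.idle n) l k.1 k.2 (basisKet Fin.elim0) φ) (fun r =>
      g (act (E.padMatrix n (E.decKeyFun sk n r.1.2)).conjTranspose r.2)) - 1| ≤ δ l :=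
    le_of_eq_of_le (congrArg (fun x => |_ - x|) e1.symm) h2
  have h5 : (expect (E.pad sk n) fun k' => 1 - g (E.recovered sk k' φ)) ≤ ε l + δ l := by
    rw [expect_sub _ (isBdd_const 1) (IsUnit01.isBdd fun _ => hgu _), expect_const]
    linarith [(abs_le.1 h3).2, (abs_le.1 h4).1]
  have hB : 0 ≤ B := Finset.sum_nonneg fun i _ => inv_nonneg.2 (ht i)
  refine le_trans ?_ (mul_le_mul_of_nonneg_left h5 hB)
  rw [← expect_const_mul, Pr_eq_expect]
  refine expect_mono (isUnit01_ite _).isBdd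
    (((isBdd_const 1).sub (IsUnit01.isBdd fun _ => hgu _)).const_mul B) fun k' _ => ?_
  split_ifs with hk'
  · exact mul_nonneg hB (sub_nonneg.2 (hgu _).2)
  · have h6 : 0 < t (E.decKeyFun sk n k'.2, k'.1) := by
      refine lt_of_le_of_ne (ht _) fun h0 => hk' ?_
      obtain ⟨z, hz⟩ := hgφ (E.recovered sk k' φ) (hne k') (by
        have : 0 = 1 - g (E.recovered sk k' φ) := h0
        linarith)
      refine ⟨z, fun hz0 => hne k' ?_, hz⟩
      rw [hz, hz0, zero_smul]
    have h7 : (t (E.decKeyFun sk n k'.2, k'.1))⁻¹ ≤ B :=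
      Finset.single_le_sum (f := fun i => (t i)⁻¹) (fun i _ => inv_nonneg.2 (ht i))
        (Finset.mem_univ _)
    calc (1 : ℝ) = (t (E.decKeyFun sk n k'.2, k'.1))⁻¹ * t (E.decKeyFun sk n k'.2, k'.1) :=
          (inv_mul_cancel₀ h6.ne').symm
      _ ≤ B * t (E.decKeyFun sk n k'.2, k'.1) := mul_le_mul_of_nonneg_right h7 h6.le

end QFHE

theorem Negligible.abs {ε : ℕ → ℝ} (h : Negligible ε) : Negligible fun l => |ε l| :=
  Asymptotics.SuperpolynomialDecay.trans_abs_le h fun l => (abs_abs (ε l)).le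

/-! ### The ideal execution with freshly encrypted answers -/

section Ideal

variable {G : Game Q} (E : QFHE) {n : ℕ} (P : OPad n (E.K n) (E.keyCode n)) (cd : Coding G)
  (S : QStrat G (QubitSpace n))

/-- The steps of an execution after the first message, when the answers are encrypted afresh. -/
def idealSteps (l : ℕ) (sk : Data) (C : G.contexts) (c : Data) :
    PMF (CompiledState G × Transcript) :=
  (S.outcome S.ψ C.1).bind fun a => (E.encBits sk (cd.vec C.1 a)).bind fun t₃ =>
    (E.pad sk n).bind fun k => finish E P cd S l sk C c t₃ k.2 (S.proj C.1 a S.ψ)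

/-- The execution in which the answers are encrypted afresh. -/
def idealExec (l : ℕ) : PMF (CompiledState G × Transcript) :=
  (E.gen.run (Data.unary l)).bind fun sk => G.D.bind fun C =>
    (E.encBits sk (cd.ctx C.1)).bind fun c => idealSteps E P cd S l sk C c

/-- On a joint eigenvector the answers are deterministic, so any nonzero factor is harmless, not
only a phase as in `finish_smul`. -/
theorem finish_smul_eigen (l : ℕ) (sk : Data) (C : G.contexts) (c t₃ kh : Data) {z : ℂ} (hz : z ≠ 0)
    {a : C.1 → G.A} {u : QubitSpace n} (hu : u ≠ 0) (hua : u ∈ S.eigen C.1 a) :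
    finish E P cd S l sk C c t₃ kh (z • u) = finish E P cd S l sk C c t₃ kh u := by
  refine bind_congr_support fun q hq => ?_
  have hq := Game.mem_of_mem_ask hq
  rw [answer_eigen cd S hu hua hq,
    answer_eigen cd S (smul_ne_zero hz hu) (Submodule.smul_mem _ z hua) hq]

theorem isEffect_finish (l : ℕ) (sk : Data) (C : G.contexts) (c t₃ kh : Data)
    {f : CompiledState G × Transcript → ℝ} (hf : IsUnit01 f) :
    IsEffect fun φ : Ket n => expect (finish E P cd S l sk C c t₃ kh (WithLp.toLp 2 φ)) f := by
  let F : Q → Data → ℝ := fun q a => expect ((P.gen.run (Data.unary l)).bind fun keys =>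
    (P.samp.run keys.fst).map fun s' =>
      record E P cd sk keys C c t₃ (Data.node kh s') q (a, Data.nil)) f
  have hF : ∀ q, IsUnit01 (F q) := fun q a => expect_unit _ hf
  have h := isEffect_answer cd S hF C
  have e : ∀ φ : Ket n, expect (finish E P cd S l sk C c t₃ kh (WithLp.toLp 2 φ)) f =
      expect (Game.ask C) fun q => expect (answer cd S (WithLp.toLp 2 φ) q) (F q) := by
    intro φ
    rw [finish, expect_bind _ _ hf.isBdd]
    refine expect_congr fun q _ => ?_
    rw [expect_bind _ _ hf.isBdd]
  simpa only [e] using h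

variable {E}

/-- The homomorphic measurement may be replaced by a measurement and a fresh encryption. -/
theorem idealSteps_close (hF : E.EvalForm) (hEc : E.Correct) : ∃ ε, Negligible ε ∧
    ∀ l sk, E.IsKey l sk → ∀ k ∈ (E.pad sk cd.ctxLen).support, ∀ (C : G.contexts) (c : Data),
      Close (ε l) ((evalMeasure E cd S l k C.1).bind fun r =>
        finish E P cd S l sk C c r.1.1 r.1.2 (decrypted E sk r.1.2 r.2))
        (idealSteps E P cd S l sk C c) := by
  classical
  obtain ⟨ε, hε, h⟩ := hF.abs_sub_le (isCircuit_measureCircuit cd S)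
  -- The error of `EvalForm.decKey` depends on the state, but only finitely many post-measurement
  -- states occur, so the errors can be summed. Absolute values are used because an error function
  -- may be negative where it bounds nothing.
  have hd : ∀ i : (Σ C : G.contexts, (C.1 → G.A)), ∃ δ, Negligible δ ∧ (S.proj i.1.1 i.2 S.ψ ≠ 0 →
      ∀ l sk, E.IsKey l sk → Pr (E.pad sk n) (fun k => ¬ ∃ z : ℂ, z ≠ 0 ∧
        E.recovered sk k (S.proj i.1.1 i.2 S.ψ).ofLp = z • (S.proj i.1.1 i.2 S.ψ).ofLp) ≤ δ l) := by
    intro i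
    by_cases h0 : S.proj i.1.1 i.2 S.ψ = 0
    · exact ⟨_, Negligible.zero, fun h => absurd h0 h⟩
    · obtain ⟨δ, hδ, h1⟩ := hF.decKey hEc (φ := (S.proj i.1.1 i.2 S.ψ).ofLp)
        fun h => h0 (WithLp.ofLp_injective 2 h)
      exact ⟨δ, hδ, fun _ => h1⟩
  choose δ hδ hd using hd
  refine ⟨fun l => ε l + ∑ i, |δ i l|, hε.add (Negligible.sum _ fun i _ => ?_),
    fun l sk hsk k hk C c => ?_⟩
  · exact (hδ i).abs
  -- In this hybrid the ciphertexts are fresh already, but the state is still the one recovered by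
  -- decryption.
  let mid : PMF (CompiledState G × Transcript) := (S.outcome S.ψ C.1).bind fun a =>
    (E.encBits sk (cd.vec C.1 a)).bind fun t₃ => (E.pad sk n).bind fun k' =>
      finish E P cd S l sk C c t₃ k'.2
        (WithLp.toLp 2 (E.recovered sk k' (S.proj C.1 a S.ψ).ofLp))
  refine Close.trans (q := mid) (fun f hf => ?_) ?_
  · have h1 := h l sk hsk k hk (S.ψ : QubitSpace n).ofLp (basisKet (cd.ctx C.1)) (ofLp_ψ_ne_zero S)
      (basisKet_ne_zero _)
      (fun x φ => expect (finish E P cd S l sk C c x.1 x.2 (decrypted E sk x.2 φ)) f)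
      (fun x => (isEffect_finish E P cd S l sk C c x.1 x.2 hf).act
        (mul_conjTranspose_self_unitary _)) fun x φ => expect_unit _ hf
    rw [expect_bind _ _ hf.isBdd]
    refine le_of_eq_of_le ?_ h1
    congr 2
    let F : Bits cd.vecLen × Ket n → ℝ := fun o => expect (E.encBits sk o.1) fun c' =>
      expect (E.pad sk n) fun k' => expect (finish E P cd S l sk C c c' k'.2
        (decrypted E sk k'.2 (act (E.padMatrix n k'.1) o.2))) f
    have hF : IsUnit01 F := fun o => expect_unit _ fun c' => expect_unit _ fun k' => expect_unit _ hf
    have e := expect_map (S.outcome S.ψ C.1)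
      (fun a => (cd.vec C.1 a, (S.proj C.1 a S.ψ).ofLp)) hF.isBdd
    rw [measureCircuit_apply cd S C.2]
    refine Eq.trans ?_ e.symm
    simp only [mid, expect_bind _ _ hf.isBdd]
    rfl
  · refine Close.bind_left fun a ha => Close.bind_left fun t₃ _ => ?_
    have h0 := (S.mem_support_outcome (S.compatible_context C.2) S.ψ_ne_zero).1 ha
    have h2 : δ ⟨C, a⟩ l ≤ ∑ i, |δ i l| := (le_abs_self _).trans
      (Finset.single_le_sum (f := fun i => |δ i l|) (fun i _ => abs_nonneg _) (Finset.mem_univ _))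
    refine close_bind_of_good _ ((hd ⟨C, a⟩ h0 l sk hsk).trans h2) fun k' _ hk' => ?_
    obtain ⟨z, hz, hk'⟩ := hk'
    rw [hk']
    exact finish_smul_eigen E P cd S l sk C c t₃ k'.2 hz h0 (S.proj_mem _ _ _)

/-- The central comparison for faithfulness: the oblivious pad is removed first, then the
homomorphic measurement is replaced by a measurement in the clear. -/
theorem exec_honest_close_idealExec (hE : E.WellFormed) (hF : E.EvalForm) (hEc : E.Correct)
    (hP : P.Correct (E.U n)) (hPr : P.RangeSampling) :
    ∃ ε, Negligible ε ∧ ∀ l, Close (ε l)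
      ((compiled G E P cd).exec ((honest G E P cd S).withInfo _) l) (idealExec E P cd S l) := by
  obtain ⟨ε, hε, h1⟩ := exec_honest_close E P cd S hE hP hPr
  obtain ⟨δ, hδ, h2⟩ := idealSteps_close P cd S hF hEc
  refine ⟨_, hε.add hδ, fun l => (h1 l).trans ?_⟩
  refine Close.bind_left fun sk hsk => Close.bind_left fun C _ => ?_
  rw [hE.encBits_eq l sk hsk, PMF.bind_map]
  exact Close.bind_left fun k hk => h2 l sk hsk k hk C _

end Ideal

theorem Pr_bind_le_add {α β : Type*} {p : PMF α} {g : α → PMF β} {e : β → Prop} (bad : α → Prop)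
    {c : ℝ} (hc : 0 ≤ c) (h : ∀ a ∈ p.support, ¬ bad a → Pr (g a) e ≤ c) :
    Pr (p.bind g) e ≤ Pr p bad + c := by
  classical
  have hb := (isUnit01_ite bad).isBdd
  rw [Pr_bind, Pr_eq_expect, ← expect_const p c, ← expect_add _ hb (isBdd_const c)]
  refine expect_mono (isUnit01_Pr _ _).isBdd (hb.add (isBdd_const c)) fun a ha => ?_
  by_cases hbad : bad a
  · have := Pr_le_one (g a) e
    simp only [hbad, if_true]
    linarith
  · simpa [hbad] using h a ha hbad

theorem abs_Pr_bind_sub_le_of_forall {α β : Type*} {p : PMF α} {g g' : α → PMF β} {e : β → Prop}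
    {c : ℝ} (h : ∀ a ∈ p.support, |Pr (g a) e - Pr (g' a) e| ≤ c) :
    |Pr (p.bind g) e - Pr (p.bind g') e| ≤ c := by
  rw [Pr_bind, Pr_bind]
  exact abs_expect_sub_le (isUnit01_Pr _ _).isBdd (isUnit01_Pr _ _).isBdd h

theorem abs_Pr_bind_sub_le {α β : Type*} {p : PMF α} {g g' : α → PMF β} {e : β → Prop}
    (bad : α → Prop) (h : ∀ a ∈ p.support, ¬ bad a → Pr (g a) e = Pr (g' a) e) :
    |Pr (p.bind g) e - Pr (p.bind g') e| ≤ Pr p bad := by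
  classical
  have hb := (isUnit01_ite bad).isBdd
  have key : ∀ g g' : α → PMF β, (∀ a ∈ p.support, ¬ bad a → Pr (g a) e = Pr (g' a) e) →
      Pr (p.bind g) e ≤ Pr (p.bind g') e + Pr p bad := by
    intro g g' h
    have hg' : IsBdd fun a => Pr (g' a) e := (isUnit01_Pr _ fun _ => e).isBdd
    rw [Pr_bind, Pr_bind, Pr_eq_expect p, ← expect_add _ hg' hb]
    refine expect_mono (isUnit01_Pr _ _).isBdd (hg'.add hb) fun a ha => ?_
    by_cases hbad : bad a
    · have := Pr_le_one (g a) e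
      have := Pr_nonneg (g' a) e
      simp only [hbad, if_true]
      linarith
    · simp [hbad, h a ha hbad]
  have h1 := key g g' h
  have h2 := key g' g fun a ha hb => (h a ha hb).symm
  exact abs_le.2 ⟨by linarith, by linarith⟩

namespace QStrat

variable {G : Game Q} {H : Type} [NormedAddCommGroup H] [InnerProductSpace ℂ H]
  [CompleteSpace H] {S S' : QStrat G H}

theorem proj_congr {R : Finset Q} (h : ∀ q ∈ R, S.O q = S'.O q) (a : R → G.A) :
    S.proj R a = S'.proj R a := by
  have e : S.eigen R a = S'.eigen R a := by
    ext v
    rw [mem_eigen, mem_eigen]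
    exact forall_congr' fun q => by rw [h q q.2]
  have key : ∀ (K K' : Submodule ℂ H) [K.HasOrthogonalProjection] [K'.HasOrthogonalProjection],
      K = K' → K.starProjection = K'.starProjection := by
    intro K K' _ _ hK
    subst hK
    rfl
  exact key _ _ e

theorem outcome_congr {R : Finset Q} (h : ∀ q ∈ R, S.O q = S'.O q) (u : H) :
    S.outcome u R = S'.outcome u R := by
  simp only [outcome, proj_congr h]

end QStrat

/-! ### Faithfulness: well-formedness, decisions, soundness and marginals -/

section Faithful

variable {G : Game Q} (E : QFHE) {n : ℕ} (P : OPad n (E.K n) (E.keyCode n)) (cd : Coding G)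

theorem ask₁_compiled {s : CompiledState G} {c : Data}
    (h : E.decFun s.sk c = ofBits (cd.ctx s.C.1)) :
    (compiledMaps G E P cd).ask₁ s c = s.C.1 := by
  classical
  have e : (G.contexts.filter fun C => ofBits (cd.ctx C) = E.decFun s.sk c) = {s.C.1} := by
    ext C
    rw [Finset.mem_filter, Finset.mem_singleton, h]
    constructor
    · rintro ⟨h1, h2⟩
      exact cd.ctx_inj h1 s.C.2 (ofBits_injective h2)
    · rintro rfl
      exact ⟨s.C.2, rfl⟩
  have e2 : (compiledMaps G E P cd).ask₁ s c =
      (G.contexts.filter fun C => ofBits (cd.ctx C) = E.decFun s.sk c).sup id := by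
    simp only [compiledMaps]
  rw [e2, e, Finset.sup_singleton, id_eq]

theorem ask₂_compiled (s : CompiledState G) (q : Q) :
    (compiledMaps G E P cd).ask₂ s (cd.que q) = {q} := by
  ext q'
  simp [compiledMaps, cd.que_inj.eq_iff]

theorem asked_record {sk keys : Data} {C : G.contexts} {c : Data} (t₃ t₄ : Data) {q : Q}
    (r : Data × Data) (hq : q ∈ C.1) (h : E.decFun sk c = ofBits (cd.ctx C.1)) :
    (compiledMaps G E P cd).asked (record E P cd sk keys C c t₃ t₄ q r) = C.1 := by
  have h1 := ask₁_compiled E P cd (s := ⟨sk, keys.snd, C⟩) h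
  have h2 := ask₂_compiled E P cd ⟨sk, keys.snd, C⟩ q
  have h3 : (compiledMaps G E P cd).asked (record E P cd sk keys C c t₃ t₄ q r) =
      (compiledMaps G E P cd).ask₁ (⟨sk, keys.snd, C⟩ : CompiledState G) c ∪
        (compiledMaps G E P cd).ask₂ (⟨sk, keys.snd, C⟩ : CompiledState G) (cd.que q) := rfl
  rw [h3]
  refine (congrArg₂ (· ∪ ·) h1 h2).trans ?_
  exact Finset.union_eq_left.2 (Finset.singleton_subset_iff.2 hq)

/-- The questions form the context chosen by the verifier. -/
theorem Pr_asked_ne_le (hF : E.EvalForm) (hEc : E.Correct) : ∃ ε, Negligible ε ∧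
    ∀ (A : Party (CompiledState G)) l, Pr ((compiled G E P cd).exec A l)
      (fun r => (compiledMaps G E P cd).asked r ≠ CompiledState.C r.1) ≤ ε l := by
  obtain ⟨ε, hε, h⟩ := hF.decBits hEc cd.ctxLen
  refine ⟨ε, hε, fun A l => ?_⟩
  refine (exec_compiled E P cd A l).symm ▸ ?_
  refine Pr_bind_le fun sk hsk => Pr_bind_le fun C _ => ?_
  refine (Pr_bind_le_add _ le_rfl fun c _ hc => ?_).trans ((add_zero _).trans_le (h l sk hsk _))
  refine Pr_bind_le fun keys _ => Pr_bind_le fun m _ => Pr_bind_le fun q hq => ?_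
  refine (Pr_map _ _ _).trans_le (Pr_false _ fun r _ hr => hr ?_).le
  exact asked_record E P cd _ _ _ (Game.mem_of_mem_ask hq) (not_not.1 hc)

theorem wellFormed_compiled (hF : E.EvalForm) (hEc : E.Correct) : ∃ ε, Negligible ε ∧
    ∀ (A : Prover) (l : ℕ), Pr ((compiled G E P cd).exec (A.withInfo _) l)
      (fun r => ¬ ∃ C ∈ G.contexts, (compiledMaps G E P cd).asked r ⊆ C) ≤ ε l := by
  obtain ⟨ε, hε, h⟩ := Pr_asked_ne_le E P cd hF hEc
  refine ⟨ε, hε, fun A l => (Pr_mono fun r _ hr he => hr ?_).trans (h _ l)⟩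
  exact ⟨_, (CompiledState.C r.1).2, he.subset⟩

theorem ans₂_compiled (s : CompiledState G) (q : Q) (a : ({q} : Finset Q) → G.A) :
    (compiledMaps G E P cd).ans₂ s {q} a =
      PMF.pure (cd.ans (a ⟨q, Finset.mem_singleton_self q⟩)) := by
  have h : ∃ q', q' ∈ ({q} : Finset Q) := ⟨q, Finset.mem_singleton_self q⟩
  have e : (compiledMaps G E P cd).ans₂ s {q} a =
      PMF.pure (cd.ans (a ⟨h.choose, h.choose_spec⟩)) := dif_pos h
  rw [e]
  congr
  exact Finset.mem_singleton.1 h.choose_spec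

/-- Against a classical simulator the verdict is given by the predicate. -/
theorem Pr_ncSimulator_le (hF : E.EvalForm) (hEc : E.Correct) : ∃ ε, Negligible ε ∧
    ∀ (τ : Q → G.A) (x : Aux) l,
      Pr ((compiled G E P cd).exec (ncSimulator (compiledMaps G E P cd) τ x) l)
        (fun r => ¬ ((compiledMaps G E P cd).asked r = CompiledState.C r.1 ∧ r.2.accept =
          G.pred (CompiledState.C r.1).1 (G.restrict τ _))) ≤ ε l := by
  obtain ⟨ε, hε, h⟩ := hF.decBits hEc cd.ctxLen
  obtain ⟨δ, hδ, h'⟩ := hF.decBits hEc cd.vecLen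
  -- `δ` dominates a probability because some secret key exists.
  have hδ0 : ∀ l, 0 ≤ δ l := fun l => by
    obtain ⟨sk, hsk⟩ := (E.gen.run (Data.unary l)).support_nonempty
    exact (Pr_nonneg _ _).trans (h' l sk hsk fun _ => false)
  refine ⟨_, hε.add hδ, fun τ x l => ?_⟩
  refine (exec_compiled E P cd (ncSimulator (compiledMaps G E P cd) τ x) l).symm ▸ ?_
  refine Pr_bind_le fun sk hsk => Pr_bind_le fun C _ => ?_
  refine (Pr_bind_le_add _ (hδ0 l) fun c _ hc => ?_).trans (add_le_add_left (h l sk hsk _) _)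
  refine Pr_bind_le fun keys _ => ?_
  have hc := not_not.1 hc
  have e1 : (ncSimulator (compiledMaps G E P cd) τ x).first l ⟨sk, keys.snd, C⟩ c keys.fst =
      (E.encBits sk (cd.vec C.1 (G.restrict τ C.1))).bind fun t₃ =>
        (x.first l c keys.fst t₃).map fun r => (t₃, r.1, r.2) := by
    have h1 := ask₁_compiled E P cd (s := ⟨sk, keys.snd, C⟩) hc
    -- The type of the answers depends on the set of questions, so the equality of sets is used by
    -- substitution for a variable `R`.
    have h2 : ∀ R : Finset Q, R = C.1 → (E.encBits sk (cd.vec R (G.restrict τ R))) =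
        E.encBits sk (cd.vec C.1 (G.restrict τ C.1)) := by
      rintro R rfl
      rfl
    exact congrArg (fun p : PMF Data => p.bind fun t₃ =>
      (x.first l c keys.fst t₃).map fun r => (t₃, r.1, r.2)) (h2 _ h1)
  have e2 : ∀ (u : x.State) (q : Q) (t₆ : Data), (ncSimulator (compiledMaps G E P cd) τ x).second u
      ⟨sk, keys.snd, C⟩ (cd.que q) t₆ =
        (x.second u (cd.que q) t₆ (cd.ans (τ q))).map fun t₈ => (cd.ans (τ q), t₈) := by
    intro u q t₆
    have h1 := ask₂_compiled E P cd ⟨sk, keys.snd, C⟩ q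
    have h2 : ∀ R : Finset Q, R = {q} → (compiledMaps G E P cd).ans₂ (⟨sk, keys.snd, C⟩ :
        CompiledState G) R (G.restrict τ R) = PMF.pure (cd.ans (τ q)) := by
      rintro R rfl
      exact ans₂_compiled E P cd _ q _
    exact (congrArg (fun p : PMF Data => p.bind fun t₇ =>
      (x.second u (cd.que q) t₆ t₇).map fun t₈ => (t₇, t₈)) (h2 _ h1)).trans (PMF.pure_bind _ _)
  have e3 : ((ncSimulator (compiledMaps G E P cd) τ x).first l ⟨sk, keys.snd, C⟩ c keys.fst).bind
      (fun m => (Game.ask C).bind fun q => ((ncSimulator (compiledMaps G E P cd) τ x).second m.2.2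
        ⟨sk, keys.snd, C⟩ (cd.que q) (E.keyCode n (sentKey E P sk keys m.2.1))).map fun r =>
          record E P cd sk keys C c m.1 m.2.1 q r) =
      (E.encBits sk (cd.vec C.1 (G.restrict τ C.1))).bind fun t₃ => (x.first l c keys.fst t₃).bind
        fun m => (Game.ask C).bind fun q => (x.second m.2 (cd.que q)
          (E.keyCode n (sentKey E P sk keys m.1)) (cd.ans (τ q))).map fun t₈ =>
            record E P cd sk keys C c t₃ m.1 q (cd.ans (τ q), t₈) := by
    refine (congrArg (fun p : PMF (Data × Data × x.State) => p.bind _) e1).trans ?_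
    refine (PMF.bind_bind _ _ _).trans (congrArg _ (funext fun t₃ => (PMF.bind_map _ _ _).trans
      (congrArg _ (funext fun m => congrArg _ (funext fun q => ?_)))))
    exact (congrArg (PMF.map _) (e2 m.2 q _)).trans (PMF.map_comp _ _ _)
  refine (congrArg (fun p => Pr p _) e3).trans_le ?_
  refine (Pr_bind_le_add _ le_rfl fun t₃ _ ht₃ => ?_).trans
    ((add_zero _).trans_le (h' l sk hsk (cd.vec C.1 (G.restrict τ C.1))))
  have ht₃ := not_not.1 ht₃
  refine Pr_bind_le fun m _ => Pr_bind_le fun q hq => ?_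
  have hq := Game.mem_of_mem_ask hq
  refine (Pr_map _ _ _).trans_le
    (Pr_false _ fun r _ hr => hr ⟨asked_record E P cd _ _ _ hq hc, ?_⟩).le
  rw [Bool.eq_iff_iff]
  refine (record_accept E P cd sk keys C c t₃ _ q _).trans ?_
  rw [Accepts, ht₃]
  refine ⟨?_, fun hp => ⟨_, rfl, hp, hq, rfl⟩⟩
  rintro ⟨a, ha, hp, _⟩
  rwa [cd.vec_inj C.1 C.2 (ofBits_injective ha)] at hp

/-- Up to the decryption error all questions of the chosen context are asked, so the case of a set
that is no context does not arise. -/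
theorem decision_compiled (hF : E.EvalForm) (hEc : E.Correct) : ∃ ε, Negligible ε ∧
    ∀ (τ : Q → G.A) (x : Aux) (l : ℕ),
      Pr ((compiled G E P cd).exec (ncSimulator (compiledMaps G E P cd) τ x) l) (fun r =>
        r.2.accept ≠ if (compiledMaps G E P cd).asked r ∈ G.contexts then
          G.pred ((compiledMaps G E P cd).asked r) (G.restrict τ _) else true) ≤ ε l := by
  obtain ⟨ε, hε, h⟩ := Pr_ncSimulator_le E P cd hF hEc
  refine ⟨ε, hε, fun τ x l => (Pr_mono fun r _ hr hgood => hr ?_).trans (h τ x l)⟩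
  rw [hgood.1, if_pos (CompiledState.C r.1).2]
  exact hgood.2

/-- The verifier draws the context independently of its key, and no later draw affects its marginal.
-/
theorem map_exec_context (A : Party (CompiledState G)) (l : ℕ) :
    ((compiled G E P cd).exec A l).map (fun r => CompiledState.C r.1) = G.D := by
  refine (congrArg (PMF.map _) (exec_compiled E P cd A l)).trans ?_
  have h : ∀ (sk keys : Data) (C : G.contexts) (c t₃ t₄ : Data) (q : Q) (p : PMF (Data × Data)),
      (p.map (record E P cd sk keys C c t₃ t₄ q)).map (fun r => r.1.C) = PMF.pure C := by
    intro sk keys C c t₃ t₄ q p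
    rw [PMF.map_comp]
    exact PMF.map_const _ _
  have h' : ∀ p : PMF (CompiledState G × Transcript), PMF.map (fun r : (compiled G E P cd).State₁ ×
    Transcript => CompiledState.C r.1) p = p.map fun r => r.1.C := fun _ => rfl
  refine (h' _).trans ?_
  simp only [PMF.map_bind, h, PMF.bind_const, PMF.bind_pure]

/-- The table `τ` violates the predicate in some context `C₀`, and up to the decryption error the
verdict there is a rejection. So the simulator loses with probability about `Pr(C₀) ≥ const₁`. No
security is involved: the simulator uses `τ` whatever the messages are. -/
theorem soundness_compiled (hG : G.valNC < 1) (hF : E.EvalForm) (hEc : E.Correct) :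
    ∃ ε, Negligible ε ∧ ∀ (τ : Q → G.A) (x : Aux) (l : ℕ),
      (compiled G E P cd).winProb (ncSimulator (compiledMaps G E P cd) τ x) l ≤
        1 - G.const₁ + ε l := by
  classical
  obtain ⟨ε, hε, h⟩ := Pr_ncSimulator_le E P cd hF hEc
  refine ⟨ε, hε, fun τ x l => ?_⟩
  obtain ⟨C₀, hC₀⟩ := G.exists_context_not_pred hG τ
  have h1 := h τ x l
  set p := (compiled G E P cd).exec (ncSimulator (compiledMaps G E P cd) τ x) l
  have h2 : Pr p (fun r => CompiledState.C r.1 = C₀) = (G.D C₀).toReal := by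
    have := congrArg (fun p => Pr p (· = C₀)) (map_exec_context E P cd
      (ncSimulator (compiledMaps G E P cd) τ x) l)
    rw [Pr_map] at this
    refine this.trans ?_
    rw [Pr_eq_expect, expect_fintype, Finset.sum_eq_single C₀] <;> simp +contextual
  have h3 : (1 : ℝ) ≤ C₀.1.card := by exact_mod_cast (G.context_nonempty C₀.1 C₀.2).card_pos
  have h4 : G.const₁ ≤ (G.D C₀).toReal :=
    (G.const₁_le C₀).trans (div_le_self ENNReal.toReal_nonneg h3)
  have h5 : Pr p (fun r => CompiledState.C r.1 = C₀) ≤ Pr p (fun r => ¬ r.2.accept = true) +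
      Pr p (fun r => ¬ ((compiledMaps G E P cd).asked r = CompiledState.C r.1 ∧ r.2.accept =
          G.pred (CompiledState.C r.1).1 (G.restrict τ _))) := by
    have := Pr_exists_le p (Finset.univ : Finset Bool) fun b r => bif b then
      ¬ r.2.accept = true else ¬ ((compiledMaps G E P cd).asked r = CompiledState.C r.1 ∧
        r.2.accept = G.pred (CompiledState.C r.1).1 (G.restrict τ _))
    rw [Fintype.sum_bool] at this
    refine le_trans (Pr_mono fun r _ hr => ?_) this
    by_cases hg : (compiledMaps G E P cd).asked r = CompiledState.C r.1 ∧
        r.2.accept = G.pred (CompiledState.C r.1).1 (G.restrict τ _)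
    · refine ⟨true, Finset.mem_univ _, ?_⟩
      have h6 := hg.2
      rw [show CompiledState.C r.1 = C₀ from hr, hC₀] at h6
      simp [h6]
    · exact ⟨false, Finset.mem_univ _, hg⟩
  rw [Pr_not] at h5
  have h6 : (compiled G E P cd).winProb (ncSimulator (compiledMaps G E P cd) τ x) l =
      Pr p fun r => r.2.accept = true := by
    rw [Verifier.winProb, Verifier.transcript, Pr_map]
  linarith

variable {P} in
theorem finish_congr {S S' : QStrat G (QubitSpace n)} {C : G.contexts}
    (h : ∀ q ∈ C.1, S.O q = S'.O q) (l : ℕ) (sk c t₃ kh : Data) (u : QubitSpace n) :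
    finish E P cd S l sk C c t₃ kh u = finish E P cd S' l sk C c t₃ kh u := by
  refine bind_congr_support fun q hq => ?_
  have h1 : answer cd S u q = answer cd S' u q := by
    rw [answer, answer, QStrat.outcome_congr]
    intro q' hq'
    rw [Finset.mem_singleton.1 hq']
    exact h q (Game.mem_of_mem_ask hq)
  rw [h1]

/-- The ideal execution in the context `C` uses the state and the observables of `C` only. If `C ⊆
C₀`, the two ideal executions therefore coincide. Otherwise, when the context decrypts correctly,
the questions asked are not contained in `C₀` and the event has probability 0 for both strategies.
-/
theorem marginal_compiled (hE : E.WellFormed) (hF : E.EvalForm) (hEc : E.Correct)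
    (hP : P.Correct (E.U n)) (hPr : P.RangeSampling) (S S' : QStrat G (QubitSpace n)) (C₀ : Finset Q)
    (hψ : S.ψ = S'.ψ) (hO : ∀ q ∈ C₀, S.O q = S'.O q) :
    ∃ ε, Negligible ε ∧ ∀ (l : ℕ) (T : Set Transcript),
      |Pr ((compiled G E P cd).exec ((honest G E P cd S).withInfo _) l)
          (fun r => (compiledMaps G E P cd).asked r ⊆ C₀ ∧ r.2 ∈ T) -
        Pr ((compiled G E P cd).exec ((honest G E P cd S').withInfo _) l)
          (fun r => (compiledMaps G E P cd).asked r ⊆ C₀ ∧ r.2 ∈ T)| ≤ ε l := by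
  obtain ⟨ε, hε, h1⟩ := exec_honest_close_idealExec P cd S hE hF hEc hP hPr
  obtain ⟨ε', hε', h2⟩ := exec_honest_close_idealExec P cd S' hE hF hEc hP hPr
  obtain ⟨δ, hδ, h3⟩ := hF.decBits hEc cd.ctxLen
  refine ⟨_, (hε.add hδ).add hε', fun l T => ?_⟩
  let e : CompiledState G × Transcript → Prop :=
    fun r => (compiledMaps G E P cd).asked r ⊆ C₀ ∧ r.2 ∈ T
  have h5 := (h1 l).abs_Pr_sub_le e
  have h6 := (h2 l).symm.abs_Pr_sub_le e
  have h7 : |Pr (idealExec E P cd S l) e - Pr (idealExec E P cd S' l) e| ≤ δ l := by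
    refine abs_Pr_bind_sub_le_of_forall fun sk hsk => abs_Pr_bind_sub_le_of_forall fun C _ => ?_
    refine (abs_Pr_bind_sub_le _ fun c _ hc => ?_).trans (h3 l sk hsk (cd.ctx C.1))
    have hc := not_not.1 hc
    by_cases hC : C.1 ⊆ C₀
    · have hO' : ∀ q ∈ C.1, S.O q = S'.O q := fun q hq => hO q (hC hq)
      simp only [idealSteps, hψ, QStrat.outcome_congr hO', QStrat.proj_congr hO',
        finish_congr E cd hO']
    · have key : ∀ S : QStrat G (QubitSpace n), Pr (idealSteps E P cd S l sk C c) e = 0 := by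
        intro S
        refine le_antisymm ?_ (Pr_nonneg _ _)
        refine Pr_bind_le fun a _ => Pr_bind_le fun t₃ _ => Pr_bind_le fun k _ =>
          Pr_bind_le fun q hq => Pr_bind_le fun x _ => Pr_bind_le fun keys _ => ?_
        refine (Pr_map _ _ _).trans_le (Pr_false _ fun s _ hs => hC ?_).le
        exact (asked_record E P cd _ _ _ (Game.mem_of_mem_ask hq) hc).symm.subset.trans hs.1
      rw [key, key]
  have h8 := (abs_sub_le _ _ _).trans (add_le_add ((abs_sub_le _ _ _).trans (add_le_add h5 h7)) h6)
  exact h8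

end Faithful

theorem PMF.bind_pair_comm {α β γ δ ω : Type*} (p : PMF α) (p' : α → PMF β) (q : PMF γ)
    (q' : γ → PMF δ) (R : α → β → γ → δ → PMF ω) :
    (p.bind fun a => (p' a).bind fun b => q.bind fun c => (q' c).bind fun d => R a b c d) =
      q.bind fun c => (q' c).bind fun d => p.bind fun a => (p' a).bind fun b => R a b c d := by
  have h := PMF.bind_comm (p.bind fun a => (p' a).map fun b => (a, b))
    (q.bind fun c => (q' c).map fun d => (c, d)) fun x y => R x.1 x.2 y.1 y.2
  simpa only [PMF.bind_bind, PMF.bind_map, Function.comp_def] using h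

/-! ### Faithfulness: quantum simulation -/

section Simulation

variable {G : Game Q} (E : QFHE) {n : ℕ} (P : OPad n (E.K n) (E.keyCode n)) (cd : Coding G)
  (S : QStrat G (QubitSpace n))

variable {E} in
-- In an encryption the pair of `k` and `k̂` is drawn without regard to the state, so `k̂` from an
-- evaluation carries almost no trace of the answers. The simulator may therefore take `k̂` from an
-- evaluation unrelated to the answers it gives.
theorem close_evalMeasure_key (hF : E.EvalForm) : ∃ ε, Negligible ε ∧
    ∀ l sk, E.IsKey l sk → ∀ k ∈ (E.pad sk cd.ctxLen).support, ∀ C : Finset Q,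
      Close (ε l) ((evalMeasure E cd S l k C).map fun r => r.1.2)
        ((E.pad sk n).map Prod.snd) := by
  obtain ⟨ε, hε, h⟩ := hF.abs_sub_le (isCircuit_measureCircuit cd S)
  refine ⟨ε, hε, fun l sk hsk k hk C f hf => ?_⟩
  have h1 := h l sk hsk k hk (S.ψ : QubitSpace n).ofLp (basisKet (cd.ctx C)) (ofLp_ψ_ne_zero S)
    (basisKet_ne_zero _) (fun r _ => f r.2) (fun r => isEffect_const (hf _).1 (hf _).2)
    fun r _ => hf _
  simp only [expect_const] at h1
  rw [expect_map _ _ hf.isBdd, expect_map _ _ hf.isBdd]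
  exact h1

/-- The auxiliary messages of the quantum simulator. -/
def simAux : Aux where
  State := Unit
  first l t₁ t₂ _ := (evalOut E cd S l t₁).bind fun r =>
    (P.samp.run t₂).map fun s' => (Data.node r.1.snd s', ())
  second _ _ _ _ := PMF.pure Data.nil

/-- The execution with the quantum simulator after the first message. -/
def simSteps (l : ℕ) (sk : Data) (C : G.contexts) (c : Data) : PMF (CompiledState G × Transcript) :=
  (S.outcome S.ψ C.1).bind fun a => (E.encBits sk (cd.vec C.1 a)).bind fun t₃ =>
    (evalOut E cd S l c).bind fun r => finish E P cd S l sk C c t₃ r.1.snd (S.proj C.1 a S.ψ)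

variable {E}

theorem simulator_first (l : ℕ) {s : CompiledState G} {c : Data} (t₂ : Data)
    (h : E.decFun s.sk c = ofBits (cd.ctx s.C.1)) :
    (quSimulator (compiledMaps G E P cd) S (simAux E P cd S)).first l s c t₂ =
      (S.outcome S.ψ s.C.1).bind fun a => (E.encBits s.sk (cd.vec s.C.1 a)).bind fun t₃ =>
        (evalOut E cd S l c).bind fun r => (P.samp.run t₂).map fun s' =>
          (t₃, Data.node r.1.snd s', ((), S.proj s.C.1 a S.ψ)) := by
  have h1 := ask₁_compiled E P cd h
  have h2 : ∀ R : Finset Q, R = s.C.1 → ((S.outcome S.ψ R).bind fun a =>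
      (E.encBits s.sk (cd.vec R a)).bind fun t₃ => ((simAux E P cd S).first l c t₂ t₃).map fun r =>
        (t₃, r.1, (r.2, S.proj R a S.ψ))) =
      (S.outcome S.ψ s.C.1).bind fun a => (E.encBits s.sk (cd.vec s.C.1 a)).bind fun t₃ =>
        (evalOut E cd S l c).bind fun r => (P.samp.run t₂).map fun s' =>
          (t₃, Data.node r.1.snd s', ((), S.proj s.C.1 a S.ψ)) := by
    rintro R rfl
    simp only [simAux, PMF.map_bind, PMF.map_comp]
    rfl
  exact h2 _ h1

theorem simulator_second (s : CompiledState G) (u : QubitSpace n) (q : Q) (t₆ : Data) :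
    (quSimulator (compiledMaps G E P cd) S (simAux E P cd S)).second ((), u) s (cd.que q) t₆ =
      (answer cd S u q).map fun a => (a, Data.nil) := by
  have h1 := ask₂_compiled E P cd s q
  have h2 : ∀ R : Finset Q, R = {q} → ((S.outcome u R).bind fun a =>
      ((compiledMaps G E P cd).ans₂ s R a).bind fun t₇ => (PMF.pure Data.nil).map fun t₈ =>
        (t₇, t₈)) = (answer cd S u q).map fun a => (a, Data.nil) := by
    rintro R rfl
    simp only [ans₂_compiled, PMF.pure_bind, PMF.pure_map, answer, PMF.map_comp]
    rfl
  exact h2 _ h1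

theorem simulator_steps (l : ℕ) {sk : Data} {C : G.contexts} {c : Data}
    (h : E.decFun sk c = ofBits (cd.ctx C.1)) :
    ((P.gen.run (Data.unary l)).bind fun keys =>
      ((quSimulator (compiledMaps G E P cd) S (simAux E P cd S)).first l ⟨sk, keys.snd, C⟩ c
        keys.fst).bind fun m => (Game.ask C).bind fun q =>
          ((quSimulator (compiledMaps G E P cd) S (simAux E P cd S)).second m.2.2 ⟨sk, keys.snd, C⟩
            (cd.que q) (E.keyCode n (sentKey E P sk keys m.2.1))).map fun r =>
              record E P cd sk keys C c m.1 m.2.1 q r) = simSteps E P cd S l sk C c := by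
  have e : ∀ keys, ((quSimulator (compiledMaps G E P cd) S (simAux E P cd S)).first l
      ⟨sk, keys.snd, C⟩ c keys.fst).bind (fun m => (Game.ask C).bind fun q =>
          ((quSimulator (compiledMaps G E P cd) S (simAux E P cd S)).second m.2.2 ⟨sk, keys.snd, C⟩
            (cd.que q) (E.keyCode n (sentKey E P sk keys m.2.1))).map fun r =>
              record E P cd sk keys C c m.1 m.2.1 q r) =
      (S.outcome S.ψ C.1).bind fun a => (E.encBits sk (cd.vec C.1 a)).bind fun t₃ =>
        (evalOut E cd S l c).bind fun r => (P.samp.run keys.fst).bind fun s' =>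
          (Game.ask C).bind fun q => (answer cd S (S.proj C.1 a S.ψ) q).map fun x =>
            record E P cd sk keys C c t₃ (Data.node r.1.snd s') q (x, Data.nil) := by
    intro keys
    refine (congrArg (fun p : PMF (Data × Data × Unit × QubitSpace n) => p.bind _)
      (simulator_first P cd S l (s := ⟨sk, keys.snd, C⟩) keys.fst h)).trans ?_
    refine (PMF.bind_bind _ _ _).trans (congrArg _ (funext fun a => ?_))
    refine (PMF.bind_bind _ _ _).trans (congrArg _ (funext fun t₃ => ?_))
    refine (PMF.bind_bind _ _ _).trans (congrArg _ (funext fun r => ?_))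
    refine (PMF.bind_map _ _ _).trans (congrArg _ (funext fun s' => congrArg _ (funext fun q => ?_)))
    exact (congrArg (PMF.map _) (simulator_second P cd S ⟨sk, keys.snd, C⟩ _ q _)).trans
      (PMF.map_comp _ _ _)
  refine (congrArg _ (funext e)).trans ?_
  refine (PMF.bind_comm _ _ _).trans (congrArg _ (funext fun a => ?_))
  refine (PMF.bind_comm _ _ _).trans (congrArg _ (funext fun t₃ => ?_))
  refine (PMF.bind_comm _ _ _).trans (congrArg _ (funext fun r => ?_))
  simp only [finish, ← PMF.bind_pure_comp]
  exact PMF.bind_pair_comm (P.gen.run (Data.unary l)) (fun keys => P.samp.run keys.fst)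
    (Game.ask C) (fun q => answer cd S (S.proj C.1 a S.ψ) q) _

/-- If the context decrypts correctly, the simulator is asked for `C` and produces `simSteps`. This
differs from the ideal steps only in the origin of `k̂`, and the ideal execution is close to the
honest one. -/
theorem simulation_compiled (hE : E.WellFormed) (hF : E.EvalForm) (hEc : E.Correct)
    (hP : P.Correct (E.U n)) (hPr : P.RangeSampling) : ∃ x, ∃ ε, Negligible ε ∧ ∀ l,
      tv ((compiled G E P cd).transcript (quSimulator (compiledMaps G E P cd) S x) l)
        ((compiled G E P cd).transcript ((honest G E P cd S).withInfo _) l) ≤ ε l := by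
  obtain ⟨ε, hε, h1⟩ := exec_honest_close_idealExec P cd S hE hF hEc hP hPr
  obtain ⟨δ, hδ, h2⟩ := hF.decBits hEc cd.ctxLen
  obtain ⟨η, hη, h3⟩ := close_evalMeasure_key cd S hF
  refine ⟨simAux E P cd S, _, (hδ.add hη).add hε, fun l => Close.tv_le (Close.map ?_ _)⟩
  refine Close.trans ?_ (h1 l).symm
  refine Close.trans_eq ?_ (exec_compiled E P cd _ l)
  refine Close.bind_left fun sk hsk => Close.bind_left fun C _ => ?_
  refine Close.trans (close_bind_of_good (g' := simSteps E P cd S l sk C) _ (h2 l sk hsk _)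
    fun c _ hc => simulator_steps P cd S l hc) ?_
  rw [hE.encBits_eq l sk hsk, PMF.bind_map, PMF.bind_map]
  refine Close.bind_left fun k hk => Close.bind_left fun a _ => Close.bind_left fun t₃ _ => ?_
  have e1 := evalOut_bind E cd S l k C.1 (R := fun _ kh _ =>
    finish E P cd S l sk C (ctxCipher E cd k C.1) t₃ kh (S.proj C.1 a S.ψ)) fun _ _ _ _ _ => rfl
  have e2 := (h3 l sk hsk k hk C.1).bind_right fun kh =>
    finish E P cd S l sk C (ctxCipher E cd k C.1) t₃ kh (S.proj C.1 a S.ψ)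
  rw [PMF.bind_map, PMF.bind_map] at e2
  exact e2.trans_eq e1

end Simulation

/-- The classical evaluation of a classical circuit yields an encryption of the output. -/
theorem QFHE.EvalForm.close_cEval {E : QFHE} (hF : E.EvalForm) (hCl : E.ClassicalEval) {m m' : ℕ}
    (f : Bits m → Bits m') : ∃ ε, Negligible ε ∧ ∀ l sk, E.IsKey l sk →
      ∀ k ∈ (E.pad sk m).support, ∀ x : Bits m,
      Close (ε l) ((E.cEval f).run (Data.node (Data.unary l)
        (Data.node (ofBits (E.perm m k.1 x)) k.2))) (E.encBits sk (f x)) := by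
  obtain ⟨ε, hε, h⟩ := hF.close_ofFun f
  refine ⟨ε, hε, fun l sk hsk k hk x => (h l sk hsk k hk x).trans_eq ?_⟩
  obtain ⟨z, _, hz⟩ := E.out_eval_basis (Circuit.ofFun f) l k.1 k.2 (basisKet Fin.elim0) x
  rw [hCl f l sk hsk k hk, hz, PMF.map_comp]
  rfl

/-! ### Faithfulness: classical completeness -/

section Classical

variable {G : Game Q} (E : QFHE) {n : ℕ} (P : OPad n (E.K n) (E.keyCode n)) (cd : Coding G)
  (S : QStrat G (QubitSpace n))

/-- The answers of a truth table, as a function of the encoded context. -/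
def tableAnswers (τ : Q → G.A) (y : Bits cd.ctxLen) : Bits cd.vecLen :=
  open scoped Classical in
  if h : ∃ C, C ∈ G.contexts ∧ cd.ctx C = y then cd.vec h.choose (G.restrict τ _)
  else fun _ => false

theorem tableAnswers_ctx (τ : Q → G.A) {C : Finset Q} (hC : C ∈ G.contexts) :
    tableAnswers cd τ (cd.ctx C) = cd.vec C (G.restrict τ C) := by
  have h : ∃ C', C' ∈ G.contexts ∧ cd.ctx C' = cd.ctx C := ⟨C, hC, rfl⟩
  rw [tableAnswers, dif_pos h, cd.ctx_inj h.choose_spec.1 hC h.choose_spec.2]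

/-- The first message of a classical prover with the truth table `τ`; its state is `d`. -/
def classicalFirst (τ : Q → G.A) (d l t₁ t₂ : Data) : PMF Data :=
  ((E.cEval (tableAnswers cd τ)).run (Data.node l t₁)).bind fun t₃ =>
    ((E.cEval fun (_ : Bits cd.ctxLen) (_ : Fin n) => false).run (Data.node l t₁)).bind fun c' =>
      (P.samp.run t₂).bind fun s' =>
        PMF.pure (Data.node t₃ (Data.node (Data.node c'.snd s') d))

theorem polyTime_classicalFirst (τ : Q → G.A) : PolyTime fun x =>
    classicalFirst E P cd τ x.fst x.snd.fst x.snd.snd.fst x.snd.snd.snd := by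
  have h1 : PolyTime fun x => (E.cEval (tableAnswers cd τ)).run
      (Data.node x.snd.fst x.snd.snd.fst) :=
    (PPT.polyTime _).comp (Computable.id.snd.fst.node Computable.id.snd.snd.fst)
  have h2 : PolyTime fun x => (E.cEval fun (_ : Bits cd.ctxLen) (_ : Fin n) => false).run
      (Data.node x.fst.snd.fst x.fst.snd.snd.fst) :=
    (PPT.polyTime _).comp (Computable.id.fst.snd.fst.node Computable.id.fst.snd.snd.fst)
  have h3 : PolyTime fun x => P.samp.run x.fst.fst.snd.snd.snd :=
    (PPT.polyTime _).comp Computable.id.fst.fst.snd.snd.snd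
  have h4 : Computable fun x => Data.node x.fst.fst.snd
      (Data.node (Data.node x.fst.snd.snd x.snd) x.fst.fst.fst.fst) :=
    Computable.id.fst.fst.snd.node
      ((Computable.id.fst.snd.snd.node Computable.id.snd).node Computable.id.fst.fst.fst.fst)
  exact h1.bind (h2.bind (h3.bind (PolyTime.pure h4)))

/-- The seed names one of finitely many truth tables, and each of them has its own algorithm
`cEval`; all of these are hard-wired in one program. -/
theorem exists_classicalFirst : ∃ A : PPT, ∀ τ l t₁ t₂,
    A.run (Data.node (tableCode G τ) (Data.node l (Data.node t₁ t₂))) =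
      classicalFirst E P cd τ (tableCode G τ) l t₁ t₂ := by
  obtain ⟨A, hA⟩ := (PolyTime.cases (tableCode_injective G) Computable.id.fst
    (polyTime_classicalFirst E P cd) (PolyTime.pure Computable.id)).exists_ppt
  refine ⟨A, fun τ l t₁ t₂ => ?_⟩
  rw [hA]
  beta_reduce
  rw [Data.fst_node, (partialInv_eq_some (tableCode_injective G)).2 rfl]
  rfl

theorem exists_classicalSecond : ∃ A : PPT, ∀ τ q t₆,
    A.run (Data.node (tableCode G τ) (Data.node (cd.que q) t₆)) =
      PMF.pure (Data.node (cd.ans (τ q)) Data.nil) := by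
  have hk : Function.Injective fun p : (Q → G.A) × Q => Data.node (tableCode G p.1) (cd.que p.2) := by
    intro p p' h
    simp only [Data.node.injEq] at h
    exact Prod.ext (tableCode_injective G h.1) (cd.que_inj h.2)
  obtain ⟨A, hA⟩ := (PolyTime.pure ((Computable.table hk
    (fun p => Data.node (cd.ans (p.1 p.2)) Data.nil) Data.nil).comp
      (Computable.id.fst.node Computable.id.snd.fst))).exists_ppt
  refine ⟨A, fun τ q t₆ => ?_⟩
  have h := (partialInv_eq_some hk (a := (τ, q))).2 rfl
  simp only at h
  rw [hA]
  beta_reduce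
  rw [Data.fst_node, Data.snd_node, Data.fst_node, h]
  rfl

/-- The truth table given by a joint measurement of all observables. -/
def toTable (b : ↥(Finset.univ : Finset Q) → G.A) (q : Q) : G.A := b ⟨q, Finset.mem_univ q⟩

theorem toTable_finite (p : PMF (↥(Finset.univ : Finset Q) → G.A)) :
    (p.map fun b => tableCode G (toTable b)).support.Finite := by
  rw [PMF.support_map]
  exact (Set.toFinite _).image _

/-- The last steps of an execution with answers from a truth table. -/
def tableFinish (l : ℕ) (sk : Data) (C : G.contexts) (c : Data) (τ : Q → G.A) (t₃ kh : Data) :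
    PMF (CompiledState G × Transcript) :=
  (Game.ask C).bind fun q => (P.gen.run (Data.unary l)).bind fun keys =>
    (P.samp.run keys.fst).map fun s' =>
      record E P cd sk keys C c t₃ (Data.node kh s') q (cd.ans (τ q), Data.nil)

theorem finish_eigen (l : ℕ) (sk : Data) (C : G.contexts) (c t₃ kh : Data) {u : QubitSpace n}
    (hu : u ≠ 0) (τ : Q → G.A) (hua : u ∈ S.eigen C.1 (G.restrict τ C.1)) :
    finish E P cd S l sk C c t₃ kh u = tableFinish E P cd l sk C c τ t₃ kh := by
  refine bind_congr_support fun q hq => ?_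
  rw [answer_eigen cd S hu hua (Game.mem_of_mem_ask hq), PMF.pure_bind]
  rfl

/-- When all observables commute, they have a joint measurement whose marginal on `C` is the
measurement of `C`. Its outcome is a truth table, fixed before the context is known, and the
repeated measurement of `q` reads the same table since the state is an eigenvector. -/
theorem idealSteps_table (hS : ∀ q q', Commute (S.O q) (S.O q')) (l : ℕ) (sk : Data)
    (C : G.contexts) (c : Data) : idealSteps E P cd S l sk C c =
      (S.outcome S.ψ Finset.univ).bind fun b =>
        (E.encBits sk (cd.vec C.1 (G.restrict (toTable b) C.1))).bind fun t₃ =>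
          ((E.pad sk n).map Prod.snd).bind fun kh =>
            tableFinish E P cd l sk C c (toTable b) t₃ kh := by
  have h := S.outcome_map_restrict (Finset.subset_univ C.1) (R' := Finset.univ)
    (fun q _ q' _ => hS q q') S.ψ_ne_zero
  rw [idealSteps, ← h, PMF.bind_map]
  refine bind_congr_support fun b hb => ?_
  refine congrArg (PMF.bind (E.encBits sk (cd.vec C.1 (G.restrict (toTable b) C.1))))
    (funext fun t₃ => ?_)
  rw [PMF.bind_map]
  refine congrArg _ (funext fun k => ?_)
  refine finish_eigen E P cd S l sk C c t₃ k.2 ?_ (toTable b) (S.proj_mem _ _ _)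
  rw [← S.mem_support_outcome (S.compatible_context C.2) S.ψ_ne_zero, ← h]
  exact (PMF.mem_support_map_iff _ _ _).2 ⟨b, hb, rfl⟩

/-- The execution with the classical prover after the first message. -/
def classicalSteps (l : ℕ) (sk : Data) (C : G.contexts) (c : Data) :
    PMF (CompiledState G × Transcript) :=
  (S.outcome S.ψ Finset.univ).bind fun b =>
    ((E.cEval (tableAnswers cd (toTable b))).run (Data.node (Data.unary l) c)).bind fun t₃ =>
      ((E.cEval fun (_ : Bits cd.ctxLen) (_ : Fin n) => false).run
        (Data.node (Data.unary l) c)).bind fun c' =>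
          tableFinish E P cd l sk C c (toTable b) t₃ c'.snd

/-- The classical prover that measures all observables beforehand. -/
def classicalProver (A₁ A₂ : PPT) : PPTProver where
  seed := (S.outcome S.ψ Finset.univ).map fun b => tableCode G (toTable b)
  seed_finite := toTable_finite _
  A₁ := A₁
  A₂ := A₂

theorem exec_classicalProver {A₁ A₂ : PPT}
    (h₁ : ∀ τ l t₁ t₂, A₁.run (Data.node (tableCode G τ) (Data.node l (Data.node t₁ t₂))) =
      classicalFirst E P cd τ (tableCode G τ) l t₁ t₂)
    (h₂ : ∀ τ q t₆, A₂.run (Data.node (tableCode G τ) (Data.node (cd.que q) t₆)) =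
      PMF.pure (Data.node (cd.ans (τ q)) Data.nil)) (l : ℕ) :
    (compiled G E P cd).exec ((classicalProver S A₁ A₂).toProver.withInfo _) l =
      (E.gen.run (Data.unary l)).bind fun sk => G.D.bind fun C =>
        (E.encBits sk (cd.ctx C.1)).bind fun c => classicalSteps E P cd S l sk C c := by
  have e : ∀ (sk keys c : Data) (C : G.contexts),
      ((classicalProver S A₁ A₂).toProver.first l () c keys.fst).bind (fun m =>
        (Game.ask C).bind fun q => ((classicalProver S A₁ A₂).toProver.second m.2.2 () (cd.que q)
          (E.keyCode n (sentKey E P sk keys m.2.1))).map fun r =>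
            record E P cd sk keys C c m.1 m.2.1 q r) =
      (S.outcome S.ψ Finset.univ).bind fun b =>
        ((E.cEval (tableAnswers cd (toTable b))).run (Data.node (Data.unary l) c)).bind fun t₃ =>
          ((E.cEval fun (_ : Bits cd.ctxLen) (_ : Fin n) => false).run
            (Data.node (Data.unary l) c)).bind fun c' => (P.samp.run keys.fst).bind fun s' =>
              (Game.ask C).map fun q => record E P cd sk keys C c t₃ (Data.node c'.snd s') q
                (cd.ans (toTable b q), Data.nil) := by
    intro sk keys c C
    have e1 : (classicalProver S A₁ A₂).toProver.first l () c keys.fst =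
        (S.outcome S.ψ Finset.univ).bind fun b =>
          ((E.cEval (tableAnswers cd (toTable b))).run (Data.node (Data.unary l) c)).bind fun t₃ =>
            ((E.cEval fun (_ : Bits cd.ctxLen) (_ : Fin n) => false).run
              (Data.node (Data.unary l) c)).bind fun c' => (P.samp.run keys.fst).map fun s' =>
                (t₃, Data.node c'.snd s', tableCode G (toTable b)) := by
      simp only [PPTProver.toProver, classicalProver, PMF.bind_map, Function.comp_def, h₁,
        classicalFirst, PMF.map_bind, PMF.pure_map, Data.fst_node, Data.snd_node]
      rfl
    have e2 : ∀ τ q t₆, (classicalProver S A₁ A₂).toProver.second (tableCode G τ) () (cd.que q) t₆ =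
        PMF.pure (cd.ans (τ q), Data.nil) := by
      intro τ q t₆
      simp only [PPTProver.toProver, classicalProver, h₂, PMF.pure_map, Data.fst_node,
        Data.snd_node]
    refine (congrArg (fun p : PMF (Data × Data × Data) => p.bind _) e1).trans ?_
    refine (PMF.bind_bind _ _ _).trans (congrArg _ (funext fun b => ?_))
    refine (PMF.bind_bind _ _ _).trans (congrArg _ (funext fun t₃ => ?_))
    refine (PMF.bind_bind _ _ _).trans (congrArg _ (funext fun c' => ?_))
    refine (PMF.bind_map _ _ _).trans (congrArg _ (funext fun s' => ?_))
    refine Eq.trans ?_ (PMF.bind_pure_comp _ _)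
    refine congrArg _ (funext fun q => ?_)
    exact (congrArg (PMF.map _) (e2 (toTable b) q _)).trans (PMF.pure_map _ _)
  refine (exec_compiled E P cd _ l).trans ?_
  refine congrArg _ (funext fun sk => congrArg _ (funext fun C => congrArg _ (funext fun c => ?_)))
  refine (congrArg _ (funext fun keys => e sk keys c C)).trans ?_
  refine (PMF.bind_comm _ _ _).trans (congrArg _ (funext fun b => ?_))
  refine (PMF.bind_comm _ _ _).trans (congrArg _ (funext fun t₃ => ?_))
  refine (PMF.bind_comm _ _ _).trans (congrArg _ (funext fun c' => ?_))
  simp only [tableFinish, ← PMF.bind_pure_comp]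
  refine Eq.trans (congrArg _ (funext fun keys => PMF.bind_comm _ _ _)) ?_
  exact PMF.bind_comm _ _ _

variable {E}

/-- The prover takes a truth table from the joint measurement as its seed, which is a fixed finite
distribution. It evaluates the table classically on the encrypted context, samples `s'`, and answers
`q` from the table; this imitates the ideal execution. -/
theorem classicalCompleteness_compiled (hE : E.WellFormed) (hF : E.EvalForm) (hEc : E.Correct)
    (hCl : E.ClassicalEval) (hP : P.Correct (E.U n)) (hPr : P.RangeSampling)
    (hS : ∀ q q', Commute (S.O q) (S.O q')) : ∃ A : PPTProver, ∃ ε, Negligible ε ∧ ∀ l,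
      tv ((compiled G E P cd).transcript (A.toProver.withInfo _) l)
        ((compiled G E P cd).transcript ((honest G E P cd S).withInfo _) l) ≤ ε l := by
  obtain ⟨ε, hε, h1⟩ := exec_honest_close_idealExec P cd S hE hF hEc hP hPr
  choose δ hδ h2 using fun τ : Q → G.A => hF.close_cEval hCl (tableAnswers cd τ)
  -- Evaluating a constant circuit gives a nearly fresh encryption of `n` zero bits. Only its part
  -- `k̂` is used, and that has the distribution of `k̂` in an encryption of any `n`-qubit state.
  obtain ⟨η, hη, h3⟩ := hF.close_cEval hCl fun (_ : Bits cd.ctxLen) (_ : Fin n) => false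
  obtain ⟨A₁, hA₁⟩ := exists_classicalFirst E P cd
  obtain ⟨A₂, hA₂⟩ := exists_classicalSecond cd
  refine ⟨classicalProver S A₁ A₂, _,
    ((Negligible.sum Finset.univ fun τ _ => (hδ τ).abs).add hη).add hε,
    fun l => Close.tv_le (Close.map ?_ _)⟩
  refine Close.trans ?_ (h1 l).symm
  refine Close.trans_eq ?_ (exec_classicalProver E P cd S hA₁ hA₂ l)
  refine Close.bind_left fun sk hsk => Close.bind_left fun C _ => ?_
  rw [hE.encBits_eq l sk hsk, PMF.bind_map, PMF.bind_map]
  refine Close.bind_left fun k hk => ?_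
  simp only [Function.comp_apply, idealSteps_table E P cd S hS, classicalSteps]
  refine Close.bind_left fun b _ => ?_
  have e1 := h2 (toTable b) l sk hsk k hk (cd.ctx C.1)
  rw [tableAnswers_ctx cd _ C.2] at e1
  have e2 : δ (toTable b) l ≤ ∑ τ, |δ τ l| := (le_abs_self _).trans
    (Finset.single_le_sum (f := fun τ => |δ τ l|) (fun _ _ => abs_nonneg _) (Finset.mem_univ _))
  refine ((e1.bind_right _).mono e2).trans (Close.bind_left fun t₃ _ => ?_)
  have e3 := (h3 l sk hsk k hk (cd.ctx C.1)).bind_right fun c' =>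
    tableFinish E P cd l sk C (Data.node (ofBits (E.perm cd.ctxLen k.1 (cd.ctx C.1))) k.2)
      (toTable b) t₃ c'.snd
  rw [hE.encBits_eq l sk hsk, PMF.bind_map] at e3
  rw [PMF.bind_map]
  exact e3

end Classical

end Contextuality

end

/-! ### The theorem -/

theorem mainTheorem3 {Q : Type} [Fintype Q] [DecidableEq Q]
    (G : Game Q) (hG : G.valNC < 1)
    (E : QFHE) (hE : E.WellFormed) (hEcorrect : E.Correct) (hEsecure : E.Secure)
    (hEclassical : E.ClassicalEval)
    {n : ℕ} (S : QStrat G (QubitSpace n)) (hS : S.val = G.valQu)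
    (P : OPad n (E.K n) (E.keyCode n)) (hPcorrect : P.Correct (E.U n)) (hPsound : P.Sound)
    (hPrange : P.RangeSampling)
    (cd : Coding G) :
    ((honest G E P cd S).IsQPT ∧ ∃ ε, Negligible ε ∧ ∀ l : ℕ,
      G.valQu - ε l ≤ (compiled G E P cd).winProb ((honest G E P cd S).withInfo _) l) ∧
    (∀ A : PPTProver, ∃ ε, Negligible ε ∧ ∀ l : ℕ,
      (compiled G E P cd).winProb (A.toProver.withInfo _) l ≤ 1 - G.const₁ + ε l) ∧
    (E.EvalForm → Faithful G (compiled G E P cd) (compiledMaps G E P cd) (honest G E P cd)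
      (1 - G.const₁) G.valQu) := by
  refine ⟨⟨honest_isQPT S, ?_⟩, fun A => winProb_toProver_le G E P cd hG hE hEsecure hPsound A,
    fun hF => ?_⟩
  · obtain ⟨ε, hε, h⟩ := winProb_honest_close E P cd S hE hEcorrect hPcorrect hPrange
    exact ⟨ε, hε, fun l => by linarith [(abs_le.1 (h l)).1]⟩
  · exact
      { wellFormed := wellFormed_compiled E P cd hF hEcorrect
        isQPT := fun S' => honest_isQPT S'
        marginal := fun S₁ S₂ C _ hψ hO =>
          marginal_compiled E P cd hE hF hEcorrect hPcorrect hPrange S₁ S₂ C hψ hO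
        soundness := soundness_compiled E P cd hG hF hEcorrect
        decision := decision_compiled E P cd hF hEcorrect
        completeness := ⟨S, hS ▸ winProb_honest_close E P cd S hE hEcorrect hPcorrect hPrange⟩
        simulation := fun S' =>
          simulation_compiled P cd S' hE hF hEcorrect hPcorrect hPrange
        classicalCompleteness := fun S' hcomm =>
          classicalCompleteness_compiled P cd S' hE hF hEcorrect hEclassical hPcorrect hPrange
            hcomm }
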